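/- Let $k$ be an algebraically closed field. By an algebra we mean a finite dimensional basic connected $k$-algebra, and by a module a finite dimensional left module. A path of length $n\ge 1$ in a quiver is a sequence $\sigma=\alpha_1\cdots\alpha_n$ of arrows with $s\alpha_i=t\alpha_{i+1}$ for all $1\le i<n$ (where $s$ and $t$ denote the starting and the terminating vertex); we put $t\sigma=t\alpha_1$, $s\sigma=s\alpha_n$. A bound quiver $(\Delta,R)$, with $R$ a set of paths, consists of a finite quiver $\Delta$ and a minimal set $R$ of paths of length at least $2$ (minimal: no $\rho\in R$ lies in the ideal $\langle R\setminus\{\rho\}\rangle$ of $k\Delta$) such that all sufficiently long paths lie in the ideal $\langle R\rangle$; its bound quiver algebra is $k\Delta/\langle R\rangle$. It is gentle if $\Delta$ is connected, $R$ consists of paths of length two, at most two arrows start and at most two arrows terminate at each vertex, and for each arrow $\alpha$ there is at most one arrow $\beta$ with $t\beta=s\alpha$ and $\alpha\beta\notin R$, at most one arrow $\beta$ with $t\beta=s\alpha$ and $\alpha\beta\in R$, at most one arrow $\beta$ with $s\beta=t\alpha$ and $\beta\alpha\notin R$, and at most one arrow $\beta$ with $s\beta=t\alpha$ and $\beta\alpha\in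 R$. For an algebra $\Lambda$, a $\Lambda$-module $T$ is tilting (respectively cotilting) if $\operatorname{pd}_\Lambda T\le 1$ (respectively $\operatorname{id}_\Lambda T\le 1$), $\operatorname{Ext}^1_\Lambda(T,T)=0$, and $T$ is a direct sum of precisely $\operatorname{rk}K_0(\Lambda)$ pairwise nonisomorphic indecomposable modules, where $K_0(\Lambda)$ is the Grothendieck group of the category of $\Lambda$-modules. Algebras $\Lambda$ and $\Lambda'$ are tilting-cotilting equivalent if there is a sequence of algebras $\Lambda=A_0,A_1,\dots,A_n=\Lambda'$ such that for each $1\le i\le n$ there is a tilting or cotilting $A_{i-1}$-module $T_{i-1}$ with $A_i\simeq\operatorname{End}_{A_{i-1}}(T_{i-1})^{\mathrm{op}}$ as $k$-algebras. For integers $p\ge 1$ and $0\le r\le p-1$, let $\Lambda_0(p,r)$ be the bound quiver algebra of the quiver with vertices $0,1,\dots,p$, arrows $\alpha_i:i\to i-1$ for $1\le i\le p$ and two arrows $\beta,\gamma:0\to p$, bound by the relations $\alpha_p\beta$, $\alpha_i\alpha_{i+1}$ for $1\le i\le r$, and $\gamma\alpha_1$. **Proposition.** Let $p_1,p_2,p_3\ge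 1$, and let $\Delta$ be the quiver with two distinguished vertices $u\ne v$ which is made of three paths: a path $\alpha_1\cdots\alpha_{p_1}$ from $v$ to $u$, a path $\beta_1\cdots\beta_{p_2}$ from $u$ to $v$, and a path $\gamma_1\cdots\gamma_{p_3}$ from $v$ to $u$, whose arrows are pairwise distinct and whose inner vertices ($p_1-1$, $p_2-1$ and $p_3-1$ of them, respectively) are pairwise distinct and different from $u$ and $v$. If $(\Delta,R)$ is a gentle bound quiver such that $\beta_{p_2}\alpha_1\in R$ and $\gamma_{p_3}\beta_1\in R$, then the bound quiver algebra of $(\Delta,R)$ is tilting-cotilting equivalent to $\Lambda_0(p,r)$ for some $p\ge 1$ and $0\le r\le p-1$. -/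

import Mathlib

open CategoryTheory

universe u

/-! ### Quivers and paths -/

/-- A finite quiver: finite sets of vertices and arrows, with source and target maps. -/
structure FinQuiver where
  V : Type
  A : Type
  [fintypeV : Fintype V]
  [fintypeA : Fintype A]
  s : A → V
  t : A → V

attribute [instance] FinQuiver.fintypeV FinQuiver.fintypeA

namespace FinQuiver

variable (Q : FinQuiver)

/-- `Q.IsWalk x [a₁, …, aₙ] y` means `t a₁ = x`, `s aᵢ = t aᵢ₊₁` for `1 ≤ i < n` and `s aₙ = y`
(and `x = y` if `n = 0`): paths are written as compositions of maps. -/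
def IsWalk : Q.V → List Q.A → Q.V → Prop
  | x, [], y => x = y
  | x, a :: l, y => Q.t a = x ∧ IsWalk (Q.s a) l y

/-- The paths `a₁ ⋯ aₙ` of a quiver, including the trivial path of length `0` at each vertex. -/
@[ext]
structure Path where
  tgt : Q.V
  src : Q.V
  arrows : List Q.A
  isWalk : Q.IsWalk tgt arrows src

variable {Q}

theorem IsWalk.append {x y z : Q.V} {l m : List Q.A} (h : Q.IsWalk x l y) (h' : Q.IsWalk y m z) :
    Q.IsWalk x (l ++ m) z := by
  induction l generalizing x with
  | nil =>
    have h0 : x = y := h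
    subst h0
    exact h'
  | cons a l ih => exact ⟨h.1, ih h.2⟩

/-- The length of a path. -/
def Path.length (p : Q.Path) : ℕ := p.arrows.length

/-- The trivial path at a vertex. -/
def Path.trivial (x : Q.V) : Q.Path := ⟨x, x, [], rfl⟩

/-- The composition `p q` of two paths, defined if `s p = t q`. -/
def Path.comp (p q : Q.Path) (h : p.src = q.tgt) : Q.Path :=
  ⟨p.tgt, q.src, p.arrows ++ q.arrows, p.isWalk.append (h ▸ q.isWalk)⟩

/-! ### The path algebra -/

/-- The path algebra `kQ`: the vector space with basis the paths of `Q`. -/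
def PathAlgebra (k : Type u) [Field k] (Q : FinQuiver) : Type u := Q.Path →₀ k

namespace PathAlgebra

variable (k : Type u) [Field k]

noncomputable instance : AddCommGroup (PathAlgebra k Q) := inferInstanceAs (AddCommGroup (Q.Path →₀ k))

noncomputable instance : Module k (PathAlgebra k Q) := inferInstanceAs (Module k (Q.Path →₀ k))

/-- The basis of the path algebra formed by the paths. -/
noncomputable def basis : Module.Basis Q.Path k (PathAlgebra k Q) :=
  Module.Basis.ofRepr (LinearEquiv.refl k (Q.Path →₀ k))

/-- The basis element of the path algebra given by a path. -/
noncomputable def ofPath (p : Q.Path) : PathAlgebra k Q := basis k p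

open Classical in
/-- The product of two basis elements: the composition of the paths if they are composable, and
zero otherwise. -/
noncomputable def mulPath (p q : Q.Path) : PathAlgebra k Q :=
  if h : p.src = q.tgt then ofPath k (p.comp q h) else 0

/-- The bilinear extension of `mulPath`. -/
noncomputable def mulLin : PathAlgebra k Q →ₗ[k] PathAlgebra k Q →ₗ[k] PathAlgebra k Q :=
  (basis k).constr k fun p => (basis k).constr k fun q => mulPath k p q

noncomputable instance : Mul (PathAlgebra k Q) := ⟨fun f g => mulLin k f g⟩

noncomputable instance : One (PathAlgebra k Q) := ⟨∑ x : Q.V, ofPath k (Path.trivial x)⟩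

variable {k}

theorem mul_def (f g : PathAlgebra k Q) : f * g = mulLin k f g := rfl

theorem one_def : (1 : PathAlgebra k Q) = ∑ x : Q.V, ofPath k (Path.trivial x) := rfl

theorem ofPath_mul_ofPath (p q : Q.Path) : ofPath k p * ofPath k q = mulPath k p q := by
  rw [mul_def, mulLin, ofPath, ofPath, Module.Basis.constr_basis, Module.Basis.constr_basis]

theorem induction {P : PathAlgebra k Q → Prop} (f : PathAlgebra k Q) (h0 : P 0)
    (hadd : ∀ f g, P f → P g → P (f + g)) (hs : ∀ (c : k) (p : Q.Path), P (c • ofPath k p)) :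
    P f := by
  have hf : f ∈ Submodule.span k (Set.range (basis k (Q := Q))) := by
    rw [(basis k).span_eq]
    exact Submodule.mem_top
  rw [← Set.image_univ, Finsupp.mem_span_image_iff_linearCombination] at hf
  obtain ⟨l, -, rfl⟩ := hf
  rw [Finsupp.linearCombination_apply]
  exact Finset.sum_induction _ P hadd h0 fun p _ => hs _ p

theorem mulPath_mul (p q r : Q.Path) : mulPath k p q * ofPath k r = ofPath k p * mulPath k q r := by
  by_cases h : p.src = q.tgt <;> by_cases h' : q.src = r.tgt
  · rw [mulPath, mulPath, dif_pos h, dif_pos h', ofPath_mul_ofPath, ofPath_mul_ofPath, mulPath,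
      mulPath, dif_pos (show (p.comp q h).src = r.tgt from h'),
      dif_pos (show p.src = (q.comp r h').tgt from h)]
    congr 1
    exact Path.ext rfl rfl (List.append_assoc _ _ _)
  · rw [mulPath, mulPath, dif_pos h, dif_neg h', ofPath_mul_ofPath, mulPath,
      dif_neg (show ¬ (p.comp q h).src = r.tgt from h'), mul_def, map_zero]
  · rw [mulPath, mulPath, dif_neg h, dif_pos h', ofPath_mul_ofPath, mulPath,
      dif_neg (show ¬ p.src = (q.comp r h').tgt from h), mul_def, map_zero, LinearMap.zero_apply]
  · rw [mulPath, mulPath, dif_neg h, dif_neg h', mul_def, mul_def, map_zero, map_zero,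
      LinearMap.zero_apply]

protected theorem mul_assoc (f g h : PathAlgebra k Q) : f * g * h = f * (g * h) := by
  refine induction (P := fun f => f * g * h = f * (g * h)) f ?_ (fun a b ha hb => ?_) fun c p => ?_
  · simp only [mul_def, map_zero, LinearMap.zero_apply]
  · simp only [mul_def, map_add, LinearMap.add_apply] at ha hb ⊢
    rw [ha, hb]
  refine induction (P := fun g => c • ofPath k p * g * h = c • ofPath k p * (g * h)) g ?_ (fun a b ha hb => ?_) fun d q => ?_
  · simp only [mul_def, map_zero, LinearMap.zero_apply]
  · simp only [mul_def, map_add, LinearMap.add_apply] at ha hb ⊢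
    rw [ha, hb]
  refine induction (P := fun h => c • ofPath k p * d • ofPath k q * h = c • ofPath k p * (d • ofPath k q * h)) h ?_ (fun a b ha hb => ?_) fun e r => ?_
  · simp only [mul_def, map_zero]
  · simp only [mul_def, map_add] at ha hb ⊢
    rw [ha, hb]
  have key := mulPath_mul (k := k) p q r
  rw [← ofPath_mul_ofPath, ← ofPath_mul_ofPath] at key
  simp only [mul_def, map_smul, LinearMap.smul_apply] at key ⊢
  rw [key]

protected theorem one_mul (f : PathAlgebra k Q) : 1 * f = f := by
  refine induction (P := fun f => 1 * f = f) f ?_ (fun a b ha hb => ?_) fun c p => ?_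
  · simp only [mul_def, map_zero]
  · simp only [mul_def, map_add] at ha hb ⊢
    rw [ha, hb]
  have key : (1 : PathAlgebra k Q) * ofPath k p = ofPath k p := by
    rw [mul_def, one_def, map_sum, LinearMap.sum_apply, Finset.sum_eq_single p.tgt]
    · rw [← mul_def, ofPath_mul_ofPath, mulPath, dif_pos (show (Path.trivial p.tgt).src = p.tgt from rfl)]
      rfl
    · intro x _ hx
      rw [← mul_def, ofPath_mul_ofPath, mulPath, dif_neg (show ¬ (Path.trivial x).src = p.tgt from hx)]
    · intro h
      exact absurd (Finset.mem_univ _) h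
  rw [mul_def] at key ⊢
  rw [map_smul, key]

protected theorem mul_one (f : PathAlgebra k Q) : f * 1 = f := by
  refine induction (P := fun f => f * 1 = f) f ?_ (fun a b ha hb => ?_) fun c p => ?_
  · simp only [mul_def, map_zero, LinearMap.zero_apply]
  · simp only [mul_def, map_add, LinearMap.add_apply] at ha hb ⊢
    rw [ha, hb]
  have key : ofPath k p * (1 : PathAlgebra k Q) = ofPath k p := by
    rw [mul_def, one_def, map_sum, Finset.sum_eq_single p.src]
    · rw [← mul_def, ofPath_mul_ofPath, mulPath, dif_pos (show p.src = (Path.trivial p.src).tgt from rfl)]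
      congr 1
      exact Path.ext rfl rfl (List.append_nil _)
    · intro x _ hx
      rw [← mul_def, ofPath_mul_ofPath, mulPath,
        dif_neg (show ¬ p.src = (Path.trivial x).tgt from fun h => hx h.symm)]
    · intro h
      exact absurd (Finset.mem_univ _) h
  rw [mul_def] at key ⊢
  rw [map_smul, LinearMap.smul_apply, key]

noncomputable instance : Ring (PathAlgebra k Q) :=
  { (inferInstance : AddCommGroup (PathAlgebra k Q)),
    (inferInstance : Mul (PathAlgebra k Q)),
    (inferInstance : One (PathAlgebra k Q)) with
    mul_assoc := PathAlgebra.mul_assoc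
    one_mul := PathAlgebra.one_mul
    mul_one := PathAlgebra.mul_one
    zero_mul := fun f => by rw [mul_def, map_zero, LinearMap.zero_apply]
    mul_zero := fun f => by rw [mul_def, map_zero]
    left_distrib := fun f g h => by simp only [mul_def, map_add]
    right_distrib := fun f g h => by simp only [mul_def, map_add, LinearMap.add_apply] }

noncomputable instance : Algebra k (PathAlgebra k Q) :=
  Algebra.ofModule
    (fun c f g => by simp only [mul_def, map_smul, LinearMap.smul_apply])
    (fun c f g => by simp only [mul_def, map_smul])

end PathAlgebra

/-! ### Bound quivers -/

/-- The two-sided ideal `⟨R⟩` of the path algebra generated by a set of paths. -/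
noncomputable def relIdeal (k : Type u) [Field k] (R : Set Q.Path) :
    TwoSidedIdeal (PathAlgebra k Q) :=
  TwoSidedIdeal.span (PathAlgebra.ofPath k '' R)

/-- The algebra `kQ / ⟨R⟩`. -/
abbrev BoundQuiverAlgebra (k : Type u) [Field k] (R : Set Q.Path) : Type u :=
  (relIdeal k R).ringCon.Quotient

/-- `(Q, R)` is a bound quiver, for a set `R` of paths: the elements of `R` are relations (they have
length at least two), the set `R` is minimal, and all sufficiently long paths lie in `⟨R⟩`. -/
structure IsBoundQuiver (k : Type u) [Field k] (R : Set Q.Path) : Prop where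
  two_le_length : ∀ ρ ∈ R, 2 ≤ ρ.length
  minimal : ∀ ρ ∈ R, PathAlgebra.ofPath k ρ ∉ relIdeal k (R \ {ρ})
  admissible : ∃ n : ℕ, ∀ σ : Q.Path, n ≤ σ.length → PathAlgebra.ofPath k σ ∈ relIdeal k R

/-- The path `a b` of length two (with `s a = t b`) exists and belongs to `R`. -/
def RelMem (R : Set Q.Path) (a b : Q.A) : Prop := ∃ ρ ∈ R, ρ.arrows = [a, b]

variable (Q) in
/-- The underlying graph of the quiver is connected (and nonempty). -/
def IsConnected : Prop :=
  Nonempty Q.V ∧ ∀ x y : Q.V, Relation.EqvGen (fun x y => ∃ a : Q.A, Q.s a = x ∧ Q.t a = y) x y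

/-- Gentle bound quivers. -/
structure IsGentle (k : Type u) [Field k] (R : Set Q.Path) : Prop where
  isBoundQuiver : IsBoundQuiver k R
  connected : Q.IsConnected
  source_le_two : ∀ x : Q.V, {a : Q.A | Q.s a = x}.ncard ≤ 2
  target_le_two : ∀ x : Q.V, {a : Q.A | Q.t a = x}.ncard ≤ 2
  length_eq_two : ∀ ρ ∈ R, ρ.length = 2
  right_unique : ∀ a b b' : Q.A, Q.t b = Q.s a → ¬ RelMem R a b →
    Q.t b' = Q.s a → ¬ RelMem R a b' → b = b'
  left_unique : ∀ a b b' : Q.A, Q.s b = Q.t a → ¬ RelMem R b a →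
    Q.s b' = Q.t a → ¬ RelMem R b' a → b = b'
  right_unique_rel : ∀ a b b' : Q.A, Q.t b = Q.s a → RelMem R a b →
    Q.t b' = Q.s a → RelMem R a b' → b = b'
  left_unique_rel : ∀ a b b' : Q.A, Q.s b = Q.t a → RelMem R b a →
    Q.s b' = Q.t a → RelMem R b' a → b = b'

end FinQuiver

/-! ### Tilting-cotilting equivalence -/

section Tilting

variable (Λ : Type u) [Ring Λ]

/-- The subgroup generated by the elements `[Y] - [X] - [Z]`, for short exact sequences
`0 → X → Y → Z → 0` of finitely generated left `Λ`-modules. -/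
def K0.relations : AddSubgroup (FreeAbelianGroup (FGModuleCat.{u} Λ)) :=
  AddSubgroup.closure
    {w | ∃ (X Y Z : FGModuleCat.{u} Λ) (f : X →ₗ[Λ] Y) (g : Y →ₗ[Λ] Z),
      Function.Injective f ∧ Function.Surjective g ∧ Function.Exact f g ∧
      w = FreeAbelianGroup.of Y - FreeAbelianGroup.of X - FreeAbelianGroup.of Z}

/-- The Grothendieck group of the category of finitely generated left `Λ`-modules. -/
abbrev K0 : Type (u + 1) := FreeAbelianGroup (FGModuleCat.{u} Λ) ⧸ K0.relations Λ

/-- The module `T` is a direct sum of precisely `n` pairwise nonisomorphic indecomposable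
modules. -/
def IsMultiplicityFreeSum (T : Type u) [AddCommGroup T] [Module Λ T] (n : ℕ) : Prop :=
  ∃ M : Fin n → ModuleCat.{u} Λ, (∀ i, Indecomposable (M i)) ∧
    (∀ i j, i ≠ j → IsEmpty (M i ≃ₗ[Λ] M j)) ∧
    Nonempty (T ≃ₗ[Λ] DirectSum (Fin n) fun i => M i)

/-- The properties shared by tilting and cotilting modules: `Ext¹(T, T) = 0`, and `T` is a direct
sum of precisely `rk K₀(Λ)` pairwise nonisomorphic indecomposable modules. -/
structure IsPartialTiltCotilt (T : Type u) [AddCommGroup T] [Module Λ T] : Prop where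
  ext_self : Subsingleton (Abelian.Ext (ModuleCat.of Λ T) (ModuleCat.of Λ T) 1)
  decomposition : IsMultiplicityFreeSum Λ T (Module.finrank ℤ (K0 Λ))

/-- Tilting modules. -/
def IsTilting (T : Type u) [AddCommGroup T] [Module Λ T] : Prop :=
  HasProjectiveDimensionLE (ModuleCat.of Λ T) 1 ∧ IsPartialTiltCotilt Λ T

/-- Cotilting modules. -/
def IsCotilting (T : Type u) [AddCommGroup T] [Module Λ T] : Prop :=
  HasInjectiveDimensionLE (ModuleCat.of Λ T) 1 ∧ IsPartialTiltCotilt Λ T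

variable (k : Type u) [Field k]

/-- Finite dimensional basic connected algebras. Basic: the regular module is a direct sum of
pairwise nonisomorphic indecomposable modules. Connected: nonzero, and the only central idempotents
are `0` and `1`. -/
structure IsBasicConnected [Algebra k Λ] : Prop where
  finite : Module.Finite k Λ
  basic : ∃ n, IsMultiplicityFreeSum Λ Λ n
  nontrivial : Nontrivial Λ
  connected : ∀ e ∈ Subring.center Λ, IsIdempotentElem e → e = 0 ∨ e = 1

variable {k}

/-- One step of the tilting-cotilting equivalence: `B ≅ End_A(T)ᵒᵖ` as `k`-algebras, for some finite
dimensional left `A`-module `T` that is tilting or cotilting, where both `A` and `B` are finite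
dimensional basic connected algebras. -/
def TiltCotiltStep (A B : AlgCat.{u} k) : Prop :=
  IsBasicConnected A k ∧ IsBasicConnected B k ∧
    ∃ (T : Type u) (_ : AddCommGroup T) (_ : Module k T) (_ : Module A T)
      (_ : IsScalarTower k A T), Module.Finite k T ∧ (IsTilting A T ∨ IsCotilting A T) ∧
        Nonempty (B ≃ₐ[k] (Module.End A T)ᵐᵒᵖ)

/-- Tilting-cotilting equivalence: a finite sequence of steps leads from `A` to `B`. -/
def TiltCotiltEquivalent (A B : AlgCat.{u} k) : Prop :=
  Relation.ReflTransGen TiltCotiltStep A B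

end Tilting

/-! ### The algebras `Λ₀(p, r)` -/

/-- The quiver of `Λ₀(p, r)`, for `p ≥ 1`. The vertices are `0, …, p`; there is an oriented path
`α₁ ⋯ αₚ` from `p` to `0`, where `αᵢ₊₁ = Sum.inl i` is an arrow `i + 1 → i`, and there are two
arrows `β = Sum.inr false` and `γ = Sum.inr true` from `0` to `p`. -/
def Lambda0Quiver (p : ℕ) : FinQuiver where
  V := Fin (p + 1)
  A := Fin p ⊕ Bool
  s := Sum.elim Fin.succ fun _ => 0
  t := Sum.elim Fin.castSucc fun _ => Fin.last p

/-- The relations of `Λ₀(p, r)`: `αₚ β`, `αᵢ αᵢ₊₁` for `1 ≤ i ≤ r`, and `γ α₁`. -/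
def Lambda0Relations (p r : ℕ) : Set (Lambda0Quiver p).Path :=
  {ρ | (∃ i : Fin p, (i : ℕ) + 1 = p ∧ ρ.arrows = [Sum.inl i, Sum.inr false]) ∨
    (∃ i j : Fin p, (j : ℕ) = i + 1 ∧ (i : ℕ) < r ∧ ρ.arrows = [Sum.inl i, Sum.inl j]) ∨
    (∃ i : Fin p, (i : ℕ) = 0 ∧ ρ.arrows = [Sum.inr true, Sum.inl i])}

/-- The algebra `Λ₀(p, r)`, for `p ≥ 1` and `0 ≤ r ≤ p - 1`. -/
noncomputable abbrev Lambda0 (k : Type u) [Field k] (p r : ℕ) : Type u :=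
  FinQuiver.BoundQuiverAlgebra k (Lambda0Relations p r)

/-! ### The quiver made of three paths -/

/-- The vertices `u`, `v`, the `p₁ - 1` vertices `xᵢ`, the `p₂ - 1` vertices `yᵢ` and the
`p₃ - 1` vertices `zᵢ`, where `xᵢ₊₁ = x i` for `i : Fin (p₁ - 1)`, and similarly for the others. -/
inductive ThreePathVertex (p₁ p₂ p₃ : ℕ) : Type
  | u : ThreePathVertex p₁ p₂ p₃
  | v : ThreePathVertex p₁ p₂ p₃
  | x (i : Fin (p₁ - 1)) : ThreePathVertex p₁ p₂ p₃
  | y (i : Fin (p₂ - 1)) : ThreePathVertex p₁ p₂ p₃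
  | z (i : Fin (p₃ - 1)) : ThreePathVertex p₁ p₂ p₃
  deriving Fintype

/-- The arrows `αᵢ₊₁ = α i`, `βᵢ₊₁ = β i` and `γᵢ₊₁ = γ i`. -/
inductive ThreePathArrow (p₁ p₂ p₃ : ℕ) : Type
  | α (i : Fin p₁) : ThreePathArrow p₁ p₂ p₃
  | β (i : Fin p₂) : ThreePathArrow p₁ p₂ p₃
  | γ (i : Fin p₃) : ThreePathArrow p₁ p₂ p₃
  deriving Fintype

/-- The `j`-th vertex, for `0 ≤ j ≤ p`, on the path `a ← w 0 ← w 1 ← ⋯ ← w (p - 2) ← b` of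
length `p ≥ 1`. -/
def pathVertex {V : Type} (p : ℕ) (a b : V) (w : Fin (p - 1) → V) (j : ℕ) : V :=
  if h₀ : j = 0 then a else if h : j < p then w ⟨j - 1, by omega⟩ else b

/-- The quiver with vertices `u`, `v` that is made of a path `α₁ ⋯ α_{p₁}` from `v` to `u`, a path
`β₁ ⋯ β_{p₂}` from `u` to `v`, and a path `γ₁ ⋯ γ_{p₃}` from `v` to `u`. -/
def threePathQuiver (p₁ p₂ p₃ : ℕ) : FinQuiver where
  V := ThreePathVertex p₁ p₂ p₃
  A := ThreePathArrow p₁ p₂ p₃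
  s
    | .α i => pathVertex p₁ .u .v .x (i + 1)
    | .β i => pathVertex p₂ .v .u .y (i + 1)
    | .γ i => pathVertex p₃ .u .v .z (i + 1)
  t
    | .α i => pathVertex p₁ .u .v .x i
    | .β i => pathVertex p₂ .v .u .y i
    | .γ i => pathVertex p₃ .u .v .z i

/-! A gentle algebra is governed by its maximal nonzero paths, the threads, and every vertex occurs
exactly twice on them if trivial threads are counted. Record the two occurrences of a vertex `x` as
positions `(x, false)` and `(x, true)`. The algebra then becomes an algebra of matrices indexed by
positions: an off-diagonal entry is allowed only for two positions in order on one thread, and the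
diagonal entries at the two positions of a vertex agree (`FinQuiver.ThreadData.algEquiv`).

Suppose that every position `(x, j)` of a vertex `x` either has an immediate predecessor `q j` at
another vertex or is alone on its thread, and that the former happens at least once. The cokernel of
`P_x → ⨁ P_{q j}` together with all `P_y`, `y ≠ x`, is a tilting module. The opposite of its
endomorphism ring is again a thread algebra, in which `(x, j)` has been taken out and put back
immediately before the other position of the vertex of `q j`
(`Threads.IsReflection.tiltCotiltStep`). Tilting thus becomes cutting and pasting in lists of
positions.

For the quiver made of three paths, gentleness and the two given relations fix all relations at `u`
and `v`. The positions form one list `v, γ, u, β, v', α, u'` (a prime marks the other position), cut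
at the inner vertices that carry a relation. A `Threads.State` stores this as three words `a`, `b`,
`c` for `α`, `β`, `γ`; a letter is called marked if its vertex carries a relation. Reflections
realize these moves. Unmarked letters pass marked ones (`tiltTo_swap`), so that only the six numbers
of marked and unmarked letters matter. Unmarked letters go from `c` to `b` and from `b` to `a`. The
total number of marks drops by one in `reaches_contract` and `reaches_contract_nil` and grows by one
in `reaches_expand` and `reaches_expand_nil`. Finally `reaches_turn` exchanges the roles of the
paths.

By `counts_induction` these moves suffice to empty `a` and `c`. Once `b` is sorted, the state
presents `Λ₀(p, r)`, with `p` one more than the length of `b` and `r` its number of marks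
(`exists_lambda0_threadData`). All steps use tilting modules. -/

/-! ### Split basic algebras -/

/-- An algebra with a complete family of orthogonal idempotents indexed by `V`, together with an
augmentation to `k^V` whose kernel is nilpotent. -/
structure PointedAlgebra (k : Type*) (B : Type*) (V : Type*) [Field k] [Ring B] [Algebra k B]
    [Fintype V] [DecidableEq V] where
  e : V → B
  ε : B →ₐ[k] (V → k)
  orth : ∀ i j, e i * e j = if i = j then e i else 0
  sum_e : ∑ i, e i = 1
  ε_e : ∀ i, ε (e i) = Pi.single i 1
  nilp : ∃ n : ℕ, ∀ l : List B, (∀ a ∈ l, ε a = 0) → n ≤ l.length → l.prod = 0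

namespace PointedAlgebra

variable {k B B' V : Type*} [Field k] [Ring B] [Algebra k B] [Ring B'] [Algebra k B']
  [Fintype V] [DecidableEq V]

/-- Transport of the structure along an isomorphism of algebras. -/
noncomputable def congr (p : PointedAlgebra k B V) (f : B ≃ₐ[k] B') : PointedAlgebra k B' V where
  e i := f (p.e i)
  ε := p.ε.comp (f.symm : B' →ₐ[k] B)
  orth i j := by rw [← map_mul, p.orth]; split_ifs <;> simp
  sum_e := by rw [← map_sum, p.sum_e, map_one]
  ε_e i := by simp [p.ε_e]
  nilp := by
    obtain ⟨n, hn⟩ := p.nilp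
    refine ⟨n, fun l hl hln => ?_⟩
    have := hn (l.map f.symm) (by simpa using hl) (by simpa using hln)
    rw [← map_list_prod] at this
    simpa using this

variable (p : PointedAlgebra k B V)

theorem e_mul_self (i : V) : p.e i * p.e i = p.e i := by rw [p.orth, if_pos rfl]

theorem e_mul_ne {i j : V} (h : i ≠ j) : p.e i * p.e j = 0 := by rw [p.orth, if_neg h]

theorem e_ne_zero (i : V) : p.e i ≠ 0 := fun h => by
  have := congrFun (p.ε_e i) i
  simp [h] at this

/-- An idempotent equals all its positive powers, and a high power of an element of the nilpotent
kernel vanishes. -/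
theorem eq_zero_of_idempotent {a : B} (ha : a * a = a) (h : p.ε a = 0) : a = 0 := by
  obtain ⟨n, hn⟩ := p.nilp
  have h1 := hn (List.replicate (n + 1) a) (fun b hb => by
    rw [List.eq_of_mem_replicate hb]; exact h) (by simp)
  rw [List.prod_replicate] at h1
  rwa [(show IsIdempotentElem a from ha).pow_succ_eq] at h1

theorem ε_idempotent {a : B} (ha : a * a = a) (i : V) : p.ε a i = 0 ∨ p.ε a i = 1 := by
  have h : p.ε a i * p.ε a i = p.ε a i := by
    conv_rhs => rw [← ha, map_mul]
    rfl
  rcases eq_or_ne (p.ε a i) 0 with h0 | h0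
  · exact Or.inl h0
  · exact Or.inr (mul_left_cancel₀ h0 (by rw [h, mul_one]))

/-- The idempotents `e i` are primitive. -/
theorem primitive {i : V} {a : B} (ha : a * a = a) (hl : p.e i * a = a) (hr : a * p.e i = a) :
    a = 0 ∨ a = p.e i := by
  have hε : ∀ j, j ≠ i → p.ε a j = 0 := fun j hj => by
    rw [← hl, map_mul, p.ε_e, Pi.mul_apply, Pi.single_eq_of_ne hj, zero_mul]
  rcases p.ε_idempotent ha i with h | h
  · left
    refine p.eq_zero_of_idempotent ha (funext fun j => ?_)
    by_cases hj : j = i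
    · subst hj; exact h
    · exact hε j hj
  · right
    -- The complement of `a` in `e i` is an idempotent as well, now killed by `ε`.
    have : p.e i - a = 0 := by
      refine p.eq_zero_of_idempotent ?_ (funext fun j => ?_)
      · rw [sub_mul, mul_sub, mul_sub, p.e_mul_self, hl, hr, ha, sub_self, sub_zero]
      · rw [map_sub, p.ε_e, Pi.sub_apply, Pi.zero_apply]
        by_cases hj : j = i
        · subst hj; rw [h, Pi.single_eq_same, sub_self]
        · rw [hε j hj, Pi.single_eq_of_ne hj, sub_self]
    exact (sub_eq_zero.1 this).symm

/-- Mutually inverse maps between the summands cut out by `i` and `j` would be such elements `a` and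
`b`; in the commutative algebra `V → k` the idempotents of different vertices are orthogonal. -/
theorem not_iso {i j : V} (hij : i ≠ j) {a b : B} (ha : a * p.e j = a) (hb : a * b = p.e i) :
    False := by
  have h1 : p.ε (a * b) i = 1 := by rw [hb, p.ε_e, Pi.single_eq_same]
  have h2 : p.ε a i = 0 := by
    rw [← ha, map_mul, p.ε_e, Pi.mul_apply, Pi.single_eq_of_ne hij, mul_zero]
  rw [map_mul, Pi.mul_apply, h2, zero_mul] at h1
  exact zero_ne_one h1

end PointedAlgebra

/-! ### Decompositions from primitive idempotents of the endomorphism ring. -/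

theorem indecomposable_of_idempotents {Λ : Type u} [Ring Λ] (M : Type u) [AddCommGroup M]
    [Module Λ M] [Nontrivial M] (h : ∀ f : M →ₗ[Λ] M, f ∘ₗ f = f → f = 0 ∨ f = LinearMap.id) :
    Indecomposable (ModuleCat.of Λ M) := by
  constructor
  · intro h0
    rw [ModuleCat.isZero_iff_subsingleton] at h0
    exact not_subsingleton M h0
  · intro Y Z φ
    -- The projection onto `Y`, transported along `φ`: if it is `0` then `Y` vanishes, and if it is
    -- the identity then `Z` does.
    let f : ModuleCat.of Λ M ⟶ ModuleCat.of Λ M := φ.hom ≫ Limits.biprod.fst ≫ Limits.biprod.inl ≫ φ.inv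
    have hf : f ≫ f = f := by simp [f]
    have hf2 : f.hom ∘ₗ f.hom = f.hom := by
      rw [← ModuleCat.hom_comp, hf]
    rcases h f.hom hf2 with h0 | h1
    · left
      have : f = 0 := ModuleCat.hom_ext h0
      rw [Limits.IsZero.iff_id_eq_zero]
      calc 𝟙 Y = Limits.biprod.inl ≫ φ.inv ≫ f ≫ φ.hom ≫ Limits.biprod.fst := by simp [f]
        _ = 0 := by rw [this]; simp
    · right
      have : f = 𝟙 _ := ModuleCat.hom_ext h1
      rw [Limits.IsZero.iff_id_eq_zero]
      calc 𝟙 Z = Limits.biprod.inr ≫ φ.inv ≫ 𝟙 _ ≫ φ.hom ≫ Limits.biprod.snd := by simp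
        _ = Limits.biprod.inr ≫ φ.inv ≫ f ≫ φ.hom ≫ Limits.biprod.snd := by rw [this]
        _ = 0 := by simp [f]

section Decomposition

variable {Λ : Type u} [Ring Λ] {T : Type u} [AddCommGroup T] [Module Λ T]

/-- An idempotent endomorphism conjugates endomorphisms of its range to endomorphisms of the
module. -/
def extendRange (e e' : Module.End Λ T) (f : LinearMap.range e →ₗ[Λ] LinearMap.range e') :
    Module.End Λ T :=
  (LinearMap.range e').subtype ∘ₗ f ∘ₗ e.rangeRestrict

variable {k B V : Type*} [Field k] [Ring B] [Algebra k B] [Fintype V] [DecidableEq V]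

/-- The vertex idempotents of `B` act on `T` as orthogonal projections with sum `1`, and their
ranges are the summands. Primitivity makes the ranges indecomposable and `not_iso` keeps them
nonisomorphic. Hence the decomposition of a tilting module follows from knowing its endomorphism
ring alone. -/
theorem isMultiplicityFreeSum_of_pointed (p : PointedAlgebra k B V)
    (φ : B ≃+* (Module.End Λ T)ᵐᵒᵖ) : IsMultiplicityFreeSum Λ T (Fintype.card V) := by
  let E : V → Module.End Λ T := fun i => (φ (p.e i)).unop
  have hE : ∀ i, E i ∘ₗ E i = E i := fun i => by
    change E i * E i = E i
    simp only [E]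
    rw [← MulOpposite.unop_mul, ← map_mul, p.e_mul_self]
  have hEE : ∀ i j, i ≠ j → E i ∘ₗ E j = 0 := fun i j h => by
    change E i * E j = 0
    simp only [E]
    rw [← MulOpposite.unop_mul, ← map_mul, p.e_mul_ne h.symm, map_zero, MulOpposite.unop_zero]
  have hsum : ∑ i, E i = LinearMap.id := by
    have h1 : ∑ i, MulOpposite.opAddEquiv (E i) = 1 := by
      simp only [E, MulOpposite.opAddEquiv_apply, MulOpposite.op_unop]
      rw [← map_sum, p.sum_e, map_one]
    rw [← map_sum MulOpposite.opAddEquiv] at h1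
    exact MulOpposite.op_injective h1
  have hfix : ∀ i (t : LinearMap.range (E i)), E i t = t := by
    rintro i ⟨_, t, rfl⟩
    exact LinearMap.congr_fun (hE i) t
  have hphi : ∀ f g : Module.End Λ T, φ.symm (MulOpposite.op f) * φ.symm (MulOpposite.op g) =
      φ.symm (MulOpposite.op (g ∘ₗ f)) := fun f g => by
    rw [← map_mul]; rfl
  have hphiE : ∀ i, φ.symm (MulOpposite.op (E i)) = p.e i := fun i => by
    simp [E]
  let en := Fintype.equivFin V
  refine ⟨fun i => ModuleCat.of Λ (LinearMap.range (E (en.symm i))), fun i => ?_, fun i j hij => ?_, ?_⟩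
  · change Indecomposable (ModuleCat.of Λ (LinearMap.range (E (en.symm i))))
    generalize en.symm i = v
    have hnt : Nontrivial (LinearMap.range (E v)) := by
      rw [Submodule.nontrivial_iff_ne_bot, Ne, LinearMap.range_eq_bot]
      intro h0
      have := hphiE v
      rw [h0, MulOpposite.op_zero, map_zero] at this
      exact p.e_ne_zero v this.symm
    refine indecomposable_of_idempotents _ fun f hf => ?_
    -- Extended by zero, `f` becomes an idempotent of the corner at `v` in the endomorphism ring of
    -- `T`, where primitivity applies.
    let F := extendRange (E v) (E v) f
    have hF : ∀ t, F t = (f ⟨E v t, t, rfl⟩ : T) := fun t => rfl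
    have hFE : F ∘ₗ E v = F := by
      ext t
      simp only [LinearMap.comp_apply, hF]
      congr 2
      exact Subtype.ext (LinearMap.congr_fun (hE v) t)
    have hEF : E v ∘ₗ F = F := by
      ext t
      simp only [LinearMap.comp_apply, hF]
      exact hfix v _
    have hFF : F ∘ₗ F = F := by
      ext t
      simp only [LinearMap.comp_apply, hF]
      have h1 : (⟨E v (f ⟨E v t, t, rfl⟩ : T), _, rfl⟩ : LinearMap.range (E v)) = f ⟨E v t, t, rfl⟩ :=
        Subtype.ext (hfix v _)
      rw [h1]
      exact congrArg Subtype.val (LinearMap.congr_fun hf _)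
    have key := p.primitive (i := v) (a := φ.symm (MulOpposite.op F)) (by rw [hphi, hFF])
      (by rw [← hphiE, hphi, hFE]) (by rw [← hphiE, hphi, hEF])
    rw [← hphiE] at key
    rcases key with h | h
    · left
      have hF0 : F = 0 := by simpa using h
      ext t
      have := LinearMap.congr_fun hF0 t
      rw [hF] at this
      have h1 : (⟨E v t, _, rfl⟩ : LinearMap.range (E v)) = t := Subtype.ext (hfix v _)
      rw [h1] at this
      exact this
    · right
      have hF0 : F = E v := by simpa using h
      ext t
      have := LinearMap.congr_fun hF0 t
      have h1 : (⟨E v t, _, rfl⟩ : LinearMap.range (E v)) = t := Subtype.ext (hfix v _)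
      rw [hF, h1, hfix] at this
      exact this
  · refine ⟨fun g => ?_⟩
    have hv : en.symm i ≠ en.symm j := fun h => hij (en.symm.injective h)
    change LinearMap.range (E (en.symm i)) ≃ₗ[Λ] LinearMap.range (E (en.symm j)) at g
    generalize en.symm i = v at g hv
    generalize en.symm j = w at g hv
    let G := extendRange (E v) (E w) g.toLinearMap
    let H := extendRange (E w) (E v) g.symm.toLinearMap
    have hG : ∀ t, G t = (g ⟨E v t, t, rfl⟩ : T) := fun t => rfl
    have hH : ∀ t, H t = (g.symm ⟨E w t, t, rfl⟩ : T) := fun t => rfl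
    refine p.not_iso hv (a := φ.symm (MulOpposite.op G)) (b := φ.symm (MulOpposite.op H)) ?_ ?_
    · rw [← hphiE, hphi]
      congr 2
      ext t
      exact hfix w _
    · rw [← hphiE, hphi]
      congr 2
      ext t
      simp only [LinearMap.comp_apply, hH]
      have h1 : (⟨E w (G t), _, rfl⟩ : LinearMap.range (E w)) = g ⟨E v t, t, rfl⟩ :=
        Subtype.ext (hfix w _)
      rw [h1, g.symm_apply_apply]
  · let f : T →ₗ[Λ] (i : Fin (Fintype.card V)) → LinearMap.range (E (en.symm i)) :=
      LinearMap.pi fun i => (E (en.symm i)).rangeRestrict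
    have hf : ∀ t i, (f t i : T) = E (en.symm i) t := fun t i => rfl
    have hdec : ∀ t : T, ∑ i, E (en.symm i) t = t := fun t => by
      rw [Equiv.sum_comp en.symm (fun v => E v t), ← LinearMap.sum_apply, hsum]
      rfl
    have hbij : Function.Bijective f := by
      constructor
      · intro t t' htt
        rw [← hdec t, ← hdec t']
        exact Finset.sum_congr rfl fun i _ => by rw [← hf, ← hf, htt]
      · intro g
        refine ⟨∑ i, (g i : T), funext fun i => Subtype.ext ?_⟩
        rw [hf, map_sum, Finset.sum_eq_single i]
        · exact hfix _ _
        · intro j _ hj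
          rw [← hfix _ (g j)]
          exact LinearMap.congr_fun (hEE _ _ fun h => hj (en.symm.injective h).symm) _
        · simp
    exact ⟨(LinearEquiv.ofBijective f hbij).trans
      (DirectSum.linearEquivFunOnFintype Λ (Fin (Fintype.card V))
        fun i => LinearMap.range (E (en.symm i))).symm⟩

end Decomposition

/-! ### Modules with a projective resolution of length one. -/

section Ext

variable {Λ : Type u} [Ring Λ]

/-- As `G` is projective, every class in `Ext¹(T, T)` is the image of some `N → T` under the
connecting map, and a map that extends to `G` has image zero. -/
theorem hasProjectiveDimensionLE_one_and_ext_self {N G T : Type u} [AddCommGroup N]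
    [AddCommGroup G] [AddCommGroup T] [Module Λ N] [Module Λ G] [Module Λ T]
    [Module.Projective Λ N] [Module.Projective Λ G] (i : N →ₗ[Λ] G) (π : G →ₗ[Λ] T)
    (hi : Function.Injective i) (hπ : Function.Surjective π) (hex : Function.Exact i π)
    (hext : ∀ f : N →ₗ[Λ] T, ∃ g : G →ₗ[Λ] T, g ∘ₗ i = f) :
    HasProjectiveDimensionLE (ModuleCat.of Λ T) 1 ∧
      Subsingleton (Abelian.Ext (ModuleCat.of Λ T) (ModuleCat.of Λ T) 1) := by
  let S : ShortComplex (ModuleCat.{u} Λ) :=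
    ShortComplex.mk (ModuleCat.ofHom i) (ModuleCat.ofHom π)
      (ModuleCat.hom_ext hex.linearMap_comp_eq_zero)
  have hS : S.ShortExact := ModuleCat.shortComplex_shortExact S hex hi hπ
  have hN : Projective S.X₁ := (IsProjective.iff_projective N).1 inferInstance
  have hG : Projective S.X₂ := (IsProjective.iff_projective G).1 inferInstance
  constructor
  · exact (hS.hasProjectiveDimensionLT_X₃_iff 0 hG).2 inferInstance
  · refine subsingleton_of_forall_eq 0 fun x => ?_
    obtain ⟨y, rfl⟩ := Abelian.Ext.contravariant_sequence_exact₃ hS _ x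
      (Abelian.Ext.eq_zero_of_projective _) (n₀ := 0) rfl
    obtain ⟨f, rfl⟩ := (Abelian.Ext.mk₀_bijective _ _).2 y
    obtain ⟨g, hg⟩ := hext f.hom
    have hf : f = S.f ≫ ModuleCat.ofHom g := ModuleCat.hom_ext hg.symm
    rw [hf, ← Abelian.Ext.mk₀_comp_mk₀, ← Abelian.Ext.comp_assoc_of_second_deg_zero,
      hS.extClass_comp, Abelian.Ext.zero_comp]

end Ext

namespace PointedAlgebra

/-! ### Dimension vectors and common eigenvectors. -/

section Dim

variable {k Λ V : Type*} [Field k] [Ring Λ] [Algebra k Λ] [Fintype V] [DecidableEq V]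

/-- The dimension of `e M`. -/
noncomputable def dimAt (k : Type*) [Field k] [Algebra k Λ] (e : Λ) (M : Type*) [AddCommGroup M]
    [Module Λ M] [Module k M] [IsScalarTower k Λ M] : ℕ :=
  Module.finrank k (LinearMap.range (Algebra.lsmul k k M e))

/-- For an idempotent `e` the functor `M ↦ e M` is exact: a preimage can be multiplied by `e`
without changing its image in the range of `e`. -/
theorem dimAt_exact {e : Λ} (he : e * e = e) {X Y Z : Type*} [AddCommGroup X] [AddCommGroup Y]
    [AddCommGroup Z] [Module Λ X] [Module Λ Y] [Module Λ Z] [Module k X] [Module k Y] [Module k Z]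
    [IsScalarTower k Λ X] [IsScalarTower k Λ Y] [IsScalarTower k Λ Z] [Module.Finite k Y]
    (f : X →ₗ[Λ] Y) (g : Y →ₗ[Λ] Z) (hf : Function.Injective f) (hg : Function.Surjective g)
    (hfg : Function.Exact f g) : dimAt k e Y = dimAt k e X + dimAt k e Z := by
  let rX := LinearMap.range (Algebra.lsmul k k X e)
  let rY := LinearMap.range (Algebra.lsmul k k Y e)
  let rZ := LinearMap.range (Algebra.lsmul k k Z e)
  have hfix : ∀ y ∈ rY, e • y = y := by
    rintro _ ⟨y, rfl⟩
    change e • e • y = e • y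
    rw [smul_smul, he]
  let f' : rX →ₗ[k] rY := (f.restrictScalars k).restrict (by
    rintro _ ⟨x, rfl⟩
    exact ⟨f x, (f.map_smul e x).symm⟩)
  let g' : rY →ₗ[k] rZ := (g.restrictScalars k).restrict (by
    rintro _ ⟨x, rfl⟩
    exact ⟨g x, (g.map_smul e x).symm⟩)
  have hf'v : ∀ x, (f' x : Y) = f x := fun _ => rfl
  have hg'v : ∀ x, (g' x : Z) = g x := fun _ => rfl
  have hf' : Function.Injective f' := fun x x' h =>
    Subtype.ext (hf (by rw [← hf'v, ← hf'v, h]))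
  have hg' : LinearMap.range g' = ⊤ := by
    rw [LinearMap.range_eq_top]
    rintro ⟨_, z, rfl⟩
    obtain ⟨y, rfl⟩ := hg z
    exact ⟨⟨e • y, y, rfl⟩, Subtype.ext (g.map_smul e y)⟩
  have hker : LinearMap.ker g' = LinearMap.range f' := by
    ext y
    constructor
    · intro hy
      have h1 : g y = 0 := by rw [← hg'v, LinearMap.mem_ker.1 hy]; rfl
      obtain ⟨x, hx⟩ := (hfg y).1 h1
      refine ⟨⟨e • x, x, rfl⟩, Subtype.ext ?_⟩
      rw [hf'v, f.map_smul, hx, hfix y y.2]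
    · rintro ⟨x, rfl⟩
      rw [LinearMap.mem_ker]
      refine Subtype.ext ?_
      rw [hg'v, hf'v]
      exact (hfg _).2 ⟨x, rfl⟩
  have h1 := LinearMap.finrank_range_add_finrank_ker g'
  rw [hg', hker, finrank_top, LinearMap.finrank_range_of_inj hf'] at h1
  change Module.finrank k rY = Module.finrank k rX + Module.finrank k rZ
  omega

variable (p : PointedAlgebra k Λ V)

/-- Otherwise a nonzero vector could be multiplied by elements of the kernel of `ε` any number of
times without becoming zero, against nilpotency. -/
theorem exists_killed (M : Type*) [AddCommGroup M] [Module Λ M] [Nontrivial M] :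
    ∃ m : M, m ≠ 0 ∧ ∀ a, p.ε a = 0 → a • m = 0 := by
  by_contra! hcon
  obtain ⟨m, hm⟩ := exists_ne (0 : M)
  have key : ∀ n : ℕ, ∃ l : List Λ, (∀ a ∈ l, p.ε a = 0) ∧ l.length = n ∧ l.prod • m ≠ 0 := by
    intro n
    induction n with
    | zero => exact ⟨[], by simp, rfl, by simpa using hm⟩
    | succ n ih =>
      obtain ⟨l, hl, hln, hlm⟩ := ih
      obtain ⟨a, ha, ham⟩ := hcon _ hlm
      refine ⟨a :: l, ?_, by simp [hln], by rwa [List.prod_cons, mul_smul]⟩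
      simpa using ⟨ha, hl⟩
  obtain ⟨n, hn⟩ := p.nilp
  obtain ⟨l, hl, hln, hlm⟩ := key n
  exact hlm (by rw [hn l hl hln.ge, zero_smul])

/-- This vector spans a copy of the simple module at `i`. It is found as `e i • m` for a vector `m`
killed by the kernel of `ε`, because `a * e i - ε a i • e i` lies in that kernel. -/
theorem exists_eigenvector (M : Type*) [AddCommGroup M] [Module Λ M] [Module k M]
    [IsScalarTower k Λ M] [Nontrivial M] :
    ∃ (m : M) (i : V), m ≠ 0 ∧ ∀ a : Λ, a • m = p.ε a i • m := by
  obtain ⟨m, hm, hk⟩ := p.exists_killed M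
  have h1 : ∃ i, p.e i • m ≠ 0 := by
    by_contra! h
    apply hm
    rw [← one_smul Λ m, ← p.sum_e, Finset.sum_smul]
    exact Finset.sum_eq_zero fun i _ => h i
  obtain ⟨i, hi⟩ := h1
  refine ⟨p.e i • m, i, hi, fun a => ?_⟩
  have h2 : p.ε (a * p.e i - p.ε a i • p.e i) = 0 := by
    rw [map_sub, map_mul, map_smul, p.ε_e, sub_eq_zero]
    funext j
    by_cases hj : j = i
    · subst hj; simp
    · simp [Pi.single_eq_of_ne hj]
  have h3 := hk _ h2
  rw [sub_smul, sub_eq_zero, mul_smul, smul_assoc] at h3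
  exact h3

end Dim

/-! ### The rank of the Grothendieck group. -/

section K0

variable {k Λ : Type u} {V : Type*} [Field k] [Ring Λ] [Algebra k Λ] [Fintype V] [DecidableEq V]
  (p : PointedAlgebra k Λ V)

/-- The one-dimensional module at the vertex `i`. -/
@[nolint unusedArguments]
def SimpleAt (_ : PointedAlgebra k Λ V) (_ : V) : Type u := k

instance (i : V) : AddCommGroup (p.SimpleAt i) := inferInstanceAs (AddCommGroup k)

instance (i : V) : Module k (p.SimpleAt i) := inferInstanceAs (Module k k)

noncomputable instance (i : V) : Module Λ (p.SimpleAt i) :=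
  Module.compHom k ((Pi.evalRingHom (fun _ : V => k) i).comp (p.ε : Λ →+* (V → k)))

theorem smul_simpleAt (i : V) (a : Λ) (c : p.SimpleAt i) : a • c = p.ε a i • c := rfl

instance (i : V) : IsScalarTower k Λ (p.SimpleAt i) :=
  ⟨fun c a m => by rw [smul_simpleAt, smul_simpleAt, map_smul, Pi.smul_apply, smul_assoc]⟩

instance (i : V) : Module.Finite k (p.SimpleAt i) := inferInstanceAs (Module.Finite k k)

instance (i : V) : Module.Finite Λ (p.SimpleAt i) := Module.Finite.of_restrictScalars_finite k Λ _

theorem dimAt_simpleAt (i j : V) : dimAt k (p.e i) (p.SimpleAt j) = if i = j then 1 else 0 := by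
  have h : Algebra.lsmul k k (p.SimpleAt j) (p.e i) = (if i = j then 1 else 0 : k) • 1 := by
    refine LinearMap.ext fun c => ?_
    change p.e i • c = (if i = j then 1 else 0 : k) • c
    rw [smul_simpleAt, p.ε_e, Pi.single_apply]
    simp only [eq_comm]
  unfold dimAt
  by_cases hij : i = j
  · rw [if_pos hij, one_smul] at h
    rw [h, if_pos hij, Module.End.one_eq_id, LinearMap.range_id, finrank_top]
    exact Module.finrank_self k
  · rw [if_neg hij, zero_smul] at h
    rw [h, if_neg hij, LinearMap.range_zero, finrank_bot]

/-- The dimension vector of a finitely generated module. -/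
noncomputable def dimVec (M : FGModuleCat.{u} Λ) (i : V) : ℤ :=
  letI : Module k M := Module.compHom M (algebraMap k Λ)
  haveI : IsScalarTower k Λ M := ⟨fun c a m => by
    rw [Algebra.smul_def, mul_smul]; rfl⟩
  (dimAt k (p.e i) M : ℤ)

theorem dimVec_eq (M : Type u) [AddCommGroup M] [Module Λ M] [Module.Finite Λ M] [Module k M]
    [IsScalarTower k Λ M] (i : V) : p.dimVec (FGModuleCat.of Λ M) i = dimAt k (p.e i) M := by
  rename_i inst _
  have h : inst = Module.compHom M (algebraMap k Λ) :=
    Module.ext (funext fun c => funext fun m => (algebraMap_smul Λ c m).symm)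
  subst h
  rfl

theorem dimVec_exact [Module.Finite k Λ] {X Y Z : FGModuleCat.{u} Λ} (f : X →ₗ[Λ] Y)
    (g : Y →ₗ[Λ] Z) (hf : Function.Injective f) (hg : Function.Surjective g)
    (hfg : Function.Exact f g) (i : V) : p.dimVec Y i = p.dimVec X i + p.dimVec Z i := by
  let (M : FGModuleCat.{u} Λ) : Module k M := Module.compHom M (algebraMap k Λ)
  have (M : FGModuleCat.{u} Λ) : IsScalarTower k Λ M := ⟨fun c a m => by
    rw [Algebra.smul_def, mul_smul]; rfl⟩
  have : Module.Finite k Y := Module.Finite.trans Λ Y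
  unfold dimVec
  rw [← Nat.cast_add, ← dimAt_exact (p.e_mul_self i) f g hf hg hfg]

/-- The class of a module in the Grothendieck group. -/
def K0class (M : FGModuleCat.{u} Λ) : K0 Λ := QuotientAddGroup.mk (FreeAbelianGroup.of M)

theorem K0class_exact {X Y Z : FGModuleCat.{u} Λ} (f : X →ₗ[Λ] Y)
    (g : Y →ₗ[Λ] Z) (hf : Function.Injective f) (hg : Function.Surjective g)
    (hfg : Function.Exact f g) : K0class Y = K0class X + K0class Z := by
  have h : FreeAbelianGroup.of Y - FreeAbelianGroup.of X - FreeAbelianGroup.of Z ∈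
      K0.relations Λ := AddSubgroup.subset_closure ⟨X, Y, Z, f, g, hf, hg, hfg, rfl⟩
  have h1 := (QuotientAddGroup.eq_zero_iff _).2 h
  rw [QuotientAddGroup.mk_sub, QuotientAddGroup.mk_sub, sub_sub, sub_eq_zero] at h1
  exact h1

/-- The dimension vector on the Grothendieck group. -/
noncomputable def K0dim [Module.Finite k Λ] : K0 Λ →+ (V → ℤ) :=
  QuotientAddGroup.lift (K0.relations Λ) (FreeAbelianGroup.lift p.dimVec) (by
    rw [K0.relations, AddSubgroup.closure_le]
    rintro _ ⟨X, Y, Z, f, g, hf, hg, hfg, rfl⟩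
    change FreeAbelianGroup.lift p.dimVec _ = 0
    rw [map_sub, map_sub, FreeAbelianGroup.lift_apply_of, FreeAbelianGroup.lift_apply_of,
      FreeAbelianGroup.lift_apply_of]
    funext i
    simp only [Pi.sub_apply, Pi.zero_apply]
    rw [p.dimVec_exact f g hf hg hfg i]
    ring)

theorem K0dim_class [Module.Finite k Λ] (M : FGModuleCat.{u} Λ) :
    p.K0dim (K0class M) = p.dimVec M := FreeAbelianGroup.lift_apply_of _ _

/-- Dévissage: a common eigenvector gives a simple submodule, and the quotient by it has smaller
dimension. -/
theorem K0class_mem [Module.Finite k Λ] (H : AddSubgroup (K0 Λ))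
    (hH : ∀ i, K0class (FGModuleCat.of Λ (p.SimpleAt i)) ∈ H) (n : ℕ) :
    ∀ (M : Type u) [AddCommGroup M] [Module Λ M] [Module.Finite Λ M] [Module k M]
      [IsScalarTower k Λ M], Module.finrank k M = n → K0class (FGModuleCat.of Λ M) ∈ H := by
  induction n using Nat.strong_induction_on with
  | _ n ih =>
    intro M _ _ _ _ _ hM
    rcases subsingleton_or_nontrivial M with hs | hn
    -- For a zero module the sequence of identities `M → M → M` is short exact, so that `[M] = [M] +
    -- [M]`.
    · have h := K0class_exact (X := FGModuleCat.of Λ M) (Y := FGModuleCat.of Λ M)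
        (Z := FGModuleCat.of Λ M) (LinearMap.id : M →ₗ[Λ] M) (LinearMap.id : M →ₗ[Λ] M)
        Function.injective_id Function.surjective_id
        (fun y => ⟨fun _ => ⟨y, rfl⟩, fun _ => Subsingleton.elim (α := M) _ _⟩)
      have h0 : K0class (FGModuleCat.of Λ M) = 0 := by
        simpa using h
      rw [h0]
      exact H.zero_mem
    · obtain ⟨m, i, hm, ha⟩ := p.exists_eigenvector M
      have : Module.Finite k M := Module.Finite.trans Λ M
      let f : p.SimpleAt i →ₗ[Λ] M :=
        { toFun := fun c => (show k from c) • m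
          map_add' := fun c d => add_smul (R := k) c d m
          map_smul' := fun a c => by
            change (p.ε a i * (show k from c)) • m = a • (show k from c) • m
            rw [smul_comm, ha, smul_smul, mul_comm] }
      have hf : Function.Injective f := fun c d (h : (show k from c) • m = (show k from d) • m) =>
        smul_left_injective k hm h
      let N := LinearMap.range f
      have hlt : Module.finrank k (M ⧸ N) < n := by
        have h1 := Submodule.finrank_quotient_add_finrank (N.restrictScalars k)
        have h2 : Module.finrank k (M ⧸ N) = Module.finrank k (M ⧸ N.restrictScalars k) := rfl
        have h3 : 0 < Module.finrank k (N.restrictScalars k) := by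
          have : Nontrivial (N.restrictScalars k) :=
            ⟨⟨0, ⟨m, ⟨(1 : k), one_smul k m⟩⟩, fun h => hm (congrArg Subtype.val h).symm⟩⟩
          exact Module.finrank_pos
        omega
      have h := K0class_exact (X := FGModuleCat.of Λ (p.SimpleAt i)) (Y := FGModuleCat.of Λ M)
        (Z := FGModuleCat.of Λ (M ⧸ N)) f N.mkQ hf N.mkQ_surjective
        (LinearMap.exact_map_mkQ_range f)
      rw [h]
      exact H.add_mem (hH i) (ih _ hlt (M ⧸ N) rfl)

/-- The classes of the simple modules form a basis: dimension vectors separate them and dévissage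
shows that they generate. -/
theorem finrank_K0 (p : PointedAlgebra k Λ V) [Module.Finite k Λ] : Module.finrank ℤ (K0 Λ) = Fintype.card V := by
  let φ : (V → ℤ) →ₗ[ℤ] K0 Λ := Fintype.linearCombination ℤ
    fun i => K0class (FGModuleCat.of Λ (p.SimpleAt i))
  have hφ1 : ∀ i, φ (Pi.single i 1) = K0class (FGModuleCat.of Λ (p.SimpleAt i)) := fun i => by
    rw [Fintype.linearCombination_apply_single, one_smul]
  have hdφ : ∀ i, p.K0dim (φ (Pi.single i 1)) = Pi.single i 1 := fun i => by
    rw [hφ1, K0dim_class]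
    funext j
    rw [dimVec_eq, dimAt_simpleAt, Pi.single_apply]
    split_ifs <;> rfl
  have hinj : Function.Injective φ := by
    have : p.K0dim.toIntLinearMap ∘ₗ φ = LinearMap.id := by
      refine LinearMap.pi_ext' fun i => LinearMap.ext_ring ?_
      exact hdφ i
    exact Function.LeftInverse.injective (g := p.K0dim.toIntLinearMap) (LinearMap.congr_fun this)
  have hsurj : Function.Surjective φ := by
    intro x
    obtain ⟨w, rfl⟩ := QuotientAddGroup.mk_surjective x
    change QuotientAddGroup.mk w ∈ φ.toAddMonoidHom.range
    induction w using FreeAbelianGroup.induction_on with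
    | zero => exact AddSubgroup.zero_mem _
    | of M =>
      let : Module k M := Module.compHom M (algebraMap k Λ)
      have : IsScalarTower k Λ M := ⟨fun c a m => by
        rw [Algebra.smul_def, mul_smul]; rfl⟩
      exact p.K0class_mem φ.toAddMonoidHom.range (fun i => ⟨_, hφ1 i⟩) _ M rfl
    | neg M h => exact AddSubgroup.neg_mem _ h
    | add a b ha hb => exact AddSubgroup.add_mem _ ha hb
  rw [← (LinearEquiv.ofBijective φ ⟨hinj, hsurj⟩).finrank_eq, Module.finrank_fintype_fun_eq_card]

end K0

end PointedAlgebra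

/-! ### Tilting steps -/

section Step

variable {k A B : Type u} {V : Type*} [Field k] [Ring A] [Ring B] [Algebra k A] [Algebra k B]
  [Fintype V] [DecidableEq V]

/-- The algebra has no nontrivial central idempotents. -/
def NoCentralIdempotents (A : Type*) [Ring A] : Prop :=
  ∀ e ∈ Subring.center A, IsIdempotentElem e → e = 0 ∨ e = 1

theorem NoCentralIdempotents.congr {A B : Type*} [Ring A] [Ring B] (h : NoCentralIdempotents A)
    (f : A ≃+* B) : NoCentralIdempotents B := by
  intro e he hi
  rw [Subring.mem_center_iff] at he
  rcases h (f.symm e) (Subring.mem_center_iff.2 fun a => f.injective (by simpa using he (f a)))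
    (hi.map f.symm) with h0 | h1
  · left; simpa using h0
  · right; simpa using h1

/-- The opposite of the endomorphism ring of the regular module. -/
noncomputable def endSelfOp (k A : Type*) [Field k] [Ring A] [Algebra k A] :
    A ≃ₐ[k] (Module.End A A)ᵐᵒᵖ :=
  (AlgEquiv.opOp k A).trans (AlgEquiv.op (AlgEquiv.moduleEndSelf k))

theorem PointedAlgebra.isBasicConnected (p : PointedAlgebra k A V) [Nonempty V]
    [Module.Finite k A] (h : NoCentralIdempotents A) : IsBasicConnected A k where
  finite := inferInstance
  basic := ⟨_, isMultiplicityFreeSum_of_pointed p (endSelfOp k A).toRingEquiv⟩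
  nontrivial := ⟨⟨p.e (Classical.arbitrary V), 0, p.e_ne_zero _⟩⟩
  connected := h

/-- Both algebras have the same index set `V`. The number of summands of `T`, read off from its
endomorphism ring `Bᵒᵖ`, is therefore automatically the rank of `K₀(A)`, and only the resolution and
the endomorphism ring have to be supplied. -/
theorem tiltCotiltStep_of_presentation [Nonempty V] [Module.Finite k A] [Module.Finite k B]
    (pA : PointedAlgebra k A V)
    (pB : PointedAlgebra k B V) (hA : NoCentralIdempotents A) (hB : NoCentralIdempotents B)
    {N G T : Type u} [AddCommGroup N]
    [AddCommGroup G] [AddCommGroup T] [Module A N] [Module A G] [Module A T] [Module k T]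
    [IsScalarTower k A T] [Module.Finite k T]
    [Module.Projective A N] [Module.Projective A G] (i : N →ₗ[A] G) (π : G →ₗ[A] T)
    (hi : Function.Injective i) (hπ : Function.Surjective π) (hex : Function.Exact i π)
    (hext : ∀ f : N →ₗ[A] T, ∃ g : G →ₗ[A] T, g ∘ₗ i = f)
    (φ : B ≃ₐ[k] (Module.End A T)ᵐᵒᵖ) :
    TiltCotiltStep (AlgCat.of k A) (AlgCat.of k B) := by
  obtain ⟨hpd, hExt⟩ := hasProjectiveDimensionLE_one_and_ext_self i π hi hπ hex hext
  refine ⟨pA.isBasicConnected hA, pB.isBasicConnected hB, T, inferInstance, inferInstance,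
    inferInstance, inferInstance, inferInstance, Or.inl ⟨hpd, hExt, ?_⟩, ⟨φ⟩⟩
  have h := isMultiplicityFreeSum_of_pointed pB φ.toRingEquiv
  rwa [← pA.finrank_K0] at h

/-- The regular module is tilting, with resolution `0 → 0 → A → A`, and so isomorphic algebras are
joined by one step. -/
theorem tiltCotiltStep_of_algEquiv [Nonempty V] [Module.Finite k A] (pA : PointedAlgebra k A V)
    (hA : NoCentralIdempotents A) (f : B ≃ₐ[k] A) :
    TiltCotiltStep (AlgCat.of k A) (AlgCat.of k B) := by
  have : Module.Finite k B := Module.Finite.equiv f.symm.toLinearEquiv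
  refine tiltCotiltStep_of_presentation pA (pA.congr f.symm) hA
    (hA.congr f.symm.toRingEquiv) (N := PUnit) (0 : PUnit.{u + 1} →ₗ[A] A) LinearMap.id
    (fun _ _ _ => rfl) Function.surjective_id (fun y => ?_) (fun g => ⟨0, LinearMap.ext fun x => ?_⟩)
    (f.trans (endSelfOp k A))
  · exact ⟨fun h => ⟨PUnit.unit, h.symm⟩, fun ⟨_, h⟩ => h.symm⟩
  · exact (map_zero g).symm

end Step

/-! ### Thread algebras -/

/-- A strict partial order on two copies of `V`; the intended examples are disjoint unions of
chains, the maximal nonzero paths of a gentle algebra with set of vertices `V`. -/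
structure Threads (V : Type) where
  lt : V × Bool → V × Bool → Prop
  irrefl : ∀ p, ¬ lt p p
  trans : ∀ p q r, lt p q → lt q r → lt p r

namespace Threads

variable {V : Type} {D : Threads V}

theorem asymm {p q : V × Bool} (h : D.lt p q) (h' : D.lt q p) : False :=
  D.irrefl p (D.trans _ _ _ h h')

theorem ne_of_lt {p q : V × Bool} (h : D.lt p q) : p ≠ q := fun e => D.irrefl q (e ▸ h)

variable (k : Type u) [Field k] (D)

variable {k} in
/-- The matrix is supported on the reflexive closure of the order. -/
abbrev Supported (M : Matrix (V × Bool) (V × Bool) k) : Prop :=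
  ∀ r s, M r s ≠ 0 → r = s ∨ D.lt s r

variable {k D} [Fintype V]

theorem Supported.mul {M N : Matrix (V × Bool) (V × Bool) k} (hM : D.Supported M)
    (hN : D.Supported N) : D.Supported (M * N) := by
  intro r s h
  rw [Matrix.mul_apply] at h
  obtain ⟨t, -, ht⟩ := Finset.exists_ne_zero_of_sum_ne_zero h
  rcases hM _ _ (left_ne_zero_of_mul ht) with rfl | h1 <;>
    rcases hN _ _ (right_ne_zero_of_mul ht) with rfl | h2
  · exact Or.inl rfl
  · exact Or.inr h2
  · exact Or.inr h1
  · exact Or.inr (D.trans _ _ _ h2 h1)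

/-- A middle index other than `r` would lie both before and after `r`. Hence reading a diagonal
entry is multiplicative, which yields the augmentation. -/
theorem Supported.mul_diag {M N : Matrix (V × Bool) (V × Bool) k} (hM : D.Supported M)
    (hN : D.Supported N) (r : V × Bool) : (M * N) r r = M r r * N r r := by
  rw [Matrix.mul_apply, Finset.sum_eq_single r]
  · intro t _ ht
    by_contra h
    rcases hM _ _ (left_ne_zero_of_mul h) with rfl | h1
    · exact ht rfl
    · rcases hN _ _ (right_ne_zero_of_mul h) with rfl | h2
      · exact ht rfl
      · exact asymm h1 h2
  · simp

variable (k D) [DecidableEq V]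

/-- The algebra of lower triangular matrices with equal diagonal entries at the two copies of each
vertex. -/
def matrixAlgebra : Subalgebra k (Matrix (V × Bool) (V × Bool) k) where
  carrier := {M | D.Supported M ∧ ∀ x, M (x, false) (x, false) = M (x, true) (x, true)}
  mul_mem' {M N} hM hN := ⟨hM.1.mul hN.1, fun x => by
    rw [hM.1.mul_diag hN.1, hM.1.mul_diag hN.1, hM.2, hN.2]⟩
  add_mem' {M N} hM hN := by
    refine ⟨fun r s h => ?_, fun x => by rw [Matrix.add_apply, Matrix.add_apply, hM.2, hN.2]⟩
    by_cases h1 : M r s = 0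
    · exact hN.1 r s fun h2 => h (by rw [Matrix.add_apply, h1, h2, add_zero])
    · exact hM.1 r s h1
  algebraMap_mem' c := by
    refine ⟨fun r s h => ?_, fun x => by simp [Matrix.algebraMap_matrix_apply]⟩
    rw [Matrix.algebraMap_matrix_apply] at h
    left
    by_contra hrs
    exact h (if_neg hrs)

/-- The thread algebra. -/
def algebra : Type u := D.matrixAlgebra k

noncomputable instance : Ring (D.algebra k) := inferInstanceAs (Ring (D.matrixAlgebra k))

noncomputable instance : Algebra k (D.algebra k) := inferInstanceAs (Algebra k (D.matrixAlgebra k))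

instance : Module.Finite k (D.algebra k) := inferInstanceAs (Module.Finite k (D.matrixAlgebra k))

variable {k D}

/-- The matrix underlying an element of the thread algebra. -/
def mat : D.algebra k →ₐ[k] Matrix (V × Bool) (V × Bool) k := (D.matrixAlgebra k).val

theorem mat_injective : Function.Injective (mat : D.algebra k → _) := Subtype.val_injective

theorem ext_mat {M N : D.algebra k} (h : ∀ r s, mat M r s = mat N r s) : M = N :=
  mat_injective (Matrix.ext h)

/-- Construct an element of the thread algebra. -/
def ofMatrix (M : Matrix (V × Bool) (V × Bool) k) (h : D.Supported M)
    (h' : ∀ x, M (x, false) (x, false) = M (x, true) (x, true)) : D.algebra k :=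
  Subtype.mk (p := fun M => M ∈ D.matrixAlgebra k) M ⟨h, h'⟩

@[simp] theorem mat_ofMatrix (M : Matrix (V × Bool) (V × Bool) k) (h : D.Supported M)
    (h' : ∀ x, M (x, false) (x, false) = M (x, true) (x, true)) : mat (D.ofMatrix M h h') = M := rfl

theorem supported (M : D.algebra k) : D.Supported (mat M) := Subtype.prop (p := fun M => M ∈ D.matrixAlgebra k) M |>.1

theorem diag_eq (M : D.algebra k) (x : V) (b c : Bool) : mat M (x, b) (x, b) = mat M (x, c) (x, c) := by
  have h := (Subtype.prop (p := fun M => M ∈ D.matrixAlgebra k) M).2 x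
  cases b <;> cases c <;> first | rfl | exact h | exact h.symm

theorem zero_of (M : D.algebra k) {r s : V × Bool} (h : r ≠ s) (h' : ¬ D.lt s r) : mat M r s = 0 := by
  by_contra h0
  rcases D.supported M r s h0 with h1 | h1
  · exact h h1
  · exact h' h1

variable (k D)

/-- The idempotent at a vertex. -/
def idem (x : V) : D.algebra k :=
  D.ofMatrix (Matrix.diagonal fun p => if p.1 = x then 1 else 0) (fun r s h => by
    left
    by_contra hrs
    exact h (Matrix.diagonal_apply_ne _ hrs)) (fun y => by simp)

theorem idem_val (x : V) : mat (D.idem k x) = Matrix.diagonal fun p => if p.1 = x then 1 else 0 := rfl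

variable {k D}

theorem idem_mul_apply (x : V) (M : Matrix (V × Bool) (V × Bool) k) (r s : V × Bool) :
    (mat (D.idem k x) * M) r s = if r.1 = x then M r s else 0 := by
  rw [idem_val, Matrix.diagonal_mul]
  split_ifs <;> simp

theorem mul_idem_apply (x : V) (M : Matrix (V × Bool) (V × Bool) k) (r s : V × Bool) :
    (M * mat (D.idem k x)) r s = if s.1 = x then M r s else 0 := by
  rw [idem_val, Matrix.mul_diagonal]
  split_ifs <;> simp

open Classical in
/-- The matrix unit given by a relation of the order. -/
noncomputable def unit (k : Type u) [Field k] {s r : V × Bool} (h : D.lt s r) : D.algebra k :=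
  D.ofMatrix (Matrix.single r s 1) (fun r' s' h' => by
    right
    by_contra hlt
    apply h'
    rw [Matrix.single_apply, if_neg]
    rintro ⟨rfl, rfl⟩
    exact hlt h) (fun x => by
    have hne := ne_of_lt h
    rw [Matrix.single_apply, Matrix.single_apply, if_neg, if_neg]
    · rintro ⟨rfl, h2⟩; exact hne h2
    · rintro ⟨rfl, h2⟩; exact hne h2)

theorem unit_val {s r : V × Bool} (h : D.lt s r) :
    mat (D.unit k h) = Matrix.single r s 1 := by
  unfold unit
  rw [mat_ofMatrix]

/-- A nonzero entry of a product of strictly triangular matrices traces a strictly descending chain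
with one more position than there are factors. As positions in a chain are distinct, long products
vanish. -/
theorem strict_list_prod (l : List (D.algebra k)) (hl : ∀ M ∈ l, ∀ r : V × Bool, mat M r r = 0)
    (r s : V × Bool) (h : mat l.prod r s ≠ 0) :
    ∃ c : List (V × Bool), c.length = l.length ∧ (c ++ [s]).Pairwise (fun a b => D.lt b a) ∧
      (∀ a ∈ (c ++ [s]), a = r ∨ D.lt a r) := by
  induction l generalizing r with
  | nil =>
    refine ⟨[], rfl, by simp, fun a ha => ?_⟩
    left
    have ha' : a = s := by simpa using ha
    subst ha'
    by_contra hne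
    apply h
    rw [List.prod_nil, map_one, Matrix.one_apply_ne (Ne.symm hne)]
  | cons M l ih =>
    have h0 : (mat M * mat l.prod) r s ≠ 0 := by
      rw [List.prod_cons, map_mul] at h; exact h
    rw [Matrix.mul_apply] at h0
    obtain ⟨t, -, ht⟩ := Finset.exists_ne_zero_of_sum_ne_zero h0
    have hlt : D.lt t r := by
      rcases D.supported M _ _ (left_ne_zero_of_mul ht) with rfl | h1
      · exact absurd (hl M (by simp) r) (left_ne_zero_of_mul ht)
      · exact h1
    obtain ⟨c, hc, hp, hm⟩ := ih (fun N hN => hl N (by simp [hN])) t (right_ne_zero_of_mul ht)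
    have hm' : ∀ a ∈ c ++ [s], D.lt a r := fun a ha => by
      rcases hm a ha with rfl | h1
      · exact hlt
      · exact D.trans _ _ _ h1 hlt
    refine ⟨r :: c, by simp [hc], ?_, ?_⟩
    · rw [List.cons_append, List.pairwise_cons]
      exact ⟨hm', hp⟩
    · rw [List.cons_append]
      intro a ha
      rcases List.mem_cons.1 ha with rfl | ha
      · exact Or.inl rfl
      · exact Or.inr (hm' a ha)

variable (k D)

/-- The thread algebra is split basic. -/
noncomputable def pointed : PointedAlgebra k (D.algebra k) V where
  e := D.idem k
  ε :=
    { toFun := fun M x => mat M (x, false) (x, false)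
      map_one' := by funext x; exact Matrix.one_apply_eq _
      map_mul' := fun M N => by funext x; exact (D.supported M).mul_diag (D.supported N) _
      map_zero' := rfl
      map_add' := fun _ _ => rfl
      commutes' := fun c => by
        funext x
        change algebraMap k (Matrix (V × Bool) (V × Bool) k) c (x, false) (x, false) = c
        simp [Matrix.algebraMap_matrix_apply] }
  orth i j := by
    refine ext_mat fun r s => ?_
    rw [map_mul, idem_mul_apply]
    by_cases hij : i = j
    · subst hij
      rw [if_pos rfl]
      split_ifs with h
      · rfl
      · rw [idem_val, Matrix.diagonal_apply]; simp [h]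
    · rw [if_neg hij, map_zero, Matrix.zero_apply]
      split_ifs with h
      · rw [idem_val, Matrix.diagonal_apply]
        subst h
        simp [hij]
      · rfl
  sum_e := by
    refine ext_mat fun r s => ?_
    rw [map_sum, Matrix.sum_apply, map_one]
    simp only [idem_val, Matrix.diagonal_apply, Matrix.one_apply]
    split_ifs <;> simp
  ε_e i := by
    funext x
    change mat (D.idem k i) (x, false) (x, false) = _
    rw [idem_val, Matrix.diagonal_apply_eq, Pi.single_apply]
  nilp := by
    refine ⟨Fintype.card (V × Bool), fun l hl hln => ?_⟩
    by_contra hne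
    have : ∃ r s, mat l.prod r s ≠ 0 := by
      by_contra! h
      exact hne (ext_mat h)
    obtain ⟨r, s, hrs⟩ := this
    obtain ⟨c, hc, hp, -⟩ := strict_list_prod l (fun M hM p => by
      have h1 : mat M (p.1, false) (p.1, false) = 0 := congrFun (hl M hM) p.1
      rw [← h1]
      exact diag_eq M p.1 p.2 false) r s hrs
    have hnd : (c ++ [s]).Nodup := hp.imp fun {a b} h => (ne_of_lt h).symm
    have := hnd.length_le_card
    simp at this
    rw [Fintype.card_prod, Fintype.card_bool] at *
    omega

/-- The graph formed by the vertices and the order relations is connected. -/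
def Connected : Prop :=
  ∀ x y, Relation.EqvGen (fun x y => ∃ b c, D.lt (x, b) (y, c)) x y

variable {D}

/-- A central element commutes with the matrix unit of each order relation, which forces its
diagonal entries at both ends to agree. By connectedness its augmentation is constant, and an
idempotent with augmentation `0` or `1` is `0` or `1`. -/
theorem Connected.noCentralIdempotents (hD : D.Connected) :
    NoCentralIdempotents (D.algebra k) := by
  intro z hz hi
  rw [Subring.mem_center_iff] at hz
  have hconst : ∀ x y, (D.pointed k).ε z x = (D.pointed k).ε z y := by
    intro x y
    have hxy := hD x y
    induction hxy with
    | rel x y h =>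
      obtain ⟨b, c, h⟩ := h
      have h1 := congrArg (fun M : D.algebra k => mat M (y, c) (x, b)) (hz (D.unit k h))
      simp only [map_mul] at h1
      rw [unit_val, Matrix.single_mul_apply_same, Matrix.mul_single_apply_same, one_mul, mul_one] at h1
      change mat z (x, false) (x, false) = mat z (y, false) (y, false)
      rw [D.diag_eq z x false b, D.diag_eq z y false c, h1]
    | refl x => rfl
    | symm x y _ h => exact h.symm
    | trans x y w _ _ h h' => exact h.trans h'
  have hzero : ∀ a : D.algebra k, a * a = a → (∀ x y, (D.pointed k).ε a x = (D.pointed k).ε a y) →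
      (∃ x, (D.pointed k).ε a x = 0) → a = 0 := fun a ha hc ⟨x, hx⟩ =>
    (D.pointed k).eq_zero_of_idempotent ha (funext fun y => by rw [hc y x, hx]; rfl)
  rcases isEmpty_or_nonempty V with hV | ⟨⟨x⟩⟩
  · left
    exact (D.pointed k).eq_zero_of_idempotent hi (Subsingleton.elim _ _)
  rcases (D.pointed k).ε_idempotent hi x with h | h
  · exact Or.inl (hzero z hi hconst ⟨x, h⟩)
  · right
    have := hzero (1 - z) hi.one_sub (fun x y => by
      rw [map_sub, map_one, Pi.sub_apply, Pi.sub_apply, hconst x y]; rfl) ⟨x, by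
      rw [map_sub, map_one, Pi.sub_apply, h, Pi.one_apply, sub_self]⟩
    exact (sub_eq_zero.1 this).symm

end Threads

/-! ### Reflections of threads -/

/-- The other copy of the same vertex. -/
def other {V : Type} (p : V × Bool) : V × Bool := (p.1, !p.2)

@[simp] theorem other_fst {V : Type} (p : V × Bool) : (other p).1 = p.1 := rfl

@[simp] theorem other_other {V : Type} (p : V × Bool) : other (other p) = p := by
  simp [other]

theorem other_ne {V : Type} (p : V × Bool) : other p ≠ p := fun h => by
  have := congrArg Prod.snd h
  simp [other] at this

theorem other_injective {V : Type} : Function.Injective (other (V := V)) :=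
  Function.Involutive.injective other_other

theorem eq_or_eq_other {V : Type} {p p' : V × Bool} (h : p.1 = p'.1) : p = p' ∨ p = other p' := by
  obtain ⟨x, b⟩ := p
  obtain ⟨y, c⟩ := p'
  obtain rfl : x = y := h
  cases b <;> cases c <;> simp [other]

namespace Threads

/-- `D'` is obtained from `D` by the reflection at the vertex `x`: each copy `(x, j)` of `x` with
`J j` is removed from its thread and inserted immediately before the other copy of its
predecessor `q j`; the copies `(x, j)` with `¬ J j` are isolated. -/
structure IsReflection {V : Type} (D D' : Threads V) (x : V) (J : Bool → Bool)
    (q : Bool → V × Bool) : Prop where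
  ne : ∀ j, J j → (q j).1 ≠ x
  lt_self : ∀ j, J j → D.lt (q j) (x, j)
  pred : ∀ j, J j → ∀ s, D.lt s (x, j) → s = q j ∨ D.lt s (q j)
  succ : ∀ j, J j → ∀ r, D.lt (q j) r → r = (x, j) ∨ D.lt (x, j) r
  isol : ∀ j, ¬ J j → ∀ s, ¬ D.lt s (x, j) ∧ ¬ D.lt (x, j) s
  exists_arm : ∃ j, J j
  lt_iff : ∀ r s, r.1 ≠ x → s.1 ≠ x → (D'.lt r s ↔ D.lt r s)
  lt_left : ∀ j, J j → ∀ r, r.1 ≠ x → (D'.lt (x, j) r ↔ r = other (q j) ∨ D.lt (other (q j)) r)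
  lt_right : ∀ j, J j → ∀ r, r.1 ≠ x → (D'.lt r (x, j) ↔ D.lt r (other (q j)))
  lt_both : ∀ i j, J i → J j → (D'.lt (x, i) (x, j) ↔ D.lt (other (q i)) (other (q j)))
  isol' : ∀ j, ¬ J j → ∀ s, ¬ D'.lt s (x, j) ∧ ¬ D'.lt (x, j) s

/-! ### Projective left ideals spanned by columns. -/

section Cols

variable {V : Type} [Fintype V] [DecidableEq V] (k : Type u) [Field k] (D : Threads V)

/-- The projective left ideal of matrices whose columns belong to vertices in `S`. -/
def cols (S : V → Prop) : Submodule (D.algebra k) (D.algebra k) where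
  carrier := {M | ∀ r s, ¬ S s.1 → mat M r s = 0}
  add_mem' {M N} hM hN r s hs := by
    rw [map_add, Matrix.add_apply, hM r s hs, hN r s hs, add_zero]
  zero_mem' _ _ _ := by rw [map_zero, Matrix.zero_apply]
  smul_mem' c M hM r s hs := by
    rw [smul_eq_mul, map_mul, Matrix.mul_apply]
    exact Finset.sum_eq_zero fun t _ => by rw [hM t s hs, mul_zero]

variable {k D}

variable (k D)

open Classical in
/-- The idempotent of a set of vertices. -/
noncomputable def colIdem (S : V → Prop) : D.algebra k :=
  D.ofMatrix (Matrix.diagonal fun p => if S p.1 then 1 else 0) (fun r s h => by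
    left
    by_contra hrs
    exact h (Matrix.diagonal_apply_ne _ hrs)) (fun y => by simp)

variable {k D}

open Classical in
theorem colIdem_val (S : V → Prop) :
    mat (D.colIdem k S) = Matrix.diagonal fun p => if S p.1 then 1 else 0 := rfl

open Classical in
theorem mul_colIdem_apply (S : V → Prop) (M : D.algebra k) (r s : V × Bool) :
    mat (M * D.colIdem k S) r s = if S s.1 then mat M r s else 0 := by
  rw [map_mul, colIdem_val, Matrix.mul_diagonal]
  split_ifs <;> simp

open Classical in
theorem colIdem_mul_apply (S : V → Prop) (M : D.algebra k) (r s : V × Bool) :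
    mat (D.colIdem k S * M) r s = if S r.1 then mat M r s else 0 := by
  rw [map_mul, colIdem_val, Matrix.diagonal_mul]
  split_ifs <;> simp

theorem mul_colIdem_mem (S : V → Prop) (M : D.algebra k) : M * D.colIdem k S ∈ D.cols k S :=
  fun r s hs => by rw [mul_colIdem_apply, if_neg hs]

theorem mul_colIdem_of_mem {S : V → Prop} {M : D.algebra k} (h : M ∈ D.cols k S) :
    M * D.colIdem k S = M := by
  refine ext_mat fun r s => ?_
  rw [mul_colIdem_apply]
  split_ifs with hs
  · rfl
  · exact (h r s hs).symm

theorem colIdem_mem (S : V → Prop) : D.colIdem k S ∈ D.cols k S := by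
  have := mul_colIdem_mem S (1 : D.algebra k)
  rwa [one_mul] at this

variable (k D)

/-- The projection onto a left ideal `cols`. -/
noncomputable def colsProj (S : V → Prop) : D.algebra k →ₗ[D.algebra k] D.cols k S :=
  (LinearMap.toSpanSingleton (D.algebra k) (D.algebra k) (D.colIdem k S)).codRestrict _
    fun M => mul_colIdem_mem S M

theorem colsProj_apply (S : V → Prop) (M : D.cols k S) : D.colsProj k S M.1 = M :=
  Subtype.ext (mul_colIdem_of_mem M.2)

/-- Right multiplication by the idempotent of `S` splits the inclusion into the regular module. -/
instance (S : V → Prop) : Module.Projective (D.algebra k) (D.cols k S) :=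
  Module.Projective.of_split (D.cols k S).subtype (D.colsProj k S)
    (LinearMap.ext fun M => D.colsProj_apply k S M)

instance (S : V → Prop) : Module.Finite (D.algebra k) (D.cols k S) :=
  Module.Finite.of_surjective (D.colsProj k S) fun M => ⟨M.1, D.colsProj_apply k S M⟩

end Cols

/-! ### The tilting module of a reflection. -/

section Tilting

variable {V : Type} [Fintype V] [DecidableEq V] (k : Type u) [Field k] (D : Threads V)
  (x : V) (J : Bool → Bool) (q : Bool → V × Bool)

open Classical in
/-- The element of the algebra given by the arrow from `q j` to `(x, j)`. -/
noncomputable def arm (j : Bool) : D.algebra k :=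
  if h : J j = true ∧ D.lt (q j) (x, j) then D.unit k h.2 else 0

/-- The projective cover of the direct sum of the projective modules at the vertices other than `x`
and of the cokernel `T_x`. -/
abbrev tiltCover : Type u :=
  D.cols k (fun y => y ≠ x) × ((j : Bool) → D.cols k (fun y => J j = true ∧ y = (q j).1))

variable {D x J q}

section

variable {k}

/-- Being a matrix unit, an arm carries row `q j` to row `(x, j)` from the left and column `(x, j)`
to column `q j` from the right. The computations with the tilting module rest on these two rules. -/
theorem arm_mul_apply (h : ∀ j, J j → D.lt (q j) (x, j)) (j : Bool)
    (M : Matrix (V × Bool) (V × Bool) k) (r s : V × Bool) :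
    (mat (D.arm k x J q j) * M) r s = if J j = true ∧ r = (x, j) then M (q j) s else 0 := by
  unfold arm
  by_cases hj : J j = true
  · rw [dif_pos ⟨hj, h j hj⟩, unit_val]
    split_ifs with hr
    · obtain ⟨-, rfl⟩ := hr
      rw [Matrix.single_mul_apply_same, one_mul]
    · exact Matrix.single_mul_apply_of_ne _ _ _ _ _ (fun e => hr ⟨hj, e⟩) _
  · rw [dif_neg fun e => hj e.1, if_neg fun e => hj e.1]
    rw [map_zero, zero_mul, Matrix.zero_apply]

theorem mul_arm_apply (h : ∀ j, J j → D.lt (q j) (x, j)) (j : Bool)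
    (M : Matrix (V × Bool) (V × Bool) k) (r s : V × Bool) :
    (M * mat (D.arm k x J q j)) r s = if J j = true ∧ s = q j then M r (x, j) else 0 := by
  unfold arm
  by_cases hj : J j = true
  · rw [dif_pos ⟨hj, h j hj⟩, unit_val]
    split_ifs with hr
    · obtain ⟨-, rfl⟩ := hr
      rw [Matrix.mul_single_apply_same, mul_one]
    · exact Matrix.mul_single_apply_of_ne _ _ _ _ _ (fun e => hr ⟨hj, e⟩) _
  · rw [dif_neg fun e => hj e.1, if_neg fun e => hj e.1]
    rw [map_zero, mul_zero, Matrix.zero_apply]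

end

theorem mul_arm_apply_of_ne (j : Bool) (M : D.algebra k) {r s : V × Bool} (hs : s ≠ q j) :
    mat (M * D.arm k x J q j) r s = 0 := by
  rw [map_mul]
  unfold arm
  split_ifs with hj
  · rw [unit_val, Matrix.mul_single_apply_of_ne]
    exact fun e => hs e
  · rw [map_zero, mul_zero, Matrix.zero_apply]

theorem mul_arm_mem (M : D.algebra k) (j : Bool) :
    M * D.arm k x J q j ∈ D.cols k (fun y => J j = true ∧ y = (q j).1) := by
  intro r s hs
  by_cases hj : J j = true
  · exact mul_arm_apply_of_ne _ _ _ fun e => hs ⟨hj, by rw [e]⟩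
  · rw [arm, dif_neg fun e => hj e.1, mul_zero, map_zero, Matrix.zero_apply]

variable (D x J q)

/-- The inclusion of the projective module at `x` into the sum of the projective modules at the
predecessors. -/
noncomputable def tiltIncl : D.cols k (fun y => y = x) →ₗ[D.algebra k] D.tiltCover k x J q where
  toFun m := (0, fun j => ⟨m.1 * D.arm k x J q j, mul_arm_mem k m.1 j⟩)
  map_add' m n := Prod.ext (by simp) (funext fun j => Subtype.ext (add_mul _ _ _))
  map_smul' c m := Prod.ext (by simp) (funext fun j => Subtype.ext (mul_assoc _ _ _))

/-- The tilting module of the reflection at `x`. -/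
abbrev tiltModule : Type u :=
  D.tiltCover k x J q ⧸ LinearMap.range (D.tiltIncl k x J q)

instance : Module.Projective (D.algebra k) (D.tiltCover k x J q) :=
  have : Module.Projective (D.algebra k)
      ((j : Bool) → D.cols k (fun y => J j = true ∧ y = (q j).1)) :=
    Module.Projective.of_equiv (DirectSum.linearEquivFunOnFintype (D.algebra k) Bool
      fun j => D.cols k (fun y => J j = true ∧ y = (q j).1))
  inferInstance

instance : Module.Finite k (D.tiltModule k x J q) := Module.Finite.trans (D.algebra k) _

end Tilting

end Threads

namespace Threads

/-! ### Coordinates, generators and relations of the tilting module. -/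

section Coord

variable {V : Type} [Fintype V] [DecidableEq V] {k : Type u} [Field k] {D : Threads V}
  {x : V} {J : Bool → Bool} {q : Bool → V × Bool}

noncomputable instance : Module (D.algebra k) (Matrix (V × Bool) (V × Bool) k) :=
  Module.compHom _ (mat : D.algebra k →ₐ[k] Matrix (V × Bool) (V × Bool) k).toRingHom

theorem sum_vertex_split (x : V) (F : V × Bool → k) :
    ∑ p, F p = ∑ p, (if p.1 = x then 0 else F p) + ∑ j, F (x, j) := by
  have h : ∑ j, F (x, j) = ∑ p : V × Bool, (if p.1 = x then F p else 0) := by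
    rw [Fintype.sum_prod_type, Finset.sum_comm]
    simp
  rw [h, ← Finset.sum_add_distrib]
  refine Finset.sum_congr rfl fun p _ => ?_
  split_ifs <;> simp

variable (k D x J q) in
/-- Coordinates on the tilting module, one column for each position. -/
noncomputable def coord : D.tiltModule k x J q →ₗ[D.algebra k] Matrix (V × Bool) (V × Bool) k :=
  (LinearMap.range (D.tiltIncl k x J q)).liftQ
    -- In component `j` the image of `P_x` lies in column `q j`, so the column of the other position
    -- of that vertex survives in the quotient.
    { toFun := fun g => Matrix.of fun r s =>
        if s.1 = x then mat (g.2 s.2).1 r (other (q s.2)) else mat g.1.1 r s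
      map_add' := fun g g' => Matrix.ext fun r s => by
        change (if s.1 = x then mat ((g.2 s.2).1 + (g'.2 s.2).1) r (other (q s.2))
          else mat (g.1.1 + g'.1.1) r s) =
          (if s.1 = x then mat (g.2 s.2).1 r (other (q s.2)) else mat g.1.1 r s) +
          (if s.1 = x then mat (g'.2 s.2).1 r (other (q s.2)) else mat g'.1.1 r s)
        split_ifs <;> rw [map_add, Matrix.add_apply]
      map_smul' := fun a g => Matrix.ext fun r s => by
        change (if s.1 = x then mat (a * (g.2 s.2).1) r (other (q s.2))
          else mat (a * g.1.1) r s) = ∑ t, mat a r t * 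
          (if s.1 = x then mat (g.2 s.2).1 t (other (q s.2)) else mat g.1.1 t s)
        split_ifs <;> rw [map_mul, Matrix.mul_apply] } (by
    rintro _ ⟨m, rfl⟩
    rw [LinearMap.mem_ker]
    ext r s
    change (if s.1 = x then mat (m.1 * D.arm k x J q s.2) r (other (q s.2))
      else mat (0 : D.algebra k) r s) = 0
    split_ifs
    · exact mul_arm_apply_of_ne k _ _ (other_ne _)
    · rw [map_zero, Matrix.zero_apply])

theorem coord_mkQ (g : D.tiltCover k x J q) (r s : V × Bool) :
    D.coord k x J q (Submodule.mkQ _ g) r s =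
      if s.1 = x then mat (g.2 s.2).1 r (other (q s.2)) else mat g.1.1 r s := rfl

theorem coord_smul (a : D.algebra k) (t : D.tiltModule k x J q) :
    D.coord k x J q (a • t) = mat a * D.coord k x J q t := map_smul _ _ _

/-- This is the shape of the reflected order: a column `(x, j)` reaches exactly as far as the column
of `other (q j)`, before which `(x, j)` is going to be inserted. -/
theorem coord_support (t : D.tiltModule k x J q) {r s : V × Bool}
    (h : D.coord k x J q t r s ≠ 0) :
    (s.1 ≠ x → r = s ∨ D.lt s r) ∧
      (s.1 = x → J s.2 = true ∧ (r = other (q s.2) ∨ D.lt (other (q s.2)) r)) := by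
  obtain ⟨g, rfl⟩ := Submodule.mkQ_surjective _ t
  rw [coord_mkQ] at h
  constructor
  · intro hs
    rw [if_neg hs] at h
    exact supported _ _ _ h
  · intro hs
    rw [if_pos hs] at h
    refine ⟨?_, supported _ _ _ h⟩
    by_contra hJ
    exact h ((g.2 s.2).2 _ _ fun e => hJ e.1)

theorem coord_diag (t : D.tiltModule k x J q) {y : V} (hy : y ≠ x) (b c : Bool) :
    D.coord k x J q t (y, b) (y, b) = D.coord k x J q t (y, c) (y, c) := by
  obtain ⟨g, rfl⟩ := Submodule.mkQ_surjective _ t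
  rw [coord_mkQ, coord_mkQ, if_neg hy, if_neg hy]
  exact diag_eq _ _ _ _

variable (k D x J q)

/-- The generator of the projective summands of the tilting module. -/
noncomputable def gen : D.tiltModule k x J q :=
  Submodule.mkQ _ (⟨D.colIdem k (fun y => y ≠ x), colIdem_mem _⟩, 0)

/-- The generators of the remaining summand of the tilting module. -/
noncomputable def armGen (j : Bool) : D.tiltModule k x J q :=
  Submodule.mkQ _ (0, Pi.single j ⟨D.colIdem k (fun y => J j = true ∧ y = (q j).1), colIdem_mem _⟩)

/-- The homomorphism on the projective cover given by the images of the generators. -/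
noncomputable def coverHom {M : Type*} [AddCommGroup M] [Module (D.algebra k) M] (u : M)
    (w : Bool → M) : D.tiltCover k x J q →ₗ[D.algebra k] M where
  toFun g := g.1.1 • u + ∑ j, (g.2 j).1 • w j
  map_add' g g' := by
    simp only [Prod.fst_add, Prod.snd_add, Pi.add_apply, Submodule.coe_add, add_smul,
      Finset.sum_add_distrib]
    abel
  map_smul' a g := by
    simp only [Prod.smul_fst, Prod.smul_snd, Pi.smul_apply, Submodule.coe_smul, smul_eq_mul,
      mul_smul, RingHom.id_apply, smul_add, Finset.smul_sum]

variable {k D x J q}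

theorem coverHom_apply {M : Type*} [AddCommGroup M] [Module (D.algebra k) M] (u : M)
    (w : Bool → M) (g : D.tiltCover k x J q) :
    D.coverHom k x J q u w g = g.1.1 • u + ∑ j, (g.2 j).1 • w j := rfl

/-- An endomorphism of the tilting module is thus determined by the images of `gen` and of the
`armGen j`. -/
theorem mkQ_eq (g : D.tiltCover k x J q) :
    Submodule.mkQ (LinearMap.range (D.tiltIncl k x J q)) g =
      g.1.1 • D.gen k x J q + ∑ j, (g.2 j).1 • D.armGen k x J q j := by
  unfold gen armGen
  simp only [← map_smul]
  rw [← map_sum, ← map_add]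
  congr 1
  refine Prod.ext ?_ (funext fun i => ?_)
  · rw [Prod.fst_add, Prod.fst_sum]
    simp only [Prod.smul_fst, smul_zero, Finset.sum_const_zero, add_zero]
    exact Subtype.ext (mul_colIdem_of_mem g.1.2).symm
  · rw [Prod.snd_add, Prod.snd_sum]
    simp only [Prod.smul_snd, smul_zero, zero_add, Finset.sum_apply, Pi.smul_apply]
    rw [Finset.sum_eq_single i]
    · rw [Pi.single_eq_same]
      exact Subtype.ext (mul_colIdem_of_mem (g.2 i).2).symm
    · intro j _ hj
      rw [Pi.single_eq_of_ne hj.symm, smul_zero]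
    · simp

/-- The defining relation of the cokernel: it is the image of the idempotent `e_x` under the
inclusion of `P_x`. -/
theorem sum_arm_smul_armGen : ∑ j, D.arm k x J q j • D.armGen k x J q j = 0 := by
  have h := mkQ_eq (D.tiltIncl k x J q ⟨D.colIdem k (fun y => y = x), colIdem_mem _⟩)
  rw [show Submodule.mkQ (LinearMap.range (D.tiltIncl k x J q)) (D.tiltIncl k x J q
    ⟨D.colIdem k (fun y => y = x), colIdem_mem _⟩) = 0 from
    (Submodule.Quotient.mk_eq_zero _).2 ⟨_, rfl⟩] at h
  rw [h]
  change _ = (0 : D.algebra k) • _ + ∑ j, (D.colIdem k (fun y => y = x) * D.arm k x J q j) • _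
  rw [zero_smul, zero_add]
  refine Finset.sum_congr rfl fun j _ => ?_
  congr 1
  refine ext_mat fun r s => ?_
  rw [colIdem_mul_apply]
  split_ifs with hr
  · rfl
  · unfold arm
    split_ifs with hj
    · rw [unit_val]
      by_contra h0
      refine h0 (Matrix.single_apply_of_ne _ _ _ _ _ fun e => hr ?_)
      rw [← e.1]
    · rw [map_zero, Matrix.zero_apply]

/-- As `P_x` is generated by `e_x`, the single relation `∑ arm j • w j = 0` is all that a map on the
cover must respect in order to descend to the quotient. -/
theorem arm_smul_gen_ext (u : D.tiltModule k x J q) (w : Bool → D.tiltModule k x J q)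
    (hw : ∑ j, D.arm k x J q j • w j = 0) :
    ∃ f : D.tiltModule k x J q →ₗ[D.algebra k] D.tiltModule k x J q,
      ∀ g, f (Submodule.mkQ _ g) = D.coverHom k x J q u w g := by
  refine ⟨(LinearMap.range (D.tiltIncl k x J q)).liftQ (D.coverHom k x J q u w) ?_, fun g => rfl⟩
  rintro _ ⟨m, rfl⟩
  rw [LinearMap.mem_ker, coverHom_apply]
  change (0 : D.algebra k) • u + ∑ j, (m.1 * D.arm k x J q j) • w j = 0
  simp only [mul_smul]
  rw [← Finset.smul_sum, hw, smul_zero, zero_smul, zero_add]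

end Coord

end Threads

set_option linter.unusedSectionVars false

namespace Threads

/-! ### From endomorphisms of the tilting module to the reflected thread algebra. -/

section EndHom

variable {V : Type} [Fintype V] [DecidableEq V] {k : Type u} [Field k] {D D' : Threads V}
  {x : V} {J : Bool → Bool} {q : Bool → V × Bool}

theorem IsReflection.ne_other (h : D.IsReflection D' x J q) {j : Bool} (hj : J j = true) :
    (other (q j)).1 ≠ x := h.ne j hj

/-- A position has only one immediate successor on its thread, so the two positions of `x` cannot
share a predecessor. -/
theorem IsReflection.q_inj (h : D.IsReflection D' x J q) {i j : Bool} (hi : J i = true)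
    (hj : J j = true) (hq : q i = q j) : i = j := by
  by_contra hij
  have h1 := h.lt_self i hi
  rw [hq] at h1
  rcases h.succ j hj _ h1 with h2 | h2
  · exact hij (congrArg Prod.snd h2)
  · rcases h.pred i hi _ h2 with h3 | h3
    · exact h.ne i hi (congrArg Prod.fst h3).symm
    · rw [hq] at h3
      exact asymm h3 (h.lt_self j hj)

theorem coord_gen (r s : V × Bool) :
    D.coord k x J q (D.gen k x J q) r s = if s.1 = x then 0 else if r = s then 1 else 0 := by
  unfold gen
  rw [coord_mkQ]
  split_ifs with hs hrs
  · exact congrFun (congrFun (map_zero mat) r) _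
  · rw [colIdem_val, hrs, Matrix.diagonal_apply_eq, if_pos hs]
  · rw [colIdem_val, Matrix.diagonal_apply_ne _ hrs]

theorem coord_armGen {j : Bool} (hj : J j = true) (r s : V × Bool) :
    D.coord k x J q (D.armGen k x J q j) r s =
      if s = (x, j) ∧ r = other (q j) then 1 else 0 := by
  unfold armGen
  rw [coord_mkQ]
  dsimp only
  obtain ⟨y, i⟩ := s
  by_cases hs : y = x
  · subst hs
    rw [if_pos rfl]
    by_cases hij : i = j
    · subst hij
      rw [Pi.single_eq_same, colIdem_val, Matrix.diagonal_apply]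
      simp only [hj, true_and]
      split_ifs with h1 h2
      · rfl
      · exact absurd (h1 ▸ rfl) h2
      · rfl
    · rw [Pi.single_eq_of_ne hij, if_neg fun e => hij (congrArg Prod.snd e.1)]
      exact congrFun (congrFun (map_zero mat) r) _
  · rw [if_neg hs, if_neg fun e => hs (congrArg Prod.fst e.1)]
    exact congrFun (congrFun (map_zero mat) r) _

theorem mat_arm_smul (h : D.IsReflection D' x J q) (j : Bool) (t : D.tiltModule k x J q)
    (s : V × Bool) (hj : J j = true) :
    D.coord k x J q (D.arm k x J q j • t) (x, j) s = D.coord k x J q t (q j) s := by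
  rw [coord_smul, arm_mul_apply h.lt_self, if_pos ⟨hj, rfl⟩]

variable (f : Module.End (D.algebra k) (D.tiltModule k x J q))

theorem sum_arm_smul_apply : ∑ j, D.arm k x J q j • f (D.armGen k x J q j) = 0 := by
  have := congrArg f (sum_arm_smul_armGen (D := D) (k := k) (x := x) (J := J) (q := q))
  rw [map_sum, map_zero] at this
  rw [← this]
  exact Finset.sum_congr rfl fun j _ => (map_smul f _ _).symm

/-- Apply `f` to the relation between the generators and read off row `(x, j)`. Different arms land
in different rows, so only the `j`-th term contributes. -/
theorem coord_armGen_pred (h : D.IsReflection D' x J q) {j : Bool} (hj : J j = true)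
    (s : V × Bool) : D.coord k x J q (f (D.armGen k x J q j)) (q j) s = 0 := by
  have h1 := congrArg (fun t => D.coord k x J q t (x, j) s) (sum_arm_smul_apply f)
  simp only [map_sum, map_zero, Matrix.zero_apply, Matrix.sum_apply] at h1
  rw [Finset.sum_eq_single j, mat_arm_smul h _ _ _ hj] at h1
  · exact h1
  · intro i _ hij
    rw [coord_smul, arm_mul_apply h.lt_self, if_neg]
    exact fun e => hij (congrArg Prod.snd e.2).symm
  · simp

/-- Lifted to the cover, the relation for the images under `f` holds only up to an element `m` of
`P_x`. Its entry at row `(x, j)` and column `q j` identifies the coordinate for the arm `j` with the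
diagonal entry of `m` at `(x, j)`, and `m` has equal diagonal entries at the two positions of `x`.
-/
theorem coord_armGen_top (h : D.IsReflection D' x J q) (hJ : ∀ j, J j = true) (i j : Bool) :
    D.coord k x J q (f (D.armGen k x J q i)) (other (q i)) (x, i) =
      D.coord k x J q (f (D.armGen k x J q j)) (other (q j)) (x, j) := by
  have hlift : ∀ j, ∃ g : D.tiltCover k x J q, Submodule.mkQ _ g = f (D.armGen k x J q j) :=
    fun j => Submodule.mkQ_surjective _ _
  choose g hg using hlift
  have h0 := sum_arm_smul_apply f
  simp only [← hg, ← map_smul] at h0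
  rw [← map_sum, Submodule.mkQ_apply, Submodule.Quotient.mk_eq_zero] at h0
  obtain ⟨m, hm⟩ := h0
  have key : ∀ j, D.coord k x J q (f (D.armGen k x J q j)) (other (q j)) (x, j) =
      mat m.1 (x, j) (x, j) := by
    intro j
    have h1 := congrArg (fun g : D.tiltCover k x J q => mat (g.2 j).1 (x, j) (q j)) hm
    rw [← hg, coord_mkQ, if_pos rfl]
    have h2 : mat (m.1 * D.arm k x J q j) (x, j) (q j) = mat m.1 (x, j) (x, j) := by
      rw [map_mul, mul_arm_apply h.lt_self, if_pos ⟨hJ j, rfl⟩]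
    rw [← h2]
    refine Eq.trans ?_ h1.symm
    dsimp only
    rw [Prod.snd_sum, Finset.sum_apply]
    have h3 : ((∑ i, (D.arm k x J q i • g i).2 j : D.cols k _) : D.algebra k) =
      ∑ i, D.arm k x J q i * ((g i).2 j).1 := by
      rw [Submodule.coe_sum]; rfl
    rw [h3, map_sum, Matrix.sum_apply, Finset.sum_eq_single j]
    · rw [map_mul, arm_mul_apply h.lt_self, if_pos ⟨hJ j, rfl⟩]
      exact diag_eq _ _ _ _
    · intro i _ hij
      rw [map_mul, arm_mul_apply h.lt_self, if_neg]
      exact fun e => hij (congrArg Prod.snd e.2).symm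
    · simp
  rw [key, key]
  exact diag_eq _ _ _ _

/-- The matrix of an endomorphism of the tilting module. -/
noncomputable def endMatrix : Matrix (V × Bool) (V × Bool) k := Matrix.of fun c s =>
  if c.1 = x then
    if J c.2 = true then D.coord k x J q (f (D.armGen k x J q c.2)) (other (q c.2)) s
    -- A position without arm is isolated in `D'`. Its row consists of the diagonal entry, copied
    -- from the other position of `x`.
    else if s = c then
      D.coord k x J q (f (D.armGen k x J q !c.2)) (other (q !c.2)) (other c)
    else 0
  else D.coord k x J q (f (D.gen k x J q)) c s

theorem endMatrix_of_ne {c : V × Bool} (hc : c.1 ≠ x) (s : V × Bool) :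
    endMatrix f c s = D.coord k x J q (f (D.gen k x J q)) c s := by
  unfold endMatrix
  rw [Matrix.of_apply, if_neg hc]

theorem endMatrix_of_arm {j : Bool} (hj : J j = true) (s : V × Bool) :
    endMatrix f (x, j) s = D.coord k x J q (f (D.armGen k x J q j)) (other (q j)) s := by
  unfold endMatrix
  rw [Matrix.of_apply, if_pos rfl, if_pos hj]

theorem endMatrix_of_not_arm {j : Bool} (hj : ¬ J j = true) (s : V × Bool) :
    endMatrix f (x, j) s = if s = (x, j) then
      D.coord k x J q (f (D.armGen k x J q !j)) (other (q !j)) (other (x, j)) else 0 := by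
  unfold endMatrix
  rw [Matrix.of_apply, if_pos rfl, if_neg hj]

/-- Induction over the rows of a matrix: a vertex is different from `x`, or an arm, or neither. -/
theorem row_cases {P : V × Bool → Prop} (x : V) (J : Bool → Bool) (h1 : ∀ c, c.1 ≠ x → P c)
    (h2 : ∀ j, J j = true → P (x, j)) (h3 : ∀ j, ¬ J j = true → P (x, j)) (c : V × Bool) : P c := by
  obtain ⟨y, j⟩ := c
  by_cases hy : y = x
  · subst hy
    by_cases hj : J j = true
    · exact h2 j hj
    · exact h3 j hj
  · exact h1 _ hy

theorem IsReflection.lt_both_of (h : D.IsReflection D' x J q) {i j : Bool} (hi : J i = true)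
    (hj : J j = true) (h' : other (q j) = other (q i) ∨ D.lt (other (q i)) (other (q j))) :
    (x, j) = (x, i) ∨ D'.lt (x, i) (x, j) := by
  rcases h' with h' | h'
  · rw [h.q_inj hi hj (other_injective h').symm]
    exact Or.inl rfl
  · exact Or.inr ((h.lt_both i j hi hj).2 h')

theorem supported_endMatrix (h : D.IsReflection D' x J q) : D'.Supported (endMatrix f) := by
  refine row_cases x J (fun c hc s hs => ?_) (fun j hj s hs => ?_) fun j hj s hs => ?_
  · rw [endMatrix_of_ne f hc] at hs
    obtain ⟨h1, h2⟩ := coord_support _ hs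
    by_cases hsx : s.1 = x
    · obtain ⟨hJ, h3⟩ := h2 hsx
      obtain ⟨y, i⟩ := s
      obtain rfl : y = x := hsx
      exact Or.inr ((h.lt_left i hJ c hc).2 h3)
    · exact (h1 hsx).imp id (h.lt_iff s c hsx hc).2
  · rw [endMatrix_of_arm f hj] at hs
    obtain ⟨h1, h2⟩ := coord_support _ hs
    by_cases hsx : s.1 = x
    · obtain ⟨hJ, h3⟩ := h2 hsx
      obtain ⟨y, i⟩ := s
      obtain rfl : y = x := hsx
      exact h.lt_both_of hJ hj h3
    -- The entry in column `other (q j)` is a diagonal one. It equals the diagonal entry at `q j`,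
    -- which vanishes by `coord_armGen_pred`.
    · rcases h1 hsx with rfl | h3
      · refine absurd ?_ hs
        rw [← coord_armGen_pred f h hj (q j)]
        exact coord_diag _ (h.ne j hj) _ _
      · exact Or.inr ((h.lt_right j hj s hsx).2 h3)
  · rw [endMatrix_of_not_arm f hj] at hs
    left
    by_contra hne
    exact hs (if_neg (Ne.symm hne))

theorem endMatrix_diag (h : D.IsReflection D' x J q) (y : V) :
    endMatrix f (y, false) (y, false) = endMatrix f (y, true) (y, true) := by
  by_cases hy : y = x
  · subst hy
    by_cases h0 : J false = true <;> by_cases h1 : J true = true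
    · rw [endMatrix_of_arm f h0, endMatrix_of_arm f h1]
      exact coord_armGen_top f h (fun j => by cases j <;> assumption) _ _
    · rw [endMatrix_of_arm f h0, endMatrix_of_not_arm f h1, if_pos rfl]
      rfl
    · rw [endMatrix_of_not_arm f h0, endMatrix_of_arm f h1, if_pos rfl]
      rfl
    · obtain ⟨j, hj⟩ := h.exists_arm
      cases j <;> contradiction
  · rw [endMatrix_of_ne f hy, endMatrix_of_ne f hy]
    exact coord_diag _ hy _ _

/-- The row of an isolated position carries no information of its own: only its diagonal entry can
be nonzero, and an armed position of `x` has the same one. -/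
theorem ext_mat_of_rows (h : D.IsReflection D' x J q) {M N : D'.algebra k}
    (h1 : ∀ c, c.1 ≠ x → ∀ s, mat M c s = mat N c s)
    (h2 : ∀ j, J j = true → ∀ s, mat M (x, j) s = mat N (x, j) s) : M = N := by
  refine ext_mat (row_cases x J h1 h2 fun j hj s => ?_)
  by_cases hs : (x, j) = s
  · subst hs
    obtain ⟨i, hi⟩ := h.exists_arm
    rw [diag_eq M x j i, diag_eq N x j i, h2 i hi]
  · rw [zero_of M hs (h.isol' j hj s).1, zero_of N hs (h.isol' j hj s).1]

/-- The element of the reflected algebra given by an endomorphism of the tilting module. -/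
noncomputable def endAlg (h : D.IsReflection D' x J q) : D'.algebra k :=
  D'.ofMatrix (endMatrix f) (supported_endMatrix f h) (endMatrix_diag f h)

/-- In coordinates an endomorphism is right multiplication by its matrix. Composition therefore
reverses the order of factors, whence the opposite ring. -/
theorem coord_apply (h : D.IsReflection D' x J q) (t : D.tiltModule k x J q) :
    D.coord k x J q (f t) = D.coord k x J q t * mat (endAlg f h) := by
  ext r s
  rw [Matrix.mul_apply, sum_vertex_split x]
  have hx : ∀ j, D.coord k x J q t r (x, j) * mat (endAlg f h) (x, j) s =
      D.coord k x J q t r (x, j) * D.coord k x J q (f (D.armGen k x J q j)) (other (q j)) s := by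
    intro j
    by_cases hj : J j = true
    · rw [← endMatrix_of_arm f hj]; rfl
    · have : D.coord k x J q t r (x, j) = 0 := by
        by_contra h0
        exact hj ((coord_support t h0).2 rfl).1
      rw [this, zero_mul, zero_mul]
  have hne : ∀ p : V × Bool, (if p.1 = x then 0 else D.coord k x J q t r p *
      mat (endAlg f h) p s) = if p.1 = x then 0 else D.coord k x J q t r p *
      D.coord k x J q (f (D.gen k x J q)) p s := by
    intro p
    split_ifs with hp
    · rfl
    · rw [← endMatrix_of_ne f hp]; rfl
  simp only [hx, hne]
  obtain ⟨g, rfl⟩ := Submodule.mkQ_surjective _ t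
  conv_lhs => rw [mkQ_eq, map_add, map_sum, map_smul, map_add, map_sum, Matrix.add_apply,
    Matrix.sum_apply]
  congr 1
  · rw [coord_smul, Matrix.mul_apply]
    refine Finset.sum_congr rfl fun p _ => ?_
    rw [coord_mkQ]
    split_ifs with hp
    · rw [g.1.2 r p (fun e => e hp), zero_mul]
    · rfl
  · refine Finset.sum_congr rfl fun j _ => ?_
    rw [map_smul, coord_smul, coord_mkQ, if_pos rfl, Matrix.mul_apply]
    by_cases hj : J j = true
    · rw [Finset.sum_eq_single (other (q j))]
      · intro p _ hp
        by_cases hpq : p.1 = (q j).1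
        · rcases eq_or_eq_other hpq with rfl | h'
          · rw [coord_armGen_pred f h hj, mul_zero]
          · exact absurd h' hp
        · rw [(g.2 j).2 r p (fun e => hpq e.2), zero_mul]
      · simp
    · rw [(g.2 j).2 r _ (fun e => hj e.1), zero_mul]
      refine Finset.sum_eq_zero fun p _ => ?_
      rw [(g.2 j).2 r _ (fun e => hj e.1), zero_mul]

/-- The algebra homomorphism from the endomorphism ring of the tilting module to the reflected
thread algebra. -/
noncomputable def endHom (h : D.IsReflection D' x J q) :
    (Module.End (D.algebra k) (D.tiltModule k x J q))ᵐᵒᵖ →ₐ[k] D'.algebra k where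
  toFun f := endAlg f.unop h
  map_one' := ext_mat_of_rows h
    (fun c hc s => by
      change endMatrix _ c s = (mat 1) c s
      rw [endMatrix_of_ne _ hc, map_one, Matrix.one_apply]
      change D.coord k x J q (D.gen k x J q) c s = _
      rw [coord_gen]
      split_ifs with h1 h2
      · exact absurd (h2 ▸ h1) hc
      all_goals rfl)
    (fun j hj s => by
      change endMatrix _ (x, j) s = (mat 1) (x, j) s
      rw [endMatrix_of_arm _ hj, map_one, Matrix.one_apply]
      change D.coord k x J q (D.armGen k x J q j) _ s = _
      rw [coord_armGen hj]
      simp only [and_true, eq_comm])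
  map_mul' f g := ext_mat_of_rows h
    (fun c hc s => by
      rw [map_mul]
      change endMatrix _ c s = _
      rw [endMatrix_of_ne _ hc, MulOpposite.unop_mul, Module.End.mul_apply, coord_apply _ h,
        Matrix.mul_apply, Matrix.mul_apply]
      refine Finset.sum_congr rfl fun p _ => ?_
      rw [← endMatrix_of_ne _ hc]
      rfl)
    (fun j hj s => by
      rw [map_mul]
      change endMatrix _ (x, j) s = _
      rw [endMatrix_of_arm _ hj, MulOpposite.unop_mul, Module.End.mul_apply, coord_apply _ h,
        Matrix.mul_apply, Matrix.mul_apply]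
      refine Finset.sum_congr rfl fun p _ => ?_
      rw [← endMatrix_of_arm _ hj]
      rfl)
  map_zero' := ext_mat_of_rows h
    (fun c hc s => by
      rw [map_zero]
      change endMatrix _ c s = _
      rw [endMatrix_of_ne _ hc, MulOpposite.unop_zero, LinearMap.zero_apply, map_zero])
    (fun j hj s => by
      rw [map_zero]
      change endMatrix _ (x, j) s = _
      rw [endMatrix_of_arm _ hj, MulOpposite.unop_zero, LinearMap.zero_apply, map_zero]; rfl)
  map_add' f g := ext_mat_of_rows h
    (fun c hc s => by
      rw [map_add]
      change endMatrix (f.unop + g.unop) c s = endMatrix f.unop c s + endMatrix g.unop c s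
      simp only [endMatrix_of_ne _ hc]
      rw [LinearMap.add_apply, map_add, Matrix.add_apply])
    (fun j hj s => by
      rw [map_add]
      change endMatrix (f.unop + g.unop) (x, j) s = endMatrix f.unop (x, j) s + endMatrix g.unop (x, j) s
      simp only [endMatrix_of_arm _ hj]
      rw [LinearMap.add_apply, map_add, Matrix.add_apply])
  commutes' c := ext_mat_of_rows h
    (fun c' hc s => by
      rw [AlgHom.commutes]
      change endMatrix _ c' s = _
      rw [endMatrix_of_ne _ hc, MulOpposite.algebraMap_apply, MulOpposite.unop_op,
        Module.algebraMap_end_apply, ← algebraMap_smul (D.algebra k) c, coord_smul,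
        AlgHom.commutes, Matrix.algebraMap_eq_diagonal, Matrix.diagonal_mul, coord_gen,
        Matrix.diagonal_apply]
      split_ifs with h1 h2
      · exact absurd (h2 ▸ h1) hc
      all_goals simp)
    (fun j hj s => by
      rw [AlgHom.commutes]
      change endMatrix _ (x, j) s = _
      rw [endMatrix_of_arm _ hj, MulOpposite.algebraMap_apply, MulOpposite.unop_op,
        Module.algebraMap_end_apply, ← algebraMap_smul (D.algebra k) c, coord_smul,
        AlgHom.commutes, Matrix.algebraMap_eq_diagonal, Matrix.diagonal_mul, coord_armGen hj,
        Matrix.diagonal_apply]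
      simp only [and_true, eq_comm (a := s)]
      split_ifs <;> simp)

end EndHom

end Threads

namespace Threads

/-! ### The isomorphism of algebras and the remaining tilting conditions. -/

section Reflection

variable {V : Type} [Fintype V] [DecidableEq V] {k : Type u} [Field k] {D D' : Threads V}
  {x : V} {J : Bool → Bool} {q : Bool → V × Bool}

/-- Vanishing coordinates leave only the column `q j` of component `j`, off its diagonal. Once the
rows at `x` are excluded, these entries lie beyond `(x, j)` and come from `P_x`. The rows at `x`
must be excluded: with two arms, `arm j • armGen j` is nonzero but has zero coordinates. -/
theorem eq_zero_of_coord_eq_zero (h : D.IsReflection D' x J q) (t : D.tiltModule k x J q)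
    (ht : D.colIdem k (fun y => y ≠ x) • t = t) (h0 : D.coord k x J q t = 0) : t = 0 := by
  obtain ⟨g', rfl⟩ := Submodule.mkQ_surjective _ t
  rw [← map_smul] at ht
  obtain ⟨g, hg, hgx⟩ : ∃ g : D.tiltCover k x J q,
      Submodule.mkQ (LinearMap.range (D.tiltIncl k x J q)) g = Submodule.mkQ _ g' ∧
      ∀ i j s, mat (g.2 i).1 (x, j) s = 0 :=
    ⟨_, ht, fun i j s => (colIdem_mul_apply _ (g'.2 i).1 _ s).trans (if_neg fun e => e rfl)⟩
  rw [← hg] at h0 ⊢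
  have hc : ∀ r s, (if s.1 = x then mat (g.2 s.2).1 r (other (q s.2)) else mat g.1.1 r s) = 0 :=
    fun r s => by rw [← coord_mkQ, h0, Matrix.zero_apply]
  have hcol : ∀ j r, mat (g.2 j).1 r (other (q j)) = 0 := fun j r => by
    simpa using hc r (x, j)
  have hqq : ∀ j, mat (g.2 j).1 (q j) (q j) = 0 := fun j => by
    rw [← hcol j (other (q j))]
    exact diag_eq _ _ _ _
  rw [Submodule.mkQ_apply, Submodule.Quotient.mk_eq_zero]
  have hsupp : ∀ j, J j = true → ∀ r, mat (g.2 j).1 r (q j) ≠ 0 → D.lt (x, j) r := by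
    intro j hj r hr
    rcases supported _ _ _ hr with rfl | h1
    · exact absurd (hqq j) hr
    · rcases h.succ j hj r h1 with rfl | h2
      · exact absurd (hgx _ _ _) hr
      · exact h2
  -- The preimage in `P_x` is obtained by moving column `q j` of component `j` back to column `(x,
  -- j)`.
  refine ⟨⟨D.ofMatrix (Matrix.of fun r s => if s.1 = x ∧ J s.2 = true then
    mat (g.2 s.2).1 r (q s.2) else 0) ?_ ?_, ?_⟩, ?_⟩
  · intro r s hrs
    rw [Matrix.of_apply] at hrs
    split_ifs at hrs with hs
    · obtain ⟨y, j⟩ := s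
      obtain ⟨rfl, hj⟩ := hs
      exact Or.inr (hsupp j hj r hrs)
    · exact absurd rfl hrs
  · intro y
    rw [Matrix.of_apply, Matrix.of_apply]
    by_cases hy : y = x
    · subst hy
      simp [hgx]
    · simp [hy]
  · intro r s hs
    rw [mat_ofMatrix, Matrix.of_apply, if_neg fun e => hs e.1]
  · refine Prod.ext (Subtype.ext (ext_mat fun r s => ?_)) (funext fun j => Subtype.ext
      (ext_mat fun r s => ?_))
    · change mat (0 : D.algebra k) r s = _
      rw [map_zero, Matrix.zero_apply]
      by_cases hs : s.1 = x
      · rw [g.1.2 r s fun e => e hs]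
      · have := hc r s
        rw [if_neg hs] at this
        exact this.symm
    · change mat (_ * D.arm k x J q j) r s = _
      rw [map_mul, mul_arm_apply h.lt_self, mat_ofMatrix, Matrix.of_apply]
      by_cases hs : J j = true ∧ s = q j
      · rw [if_pos hs, if_pos ⟨rfl, hs.1⟩, hs.2]
      · rw [if_neg hs]
        by_cases hs' : J j = true ∧ s.1 = (q j).1
        · rcases eq_or_eq_other hs'.2 with h1 | rfl
          · exact absurd ⟨hs'.1, h1⟩ hs
          · exact (hcol _ _).symm
        · exact ((g.2 j).2 r s hs').symm

theorem colIdem_mul_colIdem {S S' : V → Prop} (hS : ∀ y, S y → S' y) :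
    D.colIdem k S' * D.colIdem k S = D.colIdem k S := by
  refine ext_mat fun r s => ?_
  rw [colIdem_mul_apply]
  split_ifs with hr
  · rfl
  · rw [colIdem_val, Matrix.diagonal_apply]
    split_ifs with h1 h2
    · exact absurd (hS _ h2) hr
    all_goals rfl

/-- The generators lie in the part away from row `x`, and so do their images under an endomorphism;
there the coordinates detect zero. -/
theorem endHom_injective (h : D.IsReflection D' x J q) :
    Function.Injective (endHom (k := k) h) := by
  rw [injective_iff_map_eq_zero]
  intro f hf
  have h0 : ∀ t, D.coord k x J q (f.unop t) = 0 := fun t => by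
    rw [coord_apply _ h]
    change _ * mat (endHom h f) = 0
    rw [hf, map_zero, mul_zero]
  have hgen : f.unop (D.gen k x J q) = 0 := by
    refine eq_zero_of_coord_eq_zero h _ ?_ (h0 _)
    rw [← map_smul]
    congr 1
    unfold gen
    rw [← map_smul]
    congr 1
    exact Prod.ext (Subtype.ext (colIdem_mul_colIdem fun y hy => hy)) (smul_zero _)
  have harm : ∀ j, f.unop (D.armGen k x J q j) = 0 := fun j => by
    refine eq_zero_of_coord_eq_zero h _ ?_ (h0 _)
    rw [← map_smul]
    congr 1
    unfold armGen
    rw [← map_smul]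
    congr 1
    refine Prod.ext (smul_zero _) ?_
    rw [Prod.smul_snd, ← Pi.single_smul]
    congr 1
    exact Subtype.ext (colIdem_mul_colIdem fun y hy e => h.ne j hy.1 (hy.2 ▸ e))
  apply MulOpposite.unop_injective
  refine LinearMap.ext fun t => ?_
  obtain ⟨g, rfl⟩ := Submodule.mkQ_surjective _ t
  rw [mkQ_eq, map_add, map_sum, map_smul, hgen]
  simp only [map_smul, harm, smul_zero, Finset.sum_const_zero, add_zero]
  rfl

/-- Column `(x, j)` of `X` is written into column `other (q j)` of component `j`. Column `q j` stays
empty except for the diagonal entry that membership in the thread algebra forces. -/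
theorem exists_section (h : D.IsReflection D' x J q) (X : Matrix (V × Bool) (V × Bool) k)
    (h1 : ∀ r s, X r s ≠ 0 → s.1 ≠ x → r = s ∨ D.lt s r)
    (h2 : ∀ r j, X r (x, j) ≠ 0 → J j = true ∧ (r = other (q j) ∨ D.lt (other (q j)) r))
    (h3 : ∀ y, y ≠ x → X (y, false) (y, false) = X (y, true) (y, true)) :
    ∃ g : D.tiltCover k x J q, D.coord k x J q (Submodule.mkQ _ g) = X ∧
      (∀ r s, mat g.1.1 r s = if s.1 = x then 0 else X r s) ∧
      ∀ j r s, mat (g.2 j).1 r s = if s = other (q j) then X r (x, j) else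
        if s = q j ∧ r = q j then X (other (q j)) (x, j) else 0 := by
  have hJ : ∀ j, ¬ J j = true → ∀ r, X r (x, j) = 0 := fun j hj r => by
    by_contra h0
    exact hj (h2 r j h0).1
  let a : D.algebra k := D.ofMatrix (Matrix.of fun r s => if s.1 = x then 0 else X r s)
    (fun r s hrs => by
      rw [Matrix.of_apply] at hrs
      split_ifs at hrs with hs
      · exact absurd rfl hrs
      · exact h1 r s hrs hs)
    (fun y => by
      rw [Matrix.of_apply, Matrix.of_apply]
      by_cases hy : y = x
      · rw [if_pos hy, if_pos hy]
      · rw [if_neg hy, if_neg hy, h3 y hy])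
  let c : Bool → D.algebra k := fun j => D.ofMatrix
    (Matrix.of fun r s => if s = other (q j) then X r (x, j) else
        if s = q j ∧ r = q j then X (other (q j)) (x, j) else 0)
    (fun r s hrs => by
      rw [Matrix.of_apply] at hrs
      split_ifs at hrs with hs hs'
      · rw [hs]
        exact (h2 r j hrs).2
      · exact Or.inl (hs'.2.trans hs'.1.symm)
      · exact absurd rfl hrs)
    (fun y => by
      have key : ∀ s, (Matrix.of fun r s => if s = other (q j) then X r (x, j) else
          if s = q j ∧ r = q j then X (other (q j)) (x, j) else 0) s s =
          if s.1 = (q j).1 then X (other (q j)) (x, j) else 0 := by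
        intro s
        rw [Matrix.of_apply]
        by_cases hs : s.1 = (q j).1
        · rw [if_pos hs]
          rcases eq_or_eq_other hs with rfl | rfl
          · rw [if_neg (other_ne _).symm, if_pos ⟨rfl, rfl⟩]
          · rw [if_pos rfl]
        · rw [if_neg hs, if_neg, if_neg]
          · exact fun e => hs (by rw [e.1])
          · exact fun e => hs (by rw [e]; rfl)
      rw [key, key])
  refine ⟨(⟨a, fun r s hs => ?_⟩, fun j => ⟨c j, fun r s hs => ?_⟩), ?_, fun r s => rfl,
    fun j r s => rfl⟩
  · exact if_pos (not_not.1 hs)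
  · by_cases hj : J j = true
    · refine (if_neg fun e => hs ⟨hj, by rw [e]; rfl⟩).trans (if_neg fun e => hs ⟨hj, by rw [e.1]⟩)
    · change (if s = other (q j) then X r (x, j) else
        if s = q j ∧ r = q j then X (other (q j)) (x, j) else 0) = 0
      rw [hJ j hj, hJ j hj, ite_self, ite_self]
  · ext r s
    rw [coord_mkQ]
    split_ifs with hs
    · obtain ⟨y, j⟩ := s
      obtain rfl : y = x := hs
      exact if_pos rfl
    · exact if_neg hs

theorem arm_smul_mkQ_eq_zero (h : D.IsReflection D' x J q) (j : Bool) (g : D.tiltCover k x J q)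
    (h1 : J j = true → ∀ s, mat g.1.1 (q j) s = 0)
    (h2 : J j = true → ∀ i s, mat (g.2 i).1 (q j) s = 0) :
    D.arm k x J q j • Submodule.mkQ (LinearMap.range (D.tiltIncl k x J q)) g = 0 := by
  rw [← map_smul]
  have : D.arm k x J q j • g = 0 := by
    refine Prod.ext (Subtype.ext (ext_mat fun r s => ?_)) (funext fun i => Subtype.ext
      (ext_mat fun r s => ?_))
    · change mat (_ * g.1.1) r s = mat (0 : D.algebra k) r s
      rw [map_mul, arm_mul_apply h.lt_self, map_zero, Matrix.zero_apply]
      split_ifs with hs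
      · exact h1 hs.1 s
      · rfl
    · change mat (_ * (g.2 i).1) r s = mat (0 : D.algebra k) r s
      rw [map_mul, arm_mul_apply h.lt_self, map_zero, Matrix.zero_apply]
      split_ifs with hs
      · exact h2 hs.1 i s
      · rfl
  rw [this, map_zero]

/-- The intended image of `armGen j`. The diagonal entry of `Y` at `x` contributes a multiple of
`armGen j`; the rest of row `(x, j)` is placed in row `other (q j)`, with nothing in row `q j`, so
that the arm kills it. -/
theorem exists_arm_lift (h : D.IsReflection D' x J q) (Y : D'.algebra k) (j : Bool)
    (hj : J j = true) : ∃ w : D.tiltModule k x J q,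
      D.arm k x J q j • w = mat Y (x, j) (x, j) • D.arm k x J q j • D.armGen k x J q j ∧
      ∀ s, D.coord k x J q w (other (q j)) s = mat Y (x, j) s := by
  have hlt : ∀ s, s ≠ (x, j) → mat Y (x, j) s ≠ 0 → D'.lt s (x, j) := fun s hs h0 =>
    (supported _ _ _ h0).resolve_left hs.symm
  obtain ⟨g, hg, hg1, hg2⟩ := exists_section h (k := k)
    (Matrix.of fun r s => if r = other (q j) then if s = (x, j) then 0 else mat Y (x, j) s else 0)
    (fun r s hrs hs => by
      rw [Matrix.of_apply] at hrs
      split_ifs at hrs with h1 h2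
      · exact absurd rfl hrs
      · rw [h1]
        exact Or.inr ((h.lt_right j hj s hs).1 (hlt s h2 hrs))
      · exact absurd rfl hrs)
    (fun r i hrs => by
      rw [Matrix.of_apply] at hrs
      split_ifs at hrs with h1 h2
      · exact absurd rfl hrs
      · have h4 := hlt _ h2 hrs
        have hi : J i = true := by
          by_contra hi
          exact (h.isol' i hi (x, j)).2 h4
        rw [h1]
        exact ⟨hi, Or.inr ((h.lt_both i j hi hj).1 h4)⟩
      · exact absurd rfl hrs)
    (fun y hy => by
      have key : ∀ b, (Matrix.of fun r s => if r = other (q j) then if s = (x, j) then 0 else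
          mat Y (x, j) s else 0) (y, b) (y, b) = 0 := by
        intro b
        rw [Matrix.of_apply]
        split_ifs with h1 h2
        · rfl
        · by_contra h0
          have := (h.lt_right j hj _ hy).1 (hlt _ h2 h0)
          rw [h1] at this
          exact D.irrefl _ this
        · rfl
      rw [key, key])
  have hq : q j ≠ other (q j) := (other_ne _).symm
  refine ⟨Submodule.mkQ _ g + mat Y (x, j) (x, j) • D.armGen k x J q j, ?_, fun s => ?_⟩
  · rw [smul_add, arm_smul_mkQ_eq_zero h, zero_add, smul_comm]
    · intro _ s
      rw [hg1, Matrix.of_apply, if_neg hq, ite_self]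
    · intro _ i s
      rw [hg2, Matrix.of_apply, if_neg hq, Matrix.of_apply]
      split_ifs with h1 h2 h3 h4
      · rfl
      · rfl
      · by_cases hi : J i = true
        · exact absurd (by rw [h.q_inj hi hj h2.2.symm]) h4
        · exact zero_of _ (fun e => h4 e.symm) fun e => (h.isol' i hi _).2 e
      · rfl
      · rfl
  · rw [map_add, Matrix.add_apply, hg, Matrix.of_apply, if_pos rfl,
      ← algebraMap_smul (D.algebra k) (mat Y (x, j) (x, j)) (D.armGen k x J q j), coord_smul,
      AlgHom.commutes, Matrix.algebraMap_eq_diagonal, Matrix.diagonal_mul, coord_armGen hj]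
    by_cases hs : s = (x, j)
    · simp [hs]
    · simp [hs]

theorem exists_gen_lift (h : D.IsReflection D' x J q) (Y : D'.algebra k) :
    ∃ w : D.tiltModule k x J q, ∀ r, r.1 ≠ x → ∀ s, D.coord k x J q w r s = mat Y r s := by
  obtain ⟨g, hg, -⟩ := exists_section h (k := k)
    (Matrix.of fun r s => if r.1 = x then 0 else mat Y r s)
    (fun r s hrs hs => by
      rw [Matrix.of_apply] at hrs
      split_ifs at hrs with h1
      · exact absurd rfl hrs
      · exact (supported _ _ _ hrs).imp id (h.lt_iff s r hs h1).1)
    (fun r j hrs => by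
      rw [Matrix.of_apply] at hrs
      split_ifs at hrs with h1
      · exact absurd rfl hrs
      · have h2 := (supported _ _ _ hrs).resolve_left fun e => h1 (by rw [e])
        have hj : J j = true := by
          by_contra hj
          exact (h.isol' j hj _).2 h2
        exact ⟨hj, (h.lt_left j hj r h1).1 h2⟩)
    (fun y hy => by
      rw [Matrix.of_apply, Matrix.of_apply, if_neg hy, if_neg hy]
      exact diag_eq _ _ _ _)
  refine ⟨Submodule.mkQ _ g, fun r hr s => ?_⟩
  rw [hg, Matrix.of_apply, if_neg hr]

/-- Images of the generators are prescribed by the rows of `Y`. They satisfy the relation because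
the diagonal entries of `Y` at the two positions of `x` agree, which makes `∑ arm j • w j` a
multiple of the original relation. -/
theorem endHom_surjective (h : D.IsReflection D' x J q) :
    Function.Surjective (endHom (k := k) h) := by
  intro Y
  obtain ⟨u, hu⟩ := exists_gen_lift h Y
  have hw : ∀ j, ∃ w : D.tiltModule k x J q,
      D.arm k x J q j • w = mat Y (x, j) (x, j) • D.arm k x J q j • D.armGen k x J q j ∧
      (J j = true → ∀ s, D.coord k x J q w (other (q j)) s = mat Y (x, j) s) := by
    intro j
    by_cases hj : J j = true
    · obtain ⟨w, hw⟩ := exists_arm_lift h Y j hj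
      exact ⟨w, hw.1, fun _ => hw.2⟩
    · refine ⟨0, ?_, fun h => absurd h hj⟩
      rw [arm, dif_neg fun e => hj e.1, zero_smul, zero_smul, smul_zero]
  choose w hw1 hw2 using hw
  obtain ⟨f, hf⟩ := arm_smul_gen_ext u w (by
    rw [Finset.sum_congr rfl fun j _ => (hw1 j).trans
      (by rw [diag_eq Y x j false])]
    rw [← Finset.smul_sum, sum_arm_smul_armGen, smul_zero])
  refine ⟨MulOpposite.op f, ext_mat_of_rows h (fun c hc s => ?_) fun j hj s => ?_⟩
  · change endMatrix f c s = _
    rw [endMatrix_of_ne _ hc]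
    unfold gen
    rw [hf, coverHom_apply]
    change D.coord k x J q (D.colIdem k (fun y => y ≠ x) • u +
      ∑ j, (0 : D.algebra k) • w j) c s = _
    simp only [zero_smul, Finset.sum_const_zero, add_zero]
    rw [coord_smul, colIdem_val, Matrix.diagonal_mul, if_pos hc, one_mul, hu c hc]
  · change endMatrix f (x, j) s = _
    rw [endMatrix_of_arm _ hj]
    unfold armGen
    rw [hf, coverHom_apply]
    change D.coord k x J q ((0 : D.algebra k) • u + _) _ s = _
    rw [zero_smul, zero_add, Finset.sum_eq_single j]
    · dsimp only
      rw [Pi.single_eq_same, coord_smul, colIdem_val, Matrix.diagonal_mul, if_pos ⟨hj, rfl⟩,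
        one_mul, hw2 j hj]
    · intro i _ hij
      dsimp only
      rw [Pi.single_eq_of_ne hij]
      exact zero_smul _ _
    · simp

/-- Whatever arrives at `(x, j)` from a different vertex has passed through its immediate
predecessor `q j`. Hence row `(x, j)` of an element without columns at `x` factors through the arm.
-/
theorem exists_shift (h : D.IsReflection D' x J q) (S : V → Prop) (M : D.cols k S)
    (hx : ¬ S x) (j : Bool) : ∃ M' : D.cols k S, J j = true → ∀ s, mat M'.1 (q j) s =
      mat M.1 (x, j) s := by
  by_cases hj : J j = true
  · have hlt : ∀ s, mat M.1 (x, j) s ≠ 0 → s = q j ∨ D.lt s (q j) := by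
      intro s hs
      rcases supported _ _ _ hs with rfl | h1
      · exact absurd (M.2 _ _ hx) hs
      · exact h.pred j hj s h1
    -- The additional entry at `other (q j)` restores equality of the two diagonal entries at the
    -- vertex of `q j`.
    refine ⟨⟨D.ofMatrix (Matrix.of fun r s => if r = q j then mat M.1 (x, j) s else
      if r = other (q j) ∧ s = other (q j) then mat M.1 (x, j) (q j) else 0) ?_ ?_, ?_⟩, ?_⟩
    · intro r s hrs
      rw [Matrix.of_apply] at hrs
      split_ifs at hrs with h1 h2
      · rw [h1]
        exact (hlt s hrs).imp Eq.symm id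
      · exact Or.inl (h2.1.trans h2.2.symm)
      · exact absurd rfl hrs
    · intro y
      have key : ∀ s, (Matrix.of fun r s => if r = q j then mat M.1 (x, j) s else
          if r = other (q j) ∧ s = other (q j) then mat M.1 (x, j) (q j) else 0) s s =
          if s.1 = (q j).1 then mat M.1 (x, j) (q j) else 0 := by
        intro s
        rw [Matrix.of_apply]
        by_cases hs : s.1 = (q j).1
        · rw [if_pos hs]
          rcases eq_or_eq_other hs with rfl | rfl
          · rw [if_pos rfl]
          · rw [if_neg (other_ne _), if_pos ⟨rfl, rfl⟩]
        · rw [if_neg hs, if_neg, if_neg]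
          · exact fun e => hs (by rw [e.1]; rfl)
          · exact fun e => hs (by rw [e])
      rw [key, key]
    · intro r s hs
      rw [mat_ofMatrix, Matrix.of_apply]
      split_ifs with h1 h2
      · exact M.2 _ _ hs
      · refine M.2 _ _ fun e => hs ?_
        rw [h2.2]
        exact e
      · rfl
    · intro _ s
      rw [mat_ofMatrix, Matrix.of_apply, if_pos rfl]
  · exact ⟨0, fun e => absurd e hj⟩

theorem sum_arm_mul (h : D.IsReflection D' x J q) (S : V → Prop) (M : D.cols k S)
    (hx : ¬ S x) (M' : Bool → D.cols k S)
    (hM : ∀ j, J j = true → ∀ s, mat (M' j).1 (q j) s = mat M.1 (x, j) s) :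
    ∑ j, D.arm k x J q j * (M' j).1 = D.colIdem k (fun y => y = x) * M.1 := by
  refine ext_mat (row_cases x J (fun r hr s => ?_) (fun j hj s => ?_) fun j hj s => ?_)
  · rw [colIdem_mul_apply, if_neg hr, map_sum, Matrix.sum_apply]
    refine Finset.sum_eq_zero fun i _ => ?_
    rw [map_mul, arm_mul_apply h.lt_self, if_neg]
    exact fun e => hr (by rw [e.2])
  · rw [colIdem_mul_apply, if_pos rfl, map_sum, Matrix.sum_apply, Finset.sum_eq_single j]
    · rw [map_mul, arm_mul_apply h.lt_self, if_pos ⟨hj, rfl⟩, hM j hj]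
    · intro i _ hij
      rw [map_mul, arm_mul_apply h.lt_self, if_neg]
      exact fun e => hij (congrArg Prod.snd e.2).symm
    · simp
  · rw [colIdem_mul_apply, if_pos rfl, map_sum, Matrix.sum_apply, Finset.sum_eq_zero]
    · by_cases hs : s.1 = x
      · exact (M.2 _ _ (by rwa [hs])).symm
      · exact (zero_of _ (fun e => hs (by rw [← e])) (h.isol j hj s).1).symm
    · intro i _
      rw [map_mul, arm_mul_apply h.lt_self, if_neg]
      rintro ⟨hi, e⟩
      have hji : j = i := congrArg Prod.snd e
      exact hj (by rwa [hji])

/-- A map from `P_x` is given by the image of `e_x`, which lies in row `x`. The cover of the tilting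
module has no columns at `x`, so this image has the form `∑ arm j • w j`. Sending the `j`-th
generator of the cover to `w j`, and the other generator to zero, extends the map. -/
theorem exists_extension (h : D.IsReflection D' x J q)
    (f : D.cols k (fun y => y = x) →ₗ[D.algebra k] D.tiltModule k x J q) :
    ∃ g : D.tiltCover k x J q →ₗ[D.algebra k] D.tiltModule k x J q,
      g ∘ₗ D.tiltIncl k x J q = f := by
  obtain ⟨W, hW⟩ := Submodule.mkQ_surjective _ (f ⟨D.colIdem k (fun y => y = x), colIdem_mem _⟩)
  choose a ha using exists_shift (k := k) h (fun y => y ≠ x) W.1 (fun e => e rfl)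
  choose c hc using fun i => exists_shift (k := k) h (fun y => J i = true ∧ y = (q i).1) (W.2 i)
    (fun e => h.ne i e.1 e.2.symm)
  have hsum : ∑ j, D.arm k x J q j • Submodule.mkQ (LinearMap.range (D.tiltIncl k x J q))
      (a j, fun i => c i j) = D.colIdem k (fun y => y = x) • Submodule.mkQ _ W := by
    simp only [← map_smul]
    rw [← map_sum]
    congr 1
    refine Prod.ext (Subtype.ext ?_) (funext fun i => Subtype.ext ?_)
    · rw [Prod.fst_sum, Submodule.coe_sum]
      exact sum_arm_mul h _ W.1 (fun e => e rfl) a ha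
    · rw [Prod.snd_sum, Finset.sum_apply, Submodule.coe_sum]
      exact sum_arm_mul h _ (W.2 i) (fun e => h.ne i e.1 e.2.symm) (c i) (hc i)
  refine ⟨D.coverHom k x J q 0 fun j => Submodule.mkQ _ (a j, fun i => c i j),
    LinearMap.ext fun m => ?_⟩
  rw [LinearMap.comp_apply, coverHom_apply]
  change (0 : D.algebra k) • _ + ∑ j, (m.1 * D.arm k x J q j) • _ = f m
  simp only [mul_smul]
  rw [zero_smul, zero_add, ← Finset.smul_sum, hsum, hW, ← map_smul, ← map_smul]
  congr 1
  refine Subtype.ext ?_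
  change m.1 * (D.colIdem k (fun y => y = x) * D.colIdem k (fun y => y = x)) = m.1
  rw [← mul_assoc, mul_colIdem_of_mem m.2, mul_colIdem_of_mem m.2]

/-- Multiplication by the arms retains the columns `(x, j)` with an arm. The column of an isolated
position has only a diagonal entry, shared with an armed position. -/
theorem tiltIncl_injective (h : D.IsReflection D' x J q) :
    Function.Injective (D.tiltIncl k x J q) := by
  rw [injective_iff_map_eq_zero]
  intro m hm
  have key : ∀ j, J j = true → ∀ r, mat m.1 r (x, j) = 0 := by
    intro j hj r
    have h1 := congrArg (fun g : D.tiltCover k x J q => mat (g.2 j).1 r (q j)) hm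
    have h2 : mat (m.1 * D.arm k x J q j) r (q j) = mat m.1 r (x, j) := by
      rw [map_mul, mul_arm_apply h.lt_self, if_pos ⟨hj, rfl⟩]
    rw [← h2]
    exact h1.trans (congrFun (congrFun (map_zero mat) r) _)
  refine Subtype.ext (ext_mat fun r s => ?_)
  refine Eq.trans ?_ (congrFun (congrFun (map_zero mat) r) s).symm
  revert s
  refine row_cases x J (fun s hs => m.2 r s hs) (fun j hj => key j hj r) fun j hj => ?_
  by_cases hr : r = (x, j)
  · obtain ⟨i, hi⟩ := h.exists_arm
    rw [hr, diag_eq m.1 x j i]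
    exact key i hi _
  · exact zero_of _ hr (h.isol j hj r).2

/-- In `D'` the vertex `x` is linked to the vertex of each `q j`, and in `D` every relation between
`(x, j)` and a position away from `x` can be routed through `q j`. -/
theorem IsReflection.connected (h : D.IsReflection D' x J q) (hD : D.Connected) :
    D'.Connected := by
  set E := Relation.EqvGen (fun x y => ∃ b c, D'.lt (x, b) (y, c)) with hE
  have hlt : ∀ p r, D'.lt p r → E p.1 r.1 := fun p r hpr => .rel _ _ ⟨p.2, r.2, hpr⟩
  have hx : ∀ j, J j = true → E x (q j).1 := fun j hj =>
    hlt (x, j) (other (q j)) ((h.lt_left j hj _ (h.ne_other hj)).2 (Or.inl rfl))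
  have key : ∀ p r, D.lt p r → E p.1 r.1 := by
    intro p r hpr
    by_cases hp : p.1 = x <;> by_cases hr : r.1 = x
    · rw [hp, hr]
      exact .refl _
    · obtain ⟨y, j⟩ := p
      obtain rfl : y = x := hp
      have hj : J j = true := by
        by_contra hj
        exact (h.isol j hj _).2 hpr
      refine (hx j hj).trans _ _ _ (hlt _ _ ((h.lt_iff _ _ (h.ne j hj) hr).2 ?_))
      exact D.trans _ _ _ (h.lt_self j hj) hpr
    · obtain ⟨y, j⟩ := r
      obtain rfl : y = x := hr
      have hj : J j = true := by
        by_contra hj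
        exact (h.isol j hj _).1 hpr
      rcases h.pred j hj _ hpr with rfl | h1
      · exact (hx j hj).symm
      · exact (hlt _ _ ((h.lt_iff _ _ hp (h.ne j hj)).2 h1)).trans _ _ _ (hx j hj).symm
    · exact hlt _ _ ((h.lt_iff _ _ hp hr).2 hpr)
  intro y z
  have hyz := hD y z
  induction hyz with
  | rel y z h =>
    obtain ⟨b, c, h⟩ := h
    exact key _ _ h
  | refl y => exact .refl _
  | symm y z _ h => exact .symm _ _ h
  | trans y z w _ _ h h' => exact .trans _ _ _ h h'

end Reflection

/-- Reflections are tilting steps. -/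
theorem IsReflection.tiltCotiltStep {V : Type} [Fintype V] [DecidableEq V] {D D' : Threads V}
    {x : V} {J : Bool → Bool} {q : Bool → V × Bool} (h : D.IsReflection D' x J q)
    (hD : D.Connected) (k : Type u) [Field k] : TiltCotiltStep (AlgCat.of k (D.algebra k)) (AlgCat.of k (D'.algebra k)) := by
  have : Nonempty V := ⟨x⟩
  exact tiltCotiltStep_of_presentation (D.pointed k) (D'.pointed k) (hD.noCentralIdempotents k)
    ((h.connected hD).noCentralIdempotents k) (D.tiltIncl k x J q) (Submodule.mkQ _)
    (tiltIncl_injective h) (Submodule.mkQ_surjective _)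
    (LinearMap.exact_map_mkQ_range _) (exists_extension h)
    (AlgEquiv.ofBijective (endHom (k := k) h) ⟨endHom_injective h, endHom_surjective h⟩).symm

end Threads

/-! ### Threads given by lists -/

namespace ThreadList

variable {α : Type}

/-- The element `r` occurs in the first block of the list; the blocks are separated by `none`. -/
def inFirst : List (Option α) → α → Prop
  | [], _ => False
  | none :: _, _ => False
  | some p :: L, r => r = p ∨ inFirst L r

/-- The element `r` occurs in the last block of the list. -/
def inLast : List (Option α) → α → Prop
  | [], _ => False
  | none :: L, r => inLast L r
  | some p :: L, r => (r = p ∧ none ∉ L) ∨ inLast L r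

/-- The element `p` occurs before `r` in the same block of the list. -/
def before : List (Option α) → α → α → Prop
  | [], _, _ => False
  | none :: L, p, r => before L p r
  | some q :: L, p, r => (p = q ∧ inFirst L r) ∨ before L p r

/-- The element `p` occurs immediately before `r` in the same block of the list. -/
def adj : List (Option α) → α → α → Prop
  | [], _, _ => False
  | none :: L, p, r => adj L p r
  | some q :: L, p, r => (p = q ∧ L.head? = some (some r)) ∨ adj L p r

theorem mem_of_inFirst {L : List (Option α)} {r : α} (h : inFirst L r) : some r ∈ L := by
  induction L with
  | nil => exact h.elim
  | cons o L ih =>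
    cases o with
    | none => exact h.elim
    | some p =>
      rcases h with rfl | h
      · exact List.mem_cons_self
      · exact List.mem_cons_of_mem _ (ih h)

theorem mem_of_inLast {L : List (Option α)} {r : α} (h : inLast L r) : some r ∈ L := by
  induction L with
  | nil => exact h.elim
  | cons o L ih =>
    cases o with
    | none => exact List.mem_cons_of_mem _ (ih h)
    | some p =>
      rcases h with ⟨rfl, -⟩ | h
      · exact List.mem_cons_self
      · exact List.mem_cons_of_mem _ (ih h)

theorem mem_of_before {L : List (Option α)} {p r : α} (h : before L p r) :
    some p ∈ L ∧ some r ∈ L := by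
  induction L with
  | nil => exact h.elim
  | cons o L ih =>
    cases o with
    | none => exact (ih h).imp (List.mem_cons_of_mem _) (List.mem_cons_of_mem _)
    | some q =>
      rcases h with ⟨rfl, h⟩ | h
      · exact ⟨List.mem_cons_self, List.mem_cons_of_mem _ (mem_of_inFirst h)⟩
      · exact (ih h).imp (List.mem_cons_of_mem _) (List.mem_cons_of_mem _)

theorem inFirst_append (A B : List (Option α)) (r : α) :
    inFirst (A ++ B) r ↔ inFirst A r ∨ (none ∉ A ∧ inFirst B r) := by
  induction A with
  | nil => simp [inFirst]
  | cons o A ih =>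
    cases o with
    | none => simp [inFirst]
    | some p => simp [inFirst, ih, or_assoc]

theorem before_append (A B : List (Option α)) (p r : α) :
    before (A ++ B) p r ↔ before A p r ∨ before B p r ∨ (inLast A p ∧ inFirst B r) := by
  induction A with
  | nil => simp [before, inLast]
  | cons o A ih =>
    cases o with
    | none => simp [before, inLast, ih]
    | some q => simp only [List.cons_append, before, inLast, ih, inFirst_append]; tauto

theorem head?_eq_of_inFirst {L : List (Option α)} {r : α} (h : inFirst L r) :
    ∃ q, L.head? = some (some q) := by
  cases L with
  | nil => exact h.elim
  | cons o L =>
    cases o with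
    | none => exact h.elim
    | some p => exact ⟨p, rfl⟩

theorem inFirst_of_before {L : List (Option α)} (hL : L.reduceOption.Nodup) {p r : α}
    (h : inFirst L p) (h' : before L p r) : inFirst L r := by
  induction L with
  | nil => exact h.elim
  | cons o L ih =>
    cases o with
    | none => exact h.elim
    | some q =>
      rw [List.reduceOption_cons_of_some, List.nodup_cons, List.reduceOption_mem_iff] at hL
      rcases h' with ⟨rfl, h'⟩ | h'
      · exact Or.inr h'
      · rcases h with rfl | h
        · exact absurd (mem_of_before h').1 hL.1
        · exact Or.inr (ih hL.2 h h')

theorem before_irrefl {L : List (Option α)} (hL : L.reduceOption.Nodup) (p : α) :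
    ¬ before L p p := by
  induction L with
  | nil => exact id
  | cons o L ih =>
    cases o with
    | none => exact ih hL
    | some q =>
      rw [List.reduceOption_cons_of_some, List.nodup_cons, List.reduceOption_mem_iff] at hL
      rintro (⟨rfl, h⟩ | h)
      · exact hL.1 (mem_of_inFirst h)
      · exact ih hL.2 h

theorem before_trans {L : List (Option α)} (hL : L.reduceOption.Nodup) {p q r : α}
    (h : before L p q) (h' : before L q r) : before L p r := by
  induction L with
  | nil => exact h.elim
  | cons o L ih =>
    cases o with
    | none => exact ih hL h h'
    | some a =>
      rw [List.reduceOption_cons_of_some, List.nodup_cons, List.reduceOption_mem_iff] at hL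
      rcases h' with ⟨rfl, h'⟩ | h'
      · rcases h with ⟨rfl, h⟩ | h
        · exact absurd (mem_of_inFirst h) hL.1
        · exact absurd (mem_of_before h).2 hL.1
      · rcases h with ⟨rfl, h⟩ | h
        · exact Or.inl ⟨rfl, inFirst_of_before hL.2 h h'⟩
        · exact Or.inr (ih hL.2 h h')

theorem inFirst_iff_head? {L : List (Option α)} {p : α} (h : L.head? = some (some p)) :
    inFirst L p := by
  cases L with
  | nil => simp at h
  | cons o L =>
    simp only [List.head?_cons, Option.some.injEq] at h
    subst h
    exact Or.inl rfl

theorem before_of_adj {L : List (Option α)} {p r : α} (h : adj L p r) : before L p r := by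
  induction L with
  | nil => exact h.elim
  | cons o L ih =>
    cases o with
    | none => exact ih h
    | some a => exact h.imp (And.imp id inFirst_iff_head?) ih

theorem reflTransGen_adj_of_inFirst {L : List (Option α)} {p r : α}
    (hp : L.head? = some (some p)) (h : inFirst L r) : Relation.ReflTransGen (adj L) p r := by
  induction L generalizing p with
  | nil => exact h.elim
  | cons o L ih =>
    simp only [List.head?_cons, Option.some.injEq] at hp
    subst hp
    rcases h with rfl | h
    · exact .refl
    · obtain ⟨q, hq⟩ := head?_eq_of_inFirst h
      exact .head (Or.inl ⟨rfl, hq⟩) (Relation.ReflTransGen.mono (fun _ _ => Or.inr) _ _ (ih hq h))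

/-- This connects the order defined by a list with the order generated by arrows that
`FinQuiver.ThreadData` asks for. -/
theorem before_iff_transGen {L : List (Option α)} (hL : L.reduceOption.Nodup) {p r : α} :
    before L p r ↔ Relation.TransGen (adj L) p r := by
  constructor
  · clear hL
    intro h
    induction L with
    | nil => exact h.elim
    | cons o L ih =>
      cases o with
      | none => exact ih h
      | some a =>
        rcases h with ⟨rfl, h⟩ | h
        · obtain ⟨q, hq⟩ := head?_eq_of_inFirst h
          exact .head' (Or.inl ⟨rfl, hq⟩)
            (Relation.ReflTransGen.mono (fun _ _ => Or.inr) _ _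
              (reflTransGen_adj_of_inFirst hq h))
        · exact Relation.TransGen.mono (fun _ _ => Or.inr) _ _ (ih h)
  · intro h
    induction h with
    | single h => exact before_of_adj h
    | tail _ h ih => exact before_trans hL ih (before_of_adj h)

/-- A list may be cut at an entry kept in both parts without losing or creating an adjacency. -/
theorem adj_append (A B : List (Option α)) (s p r : α) :
    adj (A ++ some s :: B) p r ↔ adj (A ++ [some s]) p r ∨ adj (some s :: B) p r := by
  induction A with
  | nil => simp [adj]
  | cons o A ih =>
    cases o with
    | none => exact ih
    | some q =>
      have : (A ++ some s :: B).head? = (A ++ [some s]).head? := by cases A <;> simp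
      simp only [List.cons_append, adj, ih, this, or_assoc]

end ThreadList

/-! ### Reflections as moves of entries in a list. -/

namespace Threads

open ThreadList

variable {V : Type}

/-- The order relation is the one given by the list. -/
structure HasList (D : Threads V) (L : List (Option (V × Bool))) : Prop where
  nodup : L.reduceOption.Nodup
  lt_iff : ∀ p r, D.lt p r ↔ before L p r

/-- The threads given by a list. -/
def ofList (L : List (Option (V × Bool))) (hL : L.reduceOption.Nodup) : Threads V where
  lt := before L
  irrefl := before_irrefl hL
  trans _ _ _ := before_trans hL

theorem hasList_ofList (L : List (Option (V × Bool))) (hL : L.reduceOption.Nodup) :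
    (ofList L hL).HasList L := ⟨hL, fun _ _ => Iff.rfl⟩

/-- The position `p` is removed and inserted immediately before the position `q'`. -/
structure IsMove (D D' : Threads V) (p q' : V × Bool) : Prop where
  lt_iff : ∀ r s, r ≠ p → s ≠ p → (D'.lt r s ↔ D.lt r s)
  lt_left : ∀ r, r ≠ p → (D'.lt p r ↔ r = q' ∨ D.lt q' r)
  lt_right : ∀ r, r ≠ p → (D'.lt r p ↔ D.lt r q')

/-- The position `q` is the immediate predecessor of `p`. -/
structure IsPred (D : Threads V) (q p : V × Bool) : Prop where
  lt : D.lt q p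
  pred : ∀ s, D.lt s p → s = q ∨ D.lt s q
  succ : ∀ r, D.lt q r → r = p ∨ D.lt p r

/-- Reflection with one arm: the other position of `x` is isolated, and a single move suffices. -/
theorem IsMove.isReflection {D D' : Threads V} {x : V} {j : Bool} {q : V × Bool}
    (h : D.IsMove D' (x, j) (other q)) (hq : D.IsPred q (x, j)) (hqx : q.1 ≠ x)
    (hx : ∀ s, ¬ D.lt s (x, !j) ∧ ¬ D.lt (x, !j) s) :
    D.IsReflection D' x (fun i => i == j) (fun _ => q) := by
  have ne1 : ∀ {r : V × Bool} {i : Bool}, r.1 ≠ x → r ≠ (x, i) := fun hr e => hr (by rw [e])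
  have hJ : ∀ {i : Bool}, ¬ (i == j) = true → i = !j := fun {i} => by cases i <;> cases j <;> simp
  have hnj : (x, !j) ≠ (x, j) := by simp
  have hx' : ∀ s, ¬ D'.lt s (x, !j) ∧ ¬ D'.lt (x, !j) s := by
    intro s
    by_cases hs : s = (x, j)
    · rw [hs, h.lt_left _ hnj, h.lt_right _ hnj]
      exact ⟨not_or.2 ⟨fun e => hqx (congrArg Prod.fst e).symm, (hx _).1⟩, (hx _).2⟩
    · rw [h.lt_iff _ _ hs hnj, h.lt_iff _ _ hnj hs]
      exact hx s
  refine ⟨?_, ?_, ?_, ?_, ?_, ⟨j, by simp⟩, fun r s hr hs => h.lt_iff r s (ne1 hr) (ne1 hs),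
    ?_, ?_, ?_, ?_⟩
  · exact fun _ _ => hqx
  · intro i hi
    rw [beq_iff_eq.1 hi]
    exact hq.lt
  · intro i hi
    rw [beq_iff_eq.1 hi]
    exact hq.pred
  · intro i hi
    rw [beq_iff_eq.1 hi]
    exact hq.succ
  · intro i hi
    rw [hJ hi]
    exact hx
  · intro i hi r hr
    rw [beq_iff_eq.1 hi]
    exact h.lt_left r (ne1 hr)
  · intro i hi r hr
    rw [beq_iff_eq.1 hi]
    exact h.lt_right r (ne1 hr)
  · intro i i' hi hi'
    rw [beq_iff_eq.1 hi, beq_iff_eq.1 hi']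
    exact iff_of_false (D'.irrefl _) (D.irrefl _)
  · intro i hi
    rw [hJ hi]
    exact hx'

/-- Reflection with two arms, as two successive moves. The order `D₁` in between is only
bookkeeping; both predecessors refer to the original order `D`. -/
theorem IsMove.isReflection₂ {D D₁ D' : Threads V} {x : V} {j : Bool} {q₀ q₁ : V × Bool}
    (h₀ : D.IsMove D₁ (x, j) (other q₀)) (h₁ : D₁.IsMove D' (x, !j) (other q₁))
    (hq₀ : D.IsPred q₀ (x, j)) (hq₁ : D.IsPred q₁ (x, !j)) (hx₀ : q₀.1 ≠ x) (hx₁ : q₁.1 ≠ x) :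
    D.IsReflection D' x (fun _ => true) (fun i => if i = j then q₀ else q₁) := by
  have ne1 : ∀ {r : V × Bool} {i : Bool}, r.1 ≠ x → r ≠ (x, i) := fun hr e => hr (by rw [e])
  have hcase : ∀ {P : Bool → Prop}, P j → P (!j) → ∀ i, P i := fun {P} h h' i => by
    cases i <;> cases j <;> first | exact h | exact h'
  have hnj : (x, !j) ≠ (x, j) := by simp
  have hx₁' : (other q₁).1 ≠ x := hx₁
  have hjj : ¬ (!j) = j := by simp
  -- With a common insertion point, one position of `x` would end up before the other, against
  -- `lt_both`. Distinctness holds because a position has only one immediate successor.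
  have hne : other q₁ ≠ other q₀ := by
    intro e
    obtain rfl := other_injective e
    rcases hq₀.succ _ hq₁.lt with h | h
    · exact hnj h
    · rcases hq₁.pred _ h with h | h
      · exact hx₀ (congrArg Prod.fst h).symm
      · exact asymm h hq₀.lt
  refine ⟨fun i _ => ?_, fun i _ => ?_, fun i _ => ?_, fun i _ => ?_, fun i hi => absurd rfl hi,
    ⟨true, rfl⟩, fun r s hr hs => ?_, fun i _ => ?_, fun i _ => ?_, fun i i' _ _ => ?_,
    fun i hi => absurd rfl hi⟩
  · split_ifs <;> assumption
  · revert i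
    refine hcase ?_ ?_
    · rw [if_pos rfl]; exact hq₀.lt
    · rw [if_neg hjj]; exact hq₁.lt
  · revert i
    refine hcase ?_ ?_
    · rw [if_pos rfl]; exact hq₀.pred
    · rw [if_neg hjj]; exact hq₁.pred
  · revert i
    refine hcase ?_ ?_
    · rw [if_pos rfl]; exact hq₀.succ
    · rw [if_neg hjj]; exact hq₁.succ
  · rw [h₁.lt_iff r s (ne1 hr) (ne1 hs), h₀.lt_iff r s (ne1 hr) (ne1 hs)]
  · revert i
    refine hcase (fun r hr => ?_) (fun r hr => ?_)
    · rw [if_pos rfl, h₁.lt_iff _ _ hnj.symm (ne1 hr), h₀.lt_left r (ne1 hr)]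
    · rw [if_neg hjj, h₁.lt_left r (ne1 hr), h₀.lt_iff _ _ (ne1 hx₁') (ne1 hr)]
  · revert i
    refine hcase (fun r hr => ?_) (fun r hr => ?_)
    · rw [if_pos rfl, h₁.lt_iff _ _ (ne1 hr) hnj.symm, h₀.lt_right r (ne1 hr)]
    · rw [if_neg hjj, h₁.lt_right r (ne1 hr), h₀.lt_iff _ _ (ne1 hr) (ne1 hx₁')]
  · revert i i'
    refine hcase (hcase ?_ ?_) (hcase ?_ ?_)
    · exact iff_of_false (D'.irrefl _) (D.irrefl _)
    · rw [if_pos rfl, if_neg hjj, h₁.lt_right _ hnj.symm, h₀.lt_left _ (ne1 hx₁')]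
      simp [hne]
    · rw [if_pos rfl, if_neg hjj, h₁.lt_left _ hnj.symm, h₀.lt_right _ (ne1 hx₁')]
      exact or_iff_right fun e => hx₁ (congrArg Prod.fst e).symm
    · exact iff_of_false (D'.irrefl _) (D.irrefl _)

theorem HasList.isPred {D : Threads V} {A C : List (Option (V × Bool))} {q p : V × Bool}
    (h : D.HasList (A ++ some q :: some p :: C)) : D.IsPred q p := by
  have hn := h.nodup
  rw [List.reduceOption_append, List.reduceOption_cons_of_some, List.reduceOption_cons_of_some]
    at hn
  simp only [List.nodup_append, List.nodup_cons, List.mem_cons, not_or, List.reduceOption_mem_iff] at hn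
  obtain ⟨-, ⟨⟨hqp, hqC⟩, hpC, -⟩, hA⟩ := hn
  have hqA : some q ∉ A := fun e => hA q e q (Or.inl rfl) rfl
  have hpA : some p ∉ A := fun e => hA p e p (Or.inr (Or.inl rfl)) rfl
  have b1 : ∀ s, ¬ before A s p := fun s e => hpA (mem_of_before e).2
  have b2 : ∀ s, ¬ before C s p := fun s e => hpC (mem_of_before e).2
  have b3 : ∀ s, ¬ before A s q := fun s e => hqA (mem_of_before e).2
  have b4 : ∀ s, ¬ before C s q := fun s e => hqC (mem_of_before e).2
  have b5 : ∀ s, ¬ before A q s := fun s e => hqA (mem_of_before e).1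
  have b6 : ∀ s, ¬ before C q s := fun s e => hqC (mem_of_before e).1
  have b7 : ∀ s, ¬ before A p s := fun s e => hpA (mem_of_before e).1
  have c1 : ¬ inFirst C p := fun e => hpC (mem_of_inFirst e)
  have c2 : ¬ inFirst C q := fun e => hqC (mem_of_inFirst e)
  have c3 : ¬ inLast A q := fun e => hqA (mem_of_inLast e)
  have c4 : ¬ inLast A p := fun e => hpA (mem_of_inLast e)
  refine ⟨?_, fun s => ?_, fun r => ?_⟩ <;>
    simp only [h.lt_iff, before_append, before, inFirst] <;> grind

/-- The new list is a rearrangement of the old one, so no entry is repeated, and the order among the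
entries other than `p` can be read after deleting `p`. -/
theorem HasList.isMove {D : Threads V} {L A C A' C' L' : List (Option (V × Bool))}
    {p q : V × Bool} (h : D.HasList L) (hL : L = A ++ some p :: C)
    (hAC : A ++ C = A' ++ some q :: C') (hL' : L' = A' ++ some p :: some q :: C') :
    ∃ D' : Threads V, D'.HasList L' ∧ D.IsMove D' p q := by
  subst hL hL'
  have hn := h.nodup
  have hperm : (A' ++ some p :: some q :: C').Perm (A ++ some p :: C) :=
    List.perm_middle.trans ((List.Perm.cons _ (by rw [hAC])).trans List.perm_middle.symm)
  have hn' : (A' ++ some p :: some q :: C').reduceOption.Nodup :=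
    (List.Perm.nodup_iff (hperm.filterMap id)).2 hn
  refine ⟨ofList _ hn', hasList_ofList _ _, ?_⟩
  have hlt : ∀ r s, r ≠ p → s ≠ p → (D.lt r s ↔ before (A' ++ some q :: C') r s) := by
    intro r s hr hs
    rw [h.lt_iff, ← hAC]
    simp only [before_append, before, inFirst, hr, hs, false_and, false_or]
  rw [List.reduceOption_append, List.reduceOption_cons_of_some, List.reduceOption_cons_of_some]
    at hn'
  simp only [List.nodup_append, List.nodup_cons, List.mem_cons, not_or, List.reduceOption_mem_iff] at hn'
  obtain ⟨-, ⟨⟨hpq, hpC⟩, hqC, -⟩, hA⟩ := hn'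
  have hpA : some p ∉ A' := fun e => hA p e p (Or.inl rfl) rfl
  have hqA : some q ∉ A' := fun e => hA q e q (Or.inr (Or.inl rfl)) rfl
  have b1 : ∀ s, ¬ before A' s p := fun s e => hpA (mem_of_before e).2
  have b2 : ∀ s, ¬ before C' s p := fun s e => hpC (mem_of_before e).2
  have b3 : ∀ s, ¬ before A' s q := fun s e => hqA (mem_of_before e).2
  have b4 : ∀ s, ¬ before C' s q := fun s e => hqC (mem_of_before e).2
  have b5 : ∀ s, ¬ before A' q s := fun s e => hqA (mem_of_before e).1
  have b6 : ∀ s, ¬ before C' q s := fun s e => hqC (mem_of_before e).1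
  have b7 : ∀ s, ¬ before A' p s := fun s e => hpA (mem_of_before e).1
  have b8 : ∀ s, ¬ before C' p s := fun s e => hpC (mem_of_before e).1
  have c1 : ¬ inFirst C' p := fun e => hpC (mem_of_inFirst e)
  have c2 : ¬ inFirst C' q := fun e => hqC (mem_of_inFirst e)
  have c3 : ¬ inLast A' q := fun e => hqA (mem_of_inLast e)
  have c4 : ¬ inLast A' p := fun e => hpA (mem_of_inLast e)
  refine ⟨fun r s hr hs => ?_, fun r hr => ?_, fun r hr => ?_⟩
  · rw [hlt r s hr hs]
    change before _ r s ↔ _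
    simp only [before_append, before, inFirst, hr, hs, false_and, false_or]
  · rw [hlt _ r (Ne.symm hpq) hr]
    change before _ p r ↔ _
    simp only [before_append, before, inFirst] 
    grind
  · rw [hlt r _ hr (Ne.symm hpq)]
    change before _ r p ↔ _
    simp only [before_append, before, inFirst] 
    grind

end Threads

/-! ### Reflections of lists -/

namespace Threads

open ThreadList

section TiltTo

variable {V : Type} [Fintype V] [DecidableEq V] {k : Type u} [Field k]

variable (k) in
/-- The thread algebras given by the first list are equivalent to thread algebras given by the
second list. -/
def TiltTo (L L' : List (Option (V × Bool))) : Prop :=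
  ∀ D : Threads V, D.Connected → D.HasList L → ∃ D' : Threads V, D'.Connected ∧ D'.HasList L' ∧
    TiltCotiltEquivalent (AlgCat.of k (D.algebra k)) (AlgCat.of k (D'.algebra k))

theorem TiltTo.refl (L : List (Option (V × Bool))) : TiltTo k L L :=
  fun D hD hL => ⟨D, hD, hL, .refl⟩

theorem TiltTo.trans {L L' L'' : List (Option (V × Bool))} (h : TiltTo k L L')
    (h' : TiltTo k L' L'') : TiltTo k L L'' := by
  intro D hD hL
  obtain ⟨D', hD', hL', he⟩ := h D hD hL
  obtain ⟨D'', hD'', hL'', he'⟩ := h' D' hD' hL'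
  exact ⟨D'', hD'', hL'', Relation.ReflTransGen.trans he he'⟩

/-- A block with a single entry imposes no order relation, exactly like a position missing from the
list. -/
theorem tiltTo_dropLast (L : List (Option (V × Bool))) (p : V × Bool) :
    TiltTo k (L ++ [none, some p]) L := by
  intro D hD hL
  refine ⟨D, hD, ⟨?_, fun r s => (hL.lt_iff r s).trans ?_⟩, .refl⟩
  · have := hL.nodup
    rw [List.reduceOption_append] at this
    exact this.of_append_left
  · simp [before_append, before, inFirst]

theorem tiltTo_cons {L : List (Option (V × Bool))} {p : V × Bool} (hp : some p ∉ L) :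
    TiltTo k L (some p :: none :: L) := by
  intro D hD hL
  refine ⟨D, hD, ⟨?_, fun r s => (hL.lt_iff r s).trans ?_⟩, .refl⟩
  · rw [List.reduceOption_cons_of_some, List.nodup_cons, List.reduceOption_mem_iff]
    exact ⟨by simpa using hp, hL.nodup⟩
  · simp [before, inFirst]

/-- Reflection at a vertex with one isolated position, namely the one missing from the list; `A, C`
surround the place of removal and `A', C'` the place of insertion. -/
theorem tiltTo_reflect {L A C A' C' L' : List (Option (V × Bool))} (p q : V × Bool)
    (hL : L = A ++ some q :: some p :: C)
    (hAC : A ++ some q :: C = A' ++ some (other q) :: C')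
    (hL' : L' = A' ++ some p :: some (other q) :: C') (hp : some (other p) ∉ L) :
    TiltTo k L L' := by
  intro D hD h
  obtain ⟨D', h', hm⟩ := h.isMove (p := p) (q := other q) (A := A ++ [some q]) (C := C)
    (by simpa using hL) (by simpa using hAC) hL'
  have hx : ∀ s, ¬ D.lt s (other p) ∧ ¬ D.lt (other p) s := fun s =>
    ⟨fun e => hp (mem_of_before ((h.lt_iff _ _).1 e)).2,
      fun e => hp (mem_of_before ((h.lt_iff _ _).1 e)).1⟩
  have hpr : D.IsPred q p := by
    rw [hL] at h
    exact h.isPred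
  have hqp : q.1 ≠ p.1 := by
    intro e
    rcases eq_or_eq_other e with e | e
    · exact ne_of_lt hpr.lt e
    · exact hp (by rw [hL, e]; simp)
  have hr := hm.isReflection (x := p.1) (j := p.2) hpr hqp hx
  exact ⟨D', hr.connected hD, h', .single (hr.tiltCotiltStep hD k)⟩

/-- Reflection at a vertex with both positions moving. The first two equations read the predecessors
in the original list; the others record the two removals and insertions, which together are one
tilting step. -/
theorem tiltTo_reflect₂ {L A₀ C₀ A₁ C₁ A₀' C₀' A₁' C₁' A₂ C₂ L' : List (Option (V × Bool))}
    (p q₀ q₁ : V × Bool)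
    (hL₀ : L = A₀ ++ some q₀ :: some p :: C₀)
    (hL₁ : L = A₁ ++ some q₁ :: some (other p) :: C₁)
    (hAC₀ : A₀ ++ some q₀ :: C₀ = A₀' ++ some (other q₀) :: C₀')
    (hL : A₀' ++ some p :: some (other q₀) :: C₀' = A₁' ++ some (other p) :: C₁')
    (hAC₁ : A₁' ++ C₁' = A₂ ++ some (other q₁) :: C₂)
    (hL' : L' = A₂ ++ some (other p) :: some (other q₁) :: C₂)
    (hq₀ : q₀.1 ≠ p.1) (hq₁ : q₁.1 ≠ p.1) :
    TiltTo k L L' := by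
  intro D hD h
  obtain ⟨D₁, h₁, hm₁⟩ := h.isMove (p := p) (q := other q₀) (A := A₀ ++ [some q₀]) (C := C₀)
    (by simpa using hL₀) (by simpa using hAC₀) rfl
  obtain ⟨D₂, h₂, hm₂⟩ := h₁.isMove hL hAC₁ hL'
  have hpr₀ : D.IsPred q₀ p := by
    rw [hL₀] at h
    exact h.isPred
  have hpr₁ : D.IsPred q₁ (other p) := by
    rw [hL₁] at h
    exact h.isPred
  have hr := hm₁.isReflection₂ (x := p.1) (j := p.2) hm₂ hpr₀ hpr₁ hq₀ hq₁
  exact ⟨D₂, hr.connected hD, h₂, .single (hr.tiltCotiltStep hD k)⟩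

end TiltTo

/-! ### States -/

/-- The list of positions on a path, given the inner vertices and the information at which of them
there is a relation. -/
def enc {V : Type} : List ((V × Bool) × Bool) → List (Option (V × Bool))
  | [] => []
  | (x, false) :: w => some x :: enc w
  | (x, true) :: w => some x :: none :: some (other x) :: enc w

theorem enc_append {V : Type} (w w' : List ((V × Bool) × Bool)) :
    enc (w ++ w') = enc w ++ enc w' := by
  induction w with
  | nil => rfl
  | cons x w ih =>
    obtain ⟨x, b⟩ := x
    cases b <;> simp [enc, ih]

theorem mem_enc {V : Type} {w : List ((V × Bool) × Bool)} {p : V × Bool} (h : some p ∈ enc w) :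
    p.1 ∈ w.map (fun x => x.1.1) := by
  induction w with
  | nil => simp [enc] at h
  | cons x w ih =>
    obtain ⟨x, b⟩ := x
    cases b <;> simp only [enc, List.mem_cons, Option.some.injEq, reduceCtorEq, false_or] at h
    · rcases h with rfl | h
      · simp
      · exact List.mem_cons_of_mem _ (ih h)
    · rcases h with rfl | rfl | h
      · simp
      · simp
      · exact List.mem_cons_of_mem _ (ih h)

/-- Data describing a gentle algebra whose quiver consists of two paths from `v` to `u` and a path
from `u` to `v`, with relations at the vertices `u` and `v`. -/
structure State (V : Type) where
  v : V × Bool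
  u : V × Bool
  a : List ((V × Bool) × Bool)
  b : List ((V × Bool) × Bool)
  c : List ((V × Bool) × Bool)

namespace State

/-- The list of positions. -/
def list {V : Type} (S : State V) : List (Option (V × Bool)) :=
  some S.v :: (enc S.c ++ some S.u :: (enc S.b ++ some (other S.v) ::
    (enc S.a ++ [some (other S.u)])))

/-- The list of vertices. -/
def verts {V : Type} (S : State V) : List V :=
  S.v.1 :: S.u.1 :: (S.a ++ S.b ++ S.c).map (fun x => x.1.1)

variable {V : Type} [Fintype V] [DecidableEq V] {k : Type u} [Field k]

variable (k) in
/-- The algebras given by the first state are equivalent to algebras given by the second state. -/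
def Reaches (S S' : State V) : Prop :=
  S'.verts.Perm S.verts ∧ (S.verts.Nodup → TiltTo k S.list S'.list)

theorem Reaches.refl (S : State V) : Reaches k S S := ⟨List.Perm.refl _, fun _ => TiltTo.refl _⟩

theorem Reaches.trans {S S' S'' : State V} (h : Reaches k S S') (h' : Reaches k S' S'') :
    Reaches k S S'' :=
  ⟨h'.1.trans h.1, fun hn => (h.2 hn).trans (h'.2 (h.1.nodup_iff.2 hn))⟩

/-- In the list `y | other y, x` the predecessor of the unmarked `x` is `other y`, and the
reflection at `x` inserts it before `y`. -/
theorem tiltTo_swap {A B : List (Option (V × Bool))} {X Y : List ((V × Bool) × Bool)}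
    {x y : V × Bool} (hA : some (other x) ∉ A) (hB : some (other x) ∉ B)
    (hn : ((X ++ (y, true) :: (x, false) :: Y).map fun x => x.1.1).Nodup) :
    TiltTo k (A ++ enc (X ++ (y, true) :: (x, false) :: Y) ++ B)
      (A ++ enc (X ++ (x, false) :: (y, true) :: Y) ++ B) := by
  refine tiltTo_reflect x (other y) (A := A ++ enc X ++ [some y, none]) (C := enc Y ++ B)
    (A' := A ++ enc X) (C' := none :: some (other y) :: (enc Y ++ B)) ?_ ?_ ?_ ?_
  · simp [enc_append, enc]
  · simp
  · simp [enc_append, enc]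
  · simp only [List.map_append, List.map_cons, List.nodup_append, List.nodup_cons, List.mem_cons,
      not_or] at hn
    have hX : some (other x) ∉ enc X := fun e => hn.2.2 _ (mem_enc e) x.1 (by simp) rfl
    have hY : some (other x) ∉ enc Y := fun e => hn.2.1.2.1 (mem_enc e :)
    have h1 : x ≠ y := fun e => hn.2.1.1.1 (by rw [e])
    have h2 : other x ≠ y := fun e => hn.2.1.1.1 (by rw [← e]; rfl)
    have h3 := other_ne x
    simp only [enc_append, enc, List.mem_append, List.mem_cons, Option.some.injEq, reduceCtorEq,
      other_injective.eq_iff]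
    tauto

/-- Exchange two neighbours in a word. -/
def Swap (w w' : List ((V × Bool) × Bool)) : Prop :=
  ∃ X Y x y, w = X ++ (y, true) :: (x, false) :: Y ∧ w' = X ++ (x, false) :: (y, true) :: Y

/-- Together with its analogues for `b` and `c`, this makes only the numbers of marked and unmarked
letters in each word matter. -/
theorem reaches_swap_a {v u : V × Bool} {a a' b c : List ((V × Bool) × Bool)}
    (h : Relation.ReflTransGen Swap a a') : Reaches k ⟨v, u, a, b, c⟩ ⟨v, u, a', b, c⟩ := by
  induction h with
  | refl => exact .refl _
  | tail _ h ih =>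
    refine ih.trans ?_
    obtain ⟨X, Y, x, y, rfl, rfl⟩ := h
    refine ⟨?_, fun hn => ?_⟩
    · refine List.perm_iff_count.2 fun z => ?_
      simp only [verts, List.map_append, List.map_cons, List.count_cons, List.count_append]
      omega
    · have h1 : some (other x) ∉ some v :: (enc c ++ some u :: (enc b ++ [some (other v)])) := by
        have := @mem_enc V c (other x)
        have := @mem_enc V b (other x)
        simp only [verts, List.map_append, List.map_cons, List.nodup_append, List.nodup_cons,
          List.mem_cons, List.mem_append, not_or, Option.some.injEq] at *
        grind [other]
      have h2 : some (other x) ∉ [some (other u)] := by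
        simp only [verts, List.map_append, List.map_cons, List.nodup_append, List.nodup_cons,
          List.mem_cons, List.mem_append, not_or, Option.some.injEq] at *
        grind [other]
      have h3 : ((X ++ (y, true) :: (x, false) :: Y).map fun x => x.1.1).Nodup := by
        simp only [verts, List.map_append, List.nodup_cons, List.nodup_append] at hn ⊢
        exact hn.2.2.1.1
      have := tiltTo_swap (k := k) h1 h2 h3
      simpa [list] using this

theorem reaches_swap_b {v u : V × Bool} {a b b' c : List ((V × Bool) × Bool)}
    (h : Relation.ReflTransGen Swap b b') : Reaches k ⟨v, u, a, b, c⟩ ⟨v, u, a, b', c⟩ := by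
  induction h with
  | refl => exact .refl _
  | tail _ h ih =>
    refine ih.trans ?_
    obtain ⟨X, Y, x, y, rfl, rfl⟩ := h
    refine ⟨?_, fun hn => ?_⟩
    · refine List.perm_iff_count.2 fun z => ?_
      simp only [verts, List.map_append, List.map_cons, List.count_cons, List.count_append]
      omega
    · have h1 : some (other x) ∉ some v :: (enc c ++ [some u]) := by
        have := @mem_enc V c (other x)
        simp only [verts, List.map_append, List.map_cons, List.nodup_append, List.nodup_cons,
          List.mem_cons, List.mem_append, not_or, Option.some.injEq] at *
        grind [other]
      have h2 : some (other x) ∉ some (other v) :: (enc a ++ [some (other u)]) := by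
        have := @mem_enc V a (other x)
        simp only [verts, List.map_append, List.map_cons, List.nodup_append, List.nodup_cons,
          List.mem_cons, List.mem_append, not_or, Option.some.injEq] at *
        grind [other]
      have h3 : ((X ++ (y, true) :: (x, false) :: Y).map fun x => x.1.1).Nodup := by
        simp only [verts, List.map_append, List.nodup_cons, List.nodup_append] at hn ⊢
        exact hn.2.2.1.2.1
      have := tiltTo_swap (k := k) h1 h2 h3
      simpa [list] using this

theorem reaches_swap_c {v u : V × Bool} {a b c c' : List ((V × Bool) × Bool)}
    (h : Relation.ReflTransGen Swap c c') : Reaches k ⟨v, u, a, b, c⟩ ⟨v, u, a, b, c'⟩ := by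
  induction h with
  | refl => exact .refl _
  | tail _ h ih =>
    refine ih.trans ?_
    obtain ⟨X, Y, x, y, rfl, rfl⟩ := h
    refine ⟨?_, fun hn => ?_⟩
    · refine List.perm_iff_count.2 fun z => ?_
      simp only [verts, List.map_append, List.map_cons, List.count_cons, List.count_append]
      omega
    · have h1 : some (other x) ∉ [some v] := by
        simp only [verts, List.map_append, List.map_cons, List.nodup_append, List.nodup_cons,
          List.mem_cons, List.mem_append, not_or, Option.some.injEq] at *
        grind [other]
      have h2 : some (other x) ∉ some u :: (enc b ++ some (other v) ::
          (enc a ++ [some (other u)])) := by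
        have := @mem_enc V a (other x)
        have := @mem_enc V b (other x)
        simp only [verts, List.map_append, List.map_cons, List.nodup_append, List.nodup_cons,
          List.mem_cons, List.mem_append, not_or, Option.some.injEq] at *
        grind [other]
      have h3 : ((X ++ (y, true) :: (x, false) :: Y).map fun x => x.1.1).Nodup := by
        simp only [verts, List.map_append, List.nodup_cons, List.nodup_append] at hn ⊢
        exact hn.2.2.2.1
      have := tiltTo_swap (k := k) h1 h2 h3
      simpa [list] using this

end State

end Threads

/-! ### Moves between the words of a state. -/

namespace Threads

namespace State

variable {V : Type} [Fintype V] [DecidableEq V] {k : Type u} [Field k]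

/-- The first letter of `c` follows `v`, so its reflection puts it before `other v`, at the end of
`b`. -/
theorem reaches_c_to_b (v u x : V × Bool) (a b c : List ((V × Bool) × Bool)) :
    Reaches k ⟨v, u, a, b, (x, false) :: c⟩ ⟨v, u, a, b ++ [(x, false)], c⟩ := by
  refine ⟨?_, fun hn => ?_⟩
  · refine List.perm_iff_count.2 fun z => ?_
    simp only [verts, List.map_append, List.map_cons, List.count_cons, List.count_append]
    simp only [List.map_nil, List.count_nil]
    omega
  · refine tiltTo_reflect x v (A := []) (C := enc c ++ some u :: (enc b ++ some (other v) ::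
      (enc a ++ [some (other u)]))) (A' := some v :: (enc c ++ some u :: enc b))
      (C' := enc a ++ [some (other u)]) ?_ ?_ ?_ ?_
    · simp [list, enc]
    · simp
    · simp [list, enc_append, enc]
    · have := @mem_enc V a (other x)
      have := @mem_enc V b (other x)
      have := @mem_enc V c (other x)
      simp only [verts, list, enc, List.map_append, List.map_cons, List.nodup_append,
        List.nodup_cons, List.mem_cons, List.mem_append, not_or, Option.some.injEq] at *
      grind [other]

/-- The first letter of `b` follows `u`, so its reflection puts it before `other u`, at the end of
`a`. -/
theorem reaches_b_to_a (v u x : V × Bool) (a b c : List ((V × Bool) × Bool)) :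
    Reaches k ⟨v, u, a, (x, false) :: b, c⟩ ⟨v, u, a ++ [(x, false)], b, c⟩ := by
  refine ⟨?_, fun hn => ?_⟩
  · refine List.perm_iff_count.2 fun z => ?_
    simp only [verts, List.map_append, List.map_cons, List.count_cons, List.count_append]
    simp only [List.map_nil, List.count_nil]
    omega
  · refine tiltTo_reflect x u (A := some v :: enc c) (C := enc b ++ some (other v) ::
      (enc a ++ [some (other u)]))
      (A' := some v :: (enc c ++ some u :: (enc b ++ some (other v) :: enc a)))
      (C' := []) ?_ ?_ ?_ ?_
    · simp [list, enc]
    · simp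
    · simp [list, enc_append, enc]
    · have := @mem_enc V a (other x)
      have := @mem_enc V b (other x)
      have := @mem_enc V c (other x)
      simp only [verts, list, enc, List.map_append, List.map_cons, List.nodup_append,
        List.nodup_cons, List.mem_cons, List.mem_append, not_or, Option.some.injEq] at *
      grind [other]

/-- With primes for other positions, the list is `v c z | z' u b v' a y | y' u'`. Reflection at `u`
yields `v c u z | z' b v' a u' y | y'`. Now `y'` is isolated, and reflection at `y` moves `y` from
behind `u'` to before `u`: `v c y u z | z' b v' a u'`. The mark at `y` has disappeared. -/
theorem reaches_contract (v u y z : V × Bool) (a b c : List ((V × Bool) × Bool)) :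
    Reaches k ⟨v, u, a ++ [(y, true)], b, c ++ [(z, true)]⟩
      ⟨v, u, a, (z, true) :: b, c ++ [(y, false)]⟩ := by
  refine ⟨?_, fun hn => ?_⟩
  · refine List.perm_iff_count.2 fun w => ?_
    simp only [verts, List.map_append, List.map_cons, List.count_cons, List.count_append]
    simp only [List.map_nil, List.count_nil]
    omega
  · have hyz : y.1 ≠ z.1 ∧ y.1 ≠ u.1 ∧ z.1 ≠ u.1 ∧ y.1 ≠ v.1 := by
      simp only [verts, List.map_append, List.map_cons, List.nodup_append,
        List.nodup_cons, List.mem_cons, List.mem_append, not_or] at hn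
      grind
    refine (tiltTo_reflect₂ (L' := some v :: (enc c ++ some u :: some z :: none :: some (other z) ::
      (enc b ++ some (other v) :: (enc a ++ some (other u) :: some y :: none :: [some (other y)]))))
      u (other z) (other y)
      (A₀ := some v :: (enc c ++ some z :: [none]))
      (C₀ := enc b ++ some (other v) :: (enc a ++ some y :: none :: some (other y) ::
        [some (other u)]))
      (A₁ := some v :: (enc c ++ some z :: none :: some (other z) :: some u :: (enc b ++
        some (other v) :: (enc a ++ some y :: [none])))) (C₁ := [])
      (A₀' := some v :: enc c)
      (C₀' := none :: some (other z) :: (enc b ++ some (other v) :: (enc a ++ some y :: none ::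
        some (other y) :: [some (other u)])))
      (A₁' := some v :: (enc c ++ some u :: some z :: none :: some (other z) ::
        (enc b ++ some (other v) :: (enc a ++ some y :: none :: [some (other y)]))))
      (C₁' := [])
      (A₂ := some v :: (enc c ++ some u :: some z :: none :: some (other z) ::
        (enc b ++ some (other v) :: enc a)))
      (C₂ := none :: [some (other y)]) ?_ ?_ ?_ ?_ ?_ ?_ ?_ ?_).trans ?_
    · simp [list, enc, enc_append]
    · simp [list, enc, enc_append]
    · simp
    · simp
    · simp
    · simp
    · exact hyz.2.2.1
    · exact hyz.2.1
    -- The position `other y` is now alone in its block and can be dropped, which makes the one-arm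
    -- reflection at `y` available.
    refine TiltTo.trans (L' := some v :: (enc c ++ some u :: some z :: none :: some (other z) ::
      (enc b ++ some (other v) :: (enc a ++ some (other u) :: [some y])))) ?_ ?_
    · have := tiltTo_dropLast (k := k) (some v :: (enc c ++ some u :: some z :: none ::
        some (other z) :: (enc b ++ some (other v) :: (enc a ++ some (other u) :: [some y]))))
        (other y)
      simpa using this
    refine tiltTo_reflect y (other u)
      (A := some v :: (enc c ++ some u :: some z :: none ::
        some (other z) :: (enc b ++ some (other v) :: enc a))) (C := [])
      (A' := some v :: enc c) (C' := some z :: none ::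
        some (other z) :: (enc b ++ some (other v) :: (enc a ++ [some (other u)]))) ?_ ?_ ?_ ?_
    · simp
    · simp
    · simp [list, enc, enc_append]
    · have := @mem_enc V a (other y)
      have := @mem_enc V b (other y)
      have := @mem_enc V c (other y)
      simp only [verts, List.map_append, List.map_cons, List.nodup_append,
        List.nodup_cons, List.mem_cons, List.mem_append, not_or, Option.some.injEq] at *
      grind [other]

/-- Here `u` follows `v` directly: `v u b v' a y | y' u'` becomes `v b u v' a u' y | y'` by
reflection at `u`, and then `v b y u v' a u'` by reflection at `y`. -/
theorem reaches_contract_nil (v u y : V × Bool) (a b : List ((V × Bool) × Bool)) :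
    Reaches k ⟨v, u, a ++ [(y, true)], b, []⟩ ⟨v, u, a, [], b ++ [(y, false)]⟩ := by
  refine ⟨?_, fun hn => ?_⟩
  · refine List.perm_iff_count.2 fun w => ?_
    simp only [verts, List.map_append, List.map_cons, List.count_cons, List.count_append]
    simp only [List.map_nil, List.count_nil]
    omega
  · have hyz : y.1 ≠ u.1 ∧ v.1 ≠ u.1 ∧ y.1 ≠ v.1 := by
      simp only [verts, List.map_append, List.map_cons, List.nodup_append,
        List.nodup_cons, List.mem_cons, List.mem_append, not_or] at hn
      grind
    refine (tiltTo_reflect₂ (L' := some v :: (enc b ++ some u :: some (other v) :: (enc a ++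
      some (other u) :: some y :: none :: [some (other y)])))
      u v (other y)
      (A₀ := [])
      (C₀ := enc b ++ some (other v) :: (enc a ++ some y :: none :: some (other y) ::
        [some (other u)]))
      (A₁ := some v :: some u :: (enc b ++
        some (other v) :: (enc a ++ some y :: [none]))) (C₁ := [])
      (A₀' := some v :: enc b)
      (C₀' := (enc a ++ some y :: none :: some (other y) :: [some (other u)]))
      (A₁' := some v :: (enc b ++ some u ::
        some (other v) :: (enc a ++ some y :: none :: [some (other y)])))
      (C₁' := [])
      (A₂ := some v :: (enc b ++ some u :: some (other v) :: enc a))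
      (C₂ := none :: [some (other y)]) ?_ ?_ ?_ ?_ ?_ ?_ ?_ ?_).trans ?_
    · simp [list, enc, enc_append]
    · simp [list, enc, enc_append]
    · simp
    · simp
    · simp
    · simp
    · exact hyz.2.1
    · exact hyz.1
    refine TiltTo.trans (L' := some v :: (enc b ++ some u :: some (other v) :: (enc a ++
      some (other u) :: [some y]))) ?_ ?_
    · have := tiltTo_dropLast (k := k) (some v :: (enc b ++ some u :: some (other v) :: (enc a ++
        some (other u) :: [some y]))) (other y)
      simpa using this
    refine tiltTo_reflect y (other u)
      (A := some v :: (enc b ++ some u :: some (other v) :: enc a)) (C := [])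
      (A' := some v :: enc b) (C' := some (other v) :: (enc a ++ [some (other u)])) ?_ ?_ ?_ ?_
    · simp
    · simp
    · simp [list, enc, enc_append]
    · have := @mem_enc V a (other y)
      have := @mem_enc V b (other y)
      simp only [verts, List.map_append, List.map_cons, List.nodup_append,
        List.nodup_cons, List.mem_cons, List.mem_append, not_or, Option.some.injEq] at *
      grind [other]

/-- Reflection at `u` turns `v c z | z' u b v' u'` into `u' v c u z | z' b v'`, since `u'` follows
`v'` and goes before `v`. Read from the new start `u'`, this has the same shape with the words
rotated. -/
theorem reaches_turn (v u z : V × Bool) (b c : List ((V × Bool) × Bool)) :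
    Reaches k ⟨v, u, [], b, c ++ [(z, true)]⟩ ⟨other u, v, (z, true) :: b, c, []⟩ := by
  refine ⟨?_, fun hn => ?_⟩
  · simp only [verts, List.map_append, List.map_cons, other_fst]
    refine List.perm_iff_count.2 fun w => ?_
    simp only [List.count_cons, List.count_append, List.map_nil, List.count_nil]
    omega
  · have hyz : z.1 ≠ u.1 ∧ v.1 ≠ u.1 := by
      simp only [verts, List.map_append, List.map_cons, List.nodup_append,
        List.nodup_cons, List.mem_cons, List.mem_append, not_or] at hn
      grind
    refine tiltTo_reflect₂
      u (other z) (other v)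
      (A₀ := some v :: (enc c ++ some z :: [none]))
      (C₀ := enc b ++ some (other v) :: [some (other u)])
      (A₁ := some v :: (enc c ++ some z :: none :: some (other z) :: some u :: enc b))
      (C₁ := [])
      (A₀' := some v :: enc c)
      (C₀' := none :: some (other z) :: (enc b ++ some (other v) :: [some (other u)]))
      (A₁' := some v :: (enc c ++ some u :: some z :: none :: some (other z) ::
        (enc b ++ [some (other v)])))
      (C₁' := [])
      (A₂ := [])
      (C₂ := enc c ++ some u :: some z :: none :: some (other z) ::
        (enc b ++ [some (other v)])) ?_ ?_ ?_ ?_ ?_ ?_ ?_ ?_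
    · simp [list, enc, enc_append]
    · simp [list, enc, enc_append]
    · simp
    · simp
    · simp
    · simp [list, enc]
    · exact hyz.1
    · exact hyz.2

/-- From `v c u b y | y' v' x a u'`, reflection at `x` gives `x v c u b y | y' v' a u'`. With the
isolated `x'` listed in front, reflection at `v` gives `v x' | x c u b v' y | y' a u'`, so `x` has
acquired a mark. -/
theorem reaches_expand (v u x y : V × Bool) (a b c : List ((V × Bool) × Bool)) :
    Reaches k ⟨v, u, (x, false) :: a, b ++ [(y, true)], c⟩
      ⟨v, u, (y, true) :: a, b, (other x, true) :: c⟩ := by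
  refine ⟨?_, fun hn => ?_⟩
  · simp only [verts, List.map_append, List.map_cons, other_fst]
    refine List.perm_iff_count.2 fun w => ?_
    simp only [List.count_cons, List.count_append, List.map_nil, List.count_nil]
    omega
  · have hyz : y.1 ≠ v.1 ∧ x.1 ≠ v.1 := by
      simp only [verts, List.map_append, List.map_cons, List.nodup_append,
        List.nodup_cons, List.mem_cons, List.mem_append, not_or] at hn
      grind
    have hx : some (other x) ∉ some x :: some v :: (enc c ++ some u :: (enc b ++ some y :: none ::
        some (other y) :: some (other v) :: (enc a ++ [some (other u)]))) := by
      have := @mem_enc V a (other x)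
      have := @mem_enc V b (other x)
      have := @mem_enc V c (other x)
      simp only [verts, List.map_append, List.map_cons, List.nodup_append,
        List.nodup_cons, List.mem_cons, List.mem_append, not_or, Option.some.injEq] at *
      grind [other]
    refine (tiltTo_reflect (L' := some x :: some v :: (enc c ++ some u :: (enc b ++ some y ::
        none :: some (other y) :: some (other v) :: (enc a ++ [some (other u)]))))
      x (other v)
      (A := some v :: (enc c ++ some u :: (enc b ++ some y :: none :: [some (other y)])))
      (C := enc a ++ [some (other u)])
      (A' := []) (C' := enc c ++ some u :: (enc b ++ some y :: none :: some (other y) ::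
        some (other v) :: (enc a ++ [some (other u)]))) ?_ ?_ ?_ ?_).trans ?_
    · simp [list, enc, enc_append]
    · simp
    · simp
    · simp only [list, enc, enc_append, List.mem_cons, List.mem_append] at hx ⊢
      tauto
    -- The isolated position `other x` is listed as a block so that `v` can be inserted before it.
    refine (tiltTo_cons hx).trans ?_
    refine tiltTo_reflect₂
      v x (other y)
      (A₀ := some (other x) :: [none])
      (C₀ := enc c ++ some u :: (enc b ++ some y :: none :: some (other y) ::
        some (other v) :: (enc a ++ [some (other u)])))
      (A₁ := some (other x) :: none :: some x :: some v :: (enc c ++ some u :: (enc b ++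
        some y :: [none])))
      (C₁ := enc a ++ [some (other u)])
      (A₀' := [])
      (C₀' := none :: some x :: (enc c ++ some u :: (enc b ++ some y :: none :: some (other y) ::
        some (other v) :: (enc a ++ [some (other u)]))))
      (A₁' := some v :: some (other x) :: none :: some x :: (enc c ++ some u :: (enc b ++ some y ::
        none :: [some (other y)])))
      (C₁' := enc a ++ [some (other u)])
      (A₂ := some v :: some (other x) :: none :: some x :: (enc c ++ some u :: enc b))
      (C₂ := none :: some (other y) :: (enc a ++ [some (other u)])) ?_ ?_ ?_ ?_ ?_ ?_ ?_ ?_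
    · simp
    · simp
    · simp
    · simp
    · simp
    · simp [list, enc]
    · exact hyz.2
    · exact hyz.1

/-- Here `v'` follows `u` directly: `v c u v' x a u'` becomes `x v c u v' a u'`, and reflection at
`v` gives `v x' | x c u a v' u'`. -/
theorem reaches_expand_nil (v u x : V × Bool) (a c : List ((V × Bool) × Bool)) :
    Reaches k ⟨v, u, (x, false) :: a, [], c⟩ ⟨v, u, [], a, (other x, true) :: c⟩ := by
  refine ⟨?_, fun hn => ?_⟩
  · simp only [verts, List.map_append, List.map_cons, other_fst]
    refine List.perm_iff_count.2 fun w => ?_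
    simp only [List.count_cons, List.count_append, List.map_nil, List.count_nil]
    omega
  · have hyz : u.1 ≠ v.1 ∧ x.1 ≠ v.1 := by
      simp only [verts, List.map_append, List.map_cons, List.nodup_append,
        List.nodup_cons, List.mem_cons, List.mem_append, not_or] at hn
      grind
    have hx : some (other x) ∉ some x :: some v :: (enc c ++ some u :: some (other v) ::
        (enc a ++ [some (other u)])) := by
      have := @mem_enc V a (other x)
      have := @mem_enc V c (other x)
      simp only [verts, List.map_append, List.map_cons, List.nodup_append,
        List.nodup_cons, List.mem_cons, List.mem_append, not_or, Option.some.injEq] at *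
      grind [other]
    refine (tiltTo_reflect (L' := some x :: some v :: (enc c ++ some u :: some (other v) ::
        (enc a ++ [some (other u)])))
      x (other v)
      (A := some v :: (enc c ++ [some u]))
      (C := enc a ++ [some (other u)])
      (A' := []) (C' := enc c ++ some u :: some (other v) :: (enc a ++ [some (other u)]))
      ?_ ?_ ?_ ?_).trans ?_
    · simp [list, enc]
    · simp
    · simp
    · simp only [list, enc, List.mem_cons, List.mem_append] at hx ⊢
      tauto
    refine (tiltTo_cons hx).trans ?_
    refine tiltTo_reflect₂
      v x u
      (A₀ := some (other x) :: [none])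
      (C₀ := enc c ++ some u :: some (other v) :: (enc a ++ [some (other u)]))
      (A₁ := some (other x) :: none :: some x :: some v :: enc c)
      (C₁ := enc a ++ [some (other u)])
      (A₀' := [])
      (C₀' := none :: some x :: (enc c ++ some u :: some (other v) :: (enc a ++ [some (other u)])))
      (A₁' := some v :: some (other x) :: none :: some x :: (enc c ++ [some u]))
      (C₁' := enc a ++ [some (other u)])
      (A₂ := some v :: some (other x) :: none :: some x :: (enc c ++ some u :: enc a))
      (C₂ := []) ?_ ?_ ?_ ?_ ?_ ?_ ?_ ?_
    · simp
    · simp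
    · simp
    · simp
    · simp
    · simp [list, enc]
    · exact hyz.2
    · exact hyz.1

end State

end Threads

/-! ### Reduction of states -/

/-- A predicate on six numbers that is closed under the transformations that correspond to the
moves of states holds everywhere. -/
theorem counts_induction {G : ℕ → ℕ → ℕ → ℕ → ℕ → ℕ → Prop}
    (done : ∀ b₀ b₁, G 0 0 b₀ b₁ 0 0)
    (c_to_b : ∀ a₀ a₁ b₀ b₁ c₀ c₁, G a₀ a₁ (b₀ + 1) b₁ c₀ c₁ → G a₀ a₁ b₀ b₁ (c₀ + 1) c₁)
    (b_to_a : ∀ a₀ a₁ b₀ b₁ c₀ c₁, G (a₀ + 1) a₁ b₀ b₁ c₀ c₁ → G a₀ a₁ (b₀ + 1) b₁ c₀ c₁)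
    (contract : ∀ a₀ a₁ b₀ b₁ c₀ c₁,
      G a₀ a₁ b₀ (b₁ + 1) (c₀ + 1) c₁ → G a₀ (a₁ + 1) b₀ b₁ c₀ (c₁ + 1))
    (contract_nil : ∀ a₀ a₁ b₀ b₁, G a₀ a₁ 0 0 (b₀ + 1) b₁ → G a₀ (a₁ + 1) b₀ b₁ 0 0)
    (turn : ∀ b₀ b₁ c₀ c₁, G b₀ (b₁ + 1) c₀ c₁ 0 0 → G 0 0 b₀ b₁ c₀ (c₁ + 1))
    (expand : ∀ a₀ a₁ b₀ b₁ c₀ c₁,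
      G a₀ (a₁ + 1) b₀ b₁ c₀ (c₁ + 1) → G (a₀ + 1) a₁ b₀ (b₁ + 1) c₀ c₁)
    (expand_nil : ∀ a₀ a₁ c₀ c₁, G 0 0 a₀ a₁ c₀ (c₁ + 1) → G (a₀ + 1) a₁ 0 0 c₀ c₁)
    (a₀ a₁ b₀ b₁ c₀ c₁ : ℕ) : G a₀ a₁ b₀ b₁ c₀ c₁ := by
  -- Each implication runs against its move, from the target to the source. Index `0` counts
  -- unmarked and index `1` marked letters.
  have all_c : ∀ n a₀ a₁ b₀ b₁ c₁, G a₀ a₁ (b₀ + n) b₁ 0 c₁ → G a₀ a₁ b₀ b₁ n c₁ := by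
    intro n
    induction n with
    | zero => exact fun _ _ _ _ _ h => h
    | succ n ih =>
      intro a₀ a₁ b₀ b₁ c₁ h
      exact c_to_b _ _ _ _ _ _ (ih _ _ _ _ _ (by rwa [Nat.add_right_comm]))
  have all_b : ∀ n a₀ a₁ b₁ c₀ c₁, G (a₀ + n) a₁ 0 b₁ c₀ c₁ → G a₀ a₁ n b₁ c₀ c₁ := by
    intro n
    induction n with
    | zero => exact fun _ _ _ _ _ h => h
    | succ n ih =>
      intro a₀ a₁ b₁ c₀ c₁ h
      exact b_to_a _ _ _ _ _ _ (ih _ _ _ _ _ (by rwa [Nat.add_right_comm]))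
  -- A marked letter in `b` acts as a catalyst: `expand`, `contract` and `c_to_b` carry one unmarked
  -- letter from `a` to `b` and restore the numbers of marks in all three words.
  have all_a : ∀ n a₁ b₀ b₁ c₀ c₁, G 0 a₁ (b₀ + n) (b₁ + 1) c₀ c₁ → G n a₁ b₀ (b₁ + 1) c₀ c₁ := by
    intro n
    induction n with
    | zero => exact fun _ _ _ _ _ h => h
    | succ n ih =>
      intro a₁ b₀ b₁ c₀ c₁ h
      exact expand _ _ _ _ _ _ (contract _ _ _ _ _ _ (c_to_b _ _ _ _ _ _
        (ih _ _ _ _ _ (by rwa [Nat.add_right_comm]))))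
  -- Induction on the total number of marks.
  obtain ⟨W, hW⟩ : ∃ W, W = a₁ + b₁ + c₁ := ⟨_, rfl⟩
  induction W generalizing a₀ a₁ b₀ b₁ c₀ c₁ with
  | zero =>
    obtain ⟨rfl, rfl, rfl⟩ : a₁ = 0 ∧ b₁ = 0 ∧ c₁ = 0 := by omega
    refine all_c _ _ _ _ _ _ (all_b _ _ _ _ _ _ ?_)
    generalize a₀ + (b₀ + c₀) = n
    match n with
    | 0 => exact done _ _
    | 1 =>
      exact expand_nil _ _ _ _ (turn _ _ _ _ (contract_nil _ _ _ _ (c_to_b _ _ _ _ _ _ (done _ _))))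
    -- Without marks there is no catalyst. Two uses of `expand_nil` create two marks, one of which
    -- ends in `b` and lets `all_a` run; two uses of `contract_nil` remove both marks again.
    | n + 2 =>
      refine expand_nil _ _ _ _ (b_to_a _ _ _ _ _ _ ?_)
      refine all_b _ _ _ _ _ _ ?_
      rw [show 0 + 1 + n = n + 1 by omega]
      refine expand_nil _ _ _ _ (turn _ _ _ _ ?_)
      refine all_a _ _ _ _ _ _ (contract_nil _ _ _ _ ?_)
      refine turn _ _ _ _ (contract_nil _ _ _ _ ?_)
      exact all_c _ _ _ _ _ _ (done _ _)
  | succ W ih =>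
    refine all_c _ _ _ _ _ _ ?_
    generalize b₀ + c₀ = b₀
    rcases a₁ with _ | a₁
    · rcases c₁ with _ | c₁
      -- All marks are in `b`, so `all_a` empties `a` and the state is final.
      · obtain rfl : b₁ = W + 1 := by omega
        exact all_a _ _ _ _ _ _ (done _ _)
      · rcases b₁ with _ | b₁
        · rcases Nat.eq_zero_or_pos (a₀ + b₀) with h0 | h0
          · obtain ⟨rfl, rfl⟩ : a₀ = 0 ∧ b₀ = 0 := by omega
            exact turn _ _ _ _ (contract_nil _ _ _ _ (ih _ _ _ _ _ _ (by omega)))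
          · refine all_b _ _ _ _ _ _ ?_
            -- All marks are in `c`. One extra mark is created so that, after a turn, `all_a` has a
            -- mark in `b` to work with; two contractions then leave one mark fewer than at the
            -- start.
            obtain ⟨A, hA⟩ : ∃ A, a₀ + b₀ = A + 1 := ⟨a₀ + b₀ - 1, by omega⟩
            rw [hA]
            refine expand_nil _ _ _ _ (turn _ _ _ _ (all_a _ _ _ _ _ _ ?_))
            refine contract_nil _ _ _ _ (all_c _ _ _ _ _ _ ?_)
            exact turn _ _ _ _ (contract_nil _ _ _ _ (ih _ _ _ _ _ _ (by omega)))
        -- Once `a` is empty, the turn brings marks into the new `a`, where `contract_nil` removes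
        -- one.
        · refine all_a _ _ _ _ _ _ ?_
          exact turn _ _ _ _ (contract_nil _ _ _ _ (ih _ _ _ _ _ _ (by omega)))
    · rcases c₁ with _ | c₁
      · exact contract_nil _ _ _ _ (ih _ _ _ _ _ _ (by omega))
      · exact contract _ _ _ _ _ _ (ih _ _ _ _ _ _ (by omega))

namespace Threads

namespace State

/-! ### Sorting words by swaps. -/

section Words

variable {V : Type}

/-- The number of letters of the given kind in a word. -/
def cnt (b : Bool) (w : List ((V × Bool) × Bool)) : ℕ := (w.map Prod.snd).count b

@[simp] theorem cnt_nil (b : Bool) : cnt b ([] : List ((V × Bool) × Bool)) = 0 := rfl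

@[simp] theorem cnt_cons (b : Bool) (x : (V × Bool) × Bool) (w : List ((V × Bool) × Bool)) :
    cnt b (x :: w) = cnt b w + if x.2 = b then 1 else 0 := by
  simp [cnt, List.count_cons]

@[simp] theorem cnt_append (b : Bool) (w w' : List ((V × Bool) × Bool)) :
    cnt b (w ++ w') = cnt b w + cnt b w' := by
  simp [cnt]

theorem eq_nil_of_cnt {w : List ((V × Bool) × Bool)} (h₀ : cnt false w = 0) (h₁ : cnt true w = 0) :
    w = [] := by
  rcases w with _ | ⟨⟨x, b⟩, w⟩
  · rfl
  · cases b <;> simp at h₀ h₁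

theorem Swap.cons {w w' : List ((V × Bool) × Bool)} (x : (V × Bool) × Bool) (h : Swap w w') :
    Swap (x :: w) (x :: w') := by
  obtain ⟨X, Y, y, z, rfl, rfl⟩ := h
  exact ⟨x :: X, Y, y, z, rfl, rfl⟩

theorem Swap.append {w w' : List ((V × Bool) × Bool)} (Z : List ((V × Bool) × Bool))
    (h : Swap w w') : Swap (w ++ Z) (w' ++ Z) := by
  obtain ⟨X, Y, y, z, rfl, rfl⟩ := h
  exact ⟨X, Y ++ Z, y, z, by simp, by simp⟩

theorem exists_front (w : List ((V × Bool) × Bool)) {n : ℕ} (h : cnt false w = n + 1) :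
    ∃ x w', Relation.ReflTransGen Swap w ((x, false) :: w') ∧ cnt false w' = n ∧
      cnt true w' = cnt true w := by
  induction w generalizing n with
  | nil => simp at h
  | cons y w ih =>
    obtain ⟨y, b⟩ := y
    cases b
    · exact ⟨y, w, .refl, by simpa using h, by simp⟩
    · obtain ⟨x, w', hs, h₀, h₁⟩ := ih (n := n) (by simpa using h)
      refine ⟨x, (y, true) :: w', ?_, by simpa using h₀, by simpa using h₁⟩
      exact .tail (hs.lift _ fun _ _ h => h.cons (y, true)) ⟨[], w', x, y, rfl, rfl⟩

theorem exists_back (w : List ((V × Bool) × Bool)) {n : ℕ} (h : cnt true w = n + 1) :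
    ∃ x w', Relation.ReflTransGen Swap w (w' ++ [(x, true)]) ∧ cnt true w' = n ∧
      cnt false w' = cnt false w := by
  induction w using List.reverseRecOn generalizing n with
  | nil => simp at h
  | append_singleton w y ih =>
    obtain ⟨y, b⟩ := y
    cases b
    · obtain ⟨x, w', hs, h₀, h₁⟩ := ih (n := n) (by simpa using h)
      refine ⟨x, w' ++ [(y, false)], ?_, by simpa using h₀, by simpa using h₁⟩
      refine .tail (hs.lift _ fun _ _ h => h.append [(y, false)]) ⟨w', [], y, x, ?_, ?_⟩ <;> simp
    · exact ⟨y, w, .refl, by simpa using h, by simp⟩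

/-- Unmarked letters are brought to the front one at a time by `exists_front`. -/
theorem exists_sorted (w : List ((V × Bool) × Bool)) :
    ∃ w', Relation.ReflTransGen Swap w w' ∧ w'.map Prod.snd =
      List.replicate (cnt false w) false ++ List.replicate (cnt true w) true := by
  obtain ⟨n, hn⟩ : ∃ n, cnt false w = n := ⟨_, rfl⟩
  induction n generalizing w with
  | zero =>
    refine ⟨w, .refl, ?_⟩
    rw [hn, List.replicate_zero, List.nil_append]
    induction w with
    | nil => rfl
    | cons x w ih =>
      obtain ⟨x, b⟩ := x
      cases b
      · simp at hn
      · simp [List.replicate_succ, ih (by simpa using hn)]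
  | succ n ih =>
    obtain ⟨x, w', hs, h₀, h₁⟩ := exists_front w hn
    obtain ⟨w'', hs', h'⟩ := ih w' h₀
    refine ⟨(x, false) :: w'', hs.trans (hs'.lift _ fun _ _ h => h.cons _), ?_⟩
    rw [List.map_cons, h', h₀, h₁, hn]
    rfl

end Words

variable {V : Type} [Fintype V] [DecidableEq V] {k : Type u} [Field k]

/-- Every state is equivalent to a state where the paths `a` and `c` have no inner vertices, and
the path `b` passes first through the inner vertices without relations. -/
theorem exists_reaches (S : State V) : ∃ (v u : V × Bool) (b : List ((V × Bool) × Bool)) (s r : ℕ),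
    b.map Prod.snd = List.replicate s false ++ List.replicate r true ∧
      Reaches k S ⟨v, u, [], b, []⟩ := by
  -- The predicate ranges over all states with the given counts, because the moves change the
  -- vertices and the letters.
  have key := counts_induction (G := fun a₀ a₁ b₀ b₁ c₀ c₁ => ∀ S : State V,
    cnt false S.a = a₀ → cnt true S.a = a₁ → cnt false S.b = b₀ → cnt true S.b = b₁ →
    cnt false S.c = c₀ → cnt true S.c = c₁ → ∃ (v u : V × Bool) (b : List ((V × Bool) × Bool))
      (s r : ℕ), b.map Prod.snd = List.replicate s false ++ List.replicate r true ∧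
        Reaches k S ⟨v, u, [], b, []⟩)
  have step : ∀ {S S' : State V}, Reaches k S S' → (∃ (v u : V × Bool)
      (b : List ((V × Bool) × Bool)) (s r : ℕ), b.map Prod.snd = List.replicate s false ++
        List.replicate r true ∧ Reaches k S' ⟨v, u, [], b, []⟩) → ∃ (v u : V × Bool)
      (b : List ((V × Bool) × Bool)) (s r : ℕ), b.map Prod.snd = List.replicate s false ++
        List.replicate r true ∧ Reaches k S ⟨v, u, [], b, []⟩ :=
    fun h ⟨v, u, b, s, r, hb, h'⟩ => ⟨v, u, b, s, r, hb, h.trans h'⟩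
  refine key ?_ ?_ ?_ ?_ ?_ ?_ ?_ ?_ _ _ _ _ _ _ S rfl rfl rfl rfl rfl rfl
  · rintro b₀ b₁ ⟨v, u, a, b, c⟩ ha₀ ha₁ - - hc₀ hc₁
    obtain rfl := eq_nil_of_cnt ha₀ ha₁
    obtain rfl := eq_nil_of_cnt hc₀ hc₁
    obtain ⟨b', hs, hb'⟩ := exists_sorted b
    exact ⟨v, u, b', _, _, hb', reaches_swap_b hs⟩
  · rintro a₀ a₁ b₀ b₁ c₀ c₁ h ⟨v, u, a, b, c⟩ ha₀ ha₁ hb₀ hb₁ hc₀ hc₁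
    obtain ⟨x, c', hs, h₀, h₁⟩ := exists_front c hc₀
    refine step ((reaches_swap_c hs).trans (reaches_c_to_b _ _ _ _ _ _)) (h _ ?_ ?_ ?_ ?_ ?_ ?_) <;>
      (clear h step key; simp_all)
  · rintro a₀ a₁ b₀ b₁ c₀ c₁ h ⟨v, u, a, b, c⟩ ha₀ ha₁ hb₀ hb₁ hc₀ hc₁
    obtain ⟨x, b', hs, h₀, h₁⟩ := exists_front b hb₀
    refine step ((reaches_swap_b hs).trans (reaches_b_to_a _ _ _ _ _ _)) (h _ ?_ ?_ ?_ ?_ ?_ ?_) <;>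
      (clear h step key; simp_all)
  · rintro a₀ a₁ b₀ b₁ c₀ c₁ h ⟨v, u, a, b, c⟩ ha₀ ha₁ hb₀ hb₁ hc₀ hc₁
    obtain ⟨y, a', hs, h₀, h₁⟩ := exists_back a ha₁
    obtain ⟨z, c', hs', h₀', h₁'⟩ := exists_back c hc₁
    refine step ((reaches_swap_a hs).trans ((reaches_swap_c hs').trans
      (reaches_contract _ _ _ _ _ _ _))) (h _ ?_ ?_ ?_ ?_ ?_ ?_) <;>
      (clear h step key; simp_all)
  · rintro a₀ a₁ b₀ b₁ h ⟨v, u, a, b, c⟩ ha₀ ha₁ hb₀ hb₁ hc₀ hc₁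
    obtain rfl := eq_nil_of_cnt hc₀ hc₁
    obtain ⟨y, a', hs, h₀, h₁⟩ := exists_back a ha₁
    refine step ((reaches_swap_a hs).trans (reaches_contract_nil _ _ _ _ _))
      (h _ ?_ ?_ ?_ ?_ ?_ ?_) <;>
      (clear h step key; simp_all)
  · rintro b₀ b₁ c₀ c₁ h ⟨v, u, a, b, c⟩ ha₀ ha₁ hb₀ hb₁ hc₀ hc₁
    obtain rfl := eq_nil_of_cnt ha₀ ha₁
    obtain ⟨z, c', hs, h₀, h₁⟩ := exists_back c hc₁
    refine step ((reaches_swap_c hs).trans (reaches_turn _ _ _ _ _))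
      (h _ ?_ ?_ ?_ ?_ ?_ ?_) <;>
      (clear h step key; simp_all)
  · rintro a₀ a₁ b₀ b₁ c₀ c₁ h ⟨v, u, a, b, c⟩ ha₀ ha₁ hb₀ hb₁ hc₀ hc₁
    obtain ⟨x, a', hs, h₀, h₁⟩ := exists_front a ha₀
    obtain ⟨y, b', hs', h₀', h₁'⟩ := exists_back b hb₁
    refine step ((reaches_swap_a hs).trans ((reaches_swap_b hs').trans
      (reaches_expand _ _ _ _ _ _ _))) (h _ ?_ ?_ ?_ ?_ ?_ ?_) <;>
      (clear h step key; simp_all)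
  · rintro a₀ a₁ c₀ c₁ h ⟨v, u, a, b, c⟩ ha₀ ha₁ hb₀ hb₁ hc₀ hc₁
    obtain rfl := eq_nil_of_cnt hb₀ hb₁
    obtain ⟨x, a', hs, h₀, h₁⟩ := exists_front a ha₀
    refine step ((reaches_swap_a hs).trans (reaches_expand_nil _ _ _ _ _))
      (h _ ?_ ?_ ?_ ?_ ?_ ?_) <;>
      (clear h step key; simp_all)

end State

end Threads

/-! ### Bound quiver algebras and thread algebras -/

namespace FinQuiver

variable {Q : FinQuiver}

theorem IsWalk.exists_append {x y : Q.V} {l m : List Q.A} (h : Q.IsWalk x (l ++ m) y) :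
    ∃ z, Q.IsWalk x l z ∧ Q.IsWalk z m y := by
  induction l generalizing x with
  | nil => exact ⟨x, rfl, h⟩
  | cons a l ih =>
    obtain ⟨z, h₁, h₂⟩ := ih h.2
    exact ⟨z, ⟨h.1, h₁⟩, h₂⟩

theorem IsWalk.tgt_unique {x x' y y' : Q.V} {l : List Q.A} (hl : l ≠ []) (h : Q.IsWalk x l y)
    (h' : Q.IsWalk x' l y') : x = x' ∧ y = y' := by
  induction l generalizing x x' with
  | nil => exact absurd rfl hl
  | cons a l ih =>
    refine ⟨h.1.symm.trans h'.1, ?_⟩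
    rcases l with _ | ⟨b, l⟩
    · exact Eq.trans (Eq.symm h.2) h'.2
    · exact (ih (List.cons_ne_nil _ _) h.2 h'.2).2

theorem Path.ext_arrows {p p' : Q.Path} (hp : p.arrows ≠ []) (h : p.arrows = p'.arrows) :
    p = p' := by
  obtain ⟨h₁, h₂⟩ := p.isWalk.tgt_unique hp (h ▸ p'.isWalk)
  exact Path.ext h₁ h₂ h

theorem ofPath_comp (k : Type u) [Field k] (p q : Q.Path) (h : p.src = q.tgt) :
    PathAlgebra.ofPath k (p.comp q h) = PathAlgebra.ofPath k p * PathAlgebra.ofPath k q := by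
  rw [PathAlgebra.ofPath_mul_ofPath, PathAlgebra.mulPath, dif_pos h]

theorem ofPath_mem_relIdeal (k : Type u) [Field k] {R : Set Q.Path} {p : Q.Path}
    {l m : List Q.A} {a b : Q.A} (hp : p.arrows = l ++ a :: b :: m) (h : RelMem R a b) :
    PathAlgebra.ofPath k p ∈ relIdeal k R := by
  obtain ⟨ρ, hρ, hab⟩ := h
  have hw := p.isWalk
  rw [hp] at hw
  obtain ⟨x, h₁, h₂⟩ := hw.exists_append
  change Q.IsWalk x ([a, b] ++ m) p.src at h₂
  obtain ⟨y, h₂, h₃⟩ := h₂.exists_append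
  obtain ⟨hx, hy⟩ := ρ.isWalk.tgt_unique (by simp [hab]) (hab ▸ h₂)
  let p₁ : Q.Path := ⟨p.tgt, x, l, h₁⟩
  let p₂ : Q.Path := ⟨y, p.src, m, h₃⟩
  have h₁ρ : p₁.src = ρ.tgt := hx.symm
  have hρ₂ : (p₁.comp ρ h₁ρ).src = p₂.tgt := hy
  have hpe : p = (p₁.comp ρ h₁ρ).comp p₂ hρ₂ :=
    Path.ext rfl rfl (by simp [Path.comp, hp, hab, p₁, p₂])
  rw [hpe, ofPath_comp, ofPath_comp]
  exact TwoSidedIdeal.mul_mem_right _ _ _ (TwoSidedIdeal.mul_mem_left _ _ _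
    (TwoSidedIdeal.subset_span ⟨ρ, hρ, rfl⟩))

/-- A description of a bound quiver by threads. -/
structure ThreadData (R : Set Q.Path) {V : Type} (D : Threads V) where
  vertex : Q.V ≃ V
  tail : Q.A → V × Bool
  head : Q.A → V × Bool
  tail_fst : ∀ a, (tail a).1 = vertex (Q.s a)
  head_fst : ∀ a, (head a).1 = vertex (Q.t a)
  head_injective : Function.Injective head
  lt_iff : ∀ p r, D.lt p r ↔ Relation.TransGen (fun p r => ∃ a, tail a = p ∧ head a = r) p r
  length_eq_two : ∀ ρ ∈ R, ρ.length = 2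
  rel_iff : ∀ a b, Q.s a = Q.t b → (RelMem R a b ↔ head b ≠ tail a)

namespace ThreadData

variable {R : Set Q.Path} {V : Type} {D : Threads V} (T : ThreadData R D)

theorem lt (a : Q.A) : D.lt (T.tail a) (T.head a) := (T.lt_iff _ _).2 (.single ⟨a, rfl, rfl⟩)

theorem connected (T : ThreadData R D) (h : Q.IsConnected) : D.Connected := by
  intro x y
  have hxy := h.2 (T.vertex.symm x) (T.vertex.symm y)
  rw [← T.vertex.apply_symm_apply x, ← T.vertex.apply_symm_apply y]
  generalize T.vertex.symm x = x at hxy ⊢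
  generalize T.vertex.symm y = y at hxy ⊢
  induction hxy with
  | rel x y h =>
    obtain ⟨a, rfl, rfl⟩ := h
    refine .rel _ _ ⟨(T.tail a).2, (T.head a).2, ?_⟩
    rw [← T.tail_fst, ← T.head_fst]
    exact T.lt a
  | refl x => exact .refl _
  | symm x y _ h => exact .symm _ _ h
  | trans x y z _ _ h h' => exact .trans _ _ _ h h'

/-- The arrows in the list, in reverse order, form a part of a thread from `s` to `r`. -/
def Chain (T : ThreadData R D) : V × Bool → List Q.A → V × Bool → Prop
  | r, [], s => r = s
  | r, a :: l, s => T.head a = r ∧ Chain T (T.tail a) l s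

theorem Chain.eq_or_lt {T : ThreadData R D} {r s : V × Bool} {l : List Q.A} (h : T.Chain r l s) :
    (l = [] ∧ r = s) ∨ D.lt s r := by
  induction l generalizing r with
  | nil => exact Or.inl ⟨rfl, h⟩
  | cons a l ih =>
    right
    obtain ⟨rfl, h⟩ := h
    rcases ih h with ⟨-, rfl⟩ | h
    · exact T.lt a
    · exact D.trans _ _ _ h (T.lt a)

/-- At most one arrow ends at a position, so a chain can be traced back from its end in only one
way; irreflexivity of the order rules out that one chain continues after the other has stopped. -/
theorem Chain.unique {T : ThreadData R D} {r s : V × Bool} {l l' : List Q.A} (h : T.Chain r l s)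
    (h' : T.Chain r l' s) : l = l' := by
  induction l generalizing r l' with
  | nil =>
    obtain rfl : r = s := h
    rcases l' with _ | ⟨b, l'⟩
    · rfl
    · exact (D.irrefl _ (h'.eq_or_lt.resolve_left fun e => List.cons_ne_nil _ _ e.1)).elim
  | cons a l ih =>
    rcases l' with _ | ⟨b, l'⟩
    · obtain rfl : r = s := h'
      exact (D.irrefl _ (h.eq_or_lt.resolve_left fun e => List.cons_ne_nil _ _ e.1)).elim
    · obtain rfl := T.head_injective (h.1.trans h'.1.symm)
      rw [ih h.2 h'.2]

/-- For consecutive arrows, either the positions match and the chain continues, or `rel_iff`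
provides a relation. Thus a path without a relation is a segment of a thread. -/
theorem chain_or_rel {l : List Q.A} {a : Q.A} {x y : Q.V} (h : Q.IsWalk x (a :: l) y) :
    (∃ s, T.Chain (T.head a) (a :: l) s) ∨
      ∃ l₁ b c l₂, a :: l = l₁ ++ b :: c :: l₂ ∧ RelMem R b c := by
  induction l generalizing x a with
  | nil => exact Or.inl ⟨_, rfl, rfl⟩
  | cons b l ih =>
    by_cases hab : T.head b = T.tail a
    · rcases ih h.2 with ⟨s, hs⟩ | ⟨l₁, c, d, l₂, hl, hr⟩
      · exact Or.inl ⟨s, rfl, hab ▸ hs⟩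
      · exact Or.inr ⟨a :: l₁, c, d, l₂, by rw [hl]; rfl, hr⟩
    · exact Or.inr ⟨[], a, b, l, rfl, (T.rel_iff a b h.2.1.symm).2 hab⟩

variable [Fintype V] [DecidableEq V] (k : Type u) [Field k]

/-- The element of the thread algebra given by an arrow. -/
noncomputable def arrowElt (a : Q.A) : D.algebra k := D.unit k (T.lt a)

theorem idem_mul_arrowElt (a : Q.A) :
    D.idem k (T.vertex (Q.t a)) * T.arrowElt k a = T.arrowElt k a := by
  refine Threads.ext_mat fun r s => ?_
  rw [map_mul, Threads.idem_mul_apply, arrowElt, Threads.unit_val, Matrix.single_apply]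
  split_ifs with h₁ h₂ h₂
  · rfl
  · rfl
  · exact absurd (by rw [← h₂.1, T.head_fst]) h₁
  · rfl

theorem arrowElt_mul_idem (a : Q.A) :
    T.arrowElt k a * D.idem k (T.vertex (Q.s a)) = T.arrowElt k a := by
  refine Threads.ext_mat fun r s => ?_
  rw [map_mul, Threads.mul_idem_apply, arrowElt, Threads.unit_val, Matrix.single_apply]
  split_ifs with h₁ h₂ h₂
  · rfl
  · rfl
  · exact absurd (by rw [← h₂.2, T.tail_fst]) h₁
  · rfl

theorem idem_mul_idem (x y : V) : D.idem k x * D.idem k y = if x = y then D.idem k x else 0 :=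
  (D.pointed k).orth x y

theorem prod_mul_idem {x y : Q.V} {l : List Q.A} (h : Q.IsWalk x l y) :
    D.idem k (T.vertex x) * (l.map (T.arrowElt k)).prod =
      (l.map (T.arrowElt k)).prod * D.idem k (T.vertex y) := by
  induction l generalizing x with
  | nil =>
    obtain rfl : x = y := h
    simp
  | cons a l ih =>
    obtain ⟨rfl, h⟩ := h
    rw [List.map_cons, List.prod_cons, ← mul_assoc, idem_mul_arrowElt, mul_assoc, ← ih h,
      ← mul_assoc, arrowElt_mul_idem]

/-- The element of the thread algebra given by a path. -/
noncomputable def pathElt (p : Q.Path) : D.algebra k :=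
  D.idem k (T.vertex p.tgt) * (p.arrows.map (T.arrowElt k)).prod

theorem pathElt_mul (p q : Q.Path) : T.pathElt k p * T.pathElt k q =
    (PathAlgebra.basis k).constr k (T.pathElt k) (PathAlgebra.mulPath k p q) := by
  have h1 : T.pathElt k p * T.pathElt k q = (p.arrows.map (T.arrowElt k)).prod *
      (D.idem k (T.vertex p.src) * D.idem k (T.vertex q.tgt)) *
      (q.arrows.map (T.arrowElt k)).prod := by
    unfold pathElt
    rw [T.prod_mul_idem k p.isWalk]
    simp only [mul_assoc]
  rw [h1, idem_mul_idem, PathAlgebra.mulPath]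
  by_cases h : p.src = q.tgt
  · rw [if_pos (by rw [h]), dif_pos h, PathAlgebra.ofPath, Module.Basis.constr_basis,
      ← T.prod_mul_idem k p.isWalk]
    unfold pathElt
    rw [mul_assoc, ← List.prod_append, ← List.map_append]
    rfl
  · rw [if_neg fun e => h (T.vertex.injective e), dif_neg h, mul_zero, zero_mul, map_zero]

/-- The homomorphism from the path algebra to the thread algebra. -/
noncomputable def pathHom : PathAlgebra k Q →ₐ[k] D.algebra k :=
  AlgHom.ofLinearMap ((PathAlgebra.basis k).constr k (T.pathElt k))
    (by
      rw [PathAlgebra.one_def, map_sum]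
      simp only [PathAlgebra.ofPath, Module.Basis.constr_basis]
      rw [← (D.pointed k).sum_e, ← T.vertex.sum_comp]
      refine Finset.sum_congr rfl fun x _ => ?_
      simp only [pathElt, Path.trivial, List.map_nil, List.prod_nil, mul_one]
      rfl)
    (by
      intro f g
      set F := (PathAlgebra.basis k).constr k (T.pathElt k)
      refine PathAlgebra.induction (P := fun f => F (f * g) = F f * F g) f ?_
        (fun a b ha hb => ?_) fun c p => ?_
      · rw [zero_mul, map_zero, zero_mul]
      · rw [add_mul, map_add, ha, hb, map_add, add_mul]
      refine PathAlgebra.induction (P := fun g => F (c • PathAlgebra.ofPath k p * g) =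
        F (c • PathAlgebra.ofPath k p) * F g) g ?_ (fun a b ha hb => ?_) fun d q => ?_
      · rw [mul_zero, map_zero, mul_zero]
      · rw [mul_add, map_add, ha, hb, map_add, mul_add]
      rw [smul_mul_smul_comm, map_smul, map_smul, map_smul, smul_mul_smul_comm,
        PathAlgebra.ofPath_mul_ofPath, ← pathElt_mul]
      simp only [F, PathAlgebra.ofPath, Module.Basis.constr_basis])

theorem pathHom_ofPath (p : Q.Path) :
    T.pathHom k (PathAlgebra.ofPath k p) = T.pathElt k p :=
  (PathAlgebra.basis k).constr_basis k _ p

/-- A relation is mapped to a product of two matrix units whose inner indices differ, which is zero.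
-/
theorem relIdeal_le : (relIdeal k R).ringCon ≤ RingCon.ker (T.pathHom k).toRingHom := by
  have h : relIdeal k R ≤ TwoSidedIdeal.ker (T.pathHom k) := by
    refine TwoSidedIdeal.span_le.2 ?_
    rintro _ ⟨ρ, hρ, rfl⟩
    rw [SetLike.mem_coe, TwoSidedIdeal.mem_ker, pathHom_ofPath, pathElt]
    obtain ⟨a, b, hab⟩ := List.length_eq_two.1 (T.length_eq_two ρ hρ)
    have hw := ρ.isWalk
    rw [hab] at hw ⊢
    have hr : T.head b ≠ T.tail a := (T.rel_iff a b hw.2.1.symm).1 ⟨ρ, hρ, hab⟩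
    rw [List.map_cons, List.map_cons, List.map_nil, List.prod_cons, List.prod_cons, List.prod_nil,
      mul_one]
    convert mul_zero _
    refine Threads.mat_injective ?_
    rw [map_mul, map_zero, arrowElt, arrowElt, Threads.unit_val, Threads.unit_val,
      Matrix.single_mul_single_of_ne _ _ _ _ hr.symm]
  intro x y hxy
  rw [RingCon.ker_apply]
  have := h ((TwoSidedIdeal.rel_iff _ x y).1 hxy)
  rw [TwoSidedIdeal.mem_ker, map_sub, sub_eq_zero] at this
  exact this

/-- The homomorphism from the bound quiver algebra to the thread algebra. -/
noncomputable def quotientHom : BoundQuiverAlgebra k R →ₐ[k] D.algebra k :=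
  RingCon.liftₐ _ (T.pathHom k) (T.relIdeal_le k)

/-- The thread algebra is spanned by vertex idempotents and matrix units of order relations, and
each such matrix unit is the product of the units of the arrows along a thread. -/
theorem mem_range_pathHom (M : D.algebra k) : M ∈ (T.pathHom k).range := by
  have hidem : ∀ x, D.idem k x ∈ (T.pathHom k).range := fun x => by
    refine ⟨PathAlgebra.ofPath k (Path.trivial (T.vertex.symm x)), ?_⟩
    change T.pathHom k _ = _
    rw [pathHom_ofPath]
    simp [pathElt, Path.trivial]
  have hunit : ∀ p r (h : D.lt p r), D.unit k h ∈ (T.pathHom k).range := by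
    have harrow : ∀ a, D.unit k (T.lt a) ∈ (T.pathHom k).range := fun a => by
      refine ⟨PathAlgebra.ofPath k ⟨Q.t a, Q.s a, [a], rfl, rfl⟩, ?_⟩
      change T.pathHom k _ = _
      rw [pathHom_ofPath]
      simp only [pathElt, List.map_cons, List.map_nil, List.prod_cons, List.prod_nil, mul_one,
        idem_mul_arrowElt]
      rfl
    intro p r h
    have h' := (T.lt_iff p r).1 h
    induction h' with
    | single h' =>
      obtain ⟨a, rfl, rfl⟩ := h'
      exact harrow a
    | tail h₁ h₂ ih =>
      obtain ⟨a, rfl, rfl⟩ := h₂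
      have h₀ := (T.lt_iff _ _).2 h₁
      convert mul_mem (harrow a) (ih h₀)
      refine Threads.mat_injective ?_
      rw [map_mul, Threads.unit_val, Threads.unit_val, Threads.unit_val,
        Matrix.single_mul_single_same, mul_one]
  classical
  have hM : M = ∑ x, Threads.mat M (x, false) (x, false) • D.idem k x +
      ∑ p, ∑ r, if h : D.lt p r then Threads.mat M r p • D.unit k h else 0 := by
    refine Threads.ext_mat fun r s => ?_
    rw [map_add, Matrix.add_apply, map_sum, Matrix.sum_apply, map_sum, Matrix.sum_apply]
    simp only [map_sum, Matrix.sum_apply, map_smul, Matrix.smul_apply, Threads.idem_val,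
      smul_eq_mul]
    have h₂ : ∀ p t, Threads.mat (if h : D.lt p t then Threads.mat M t p • D.unit k h else 0) r s =
        if p = s ∧ t = r ∧ D.lt s r then Threads.mat M r s else 0 := by
      intro p t
      split_ifs with h h' h'
      · obtain ⟨rfl, rfl, -⟩ := h'
        rw [map_smul, Threads.unit_val, Matrix.smul_apply, Matrix.single_apply_same, smul_eq_mul,
          mul_one]
      · rw [map_smul, Threads.unit_val, Matrix.smul_apply, Matrix.single_apply_of_ne, smul_zero]
        rintro ⟨rfl, rfl⟩
        exact h' ⟨rfl, rfl, h⟩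
      · obtain ⟨rfl, rfl, h'⟩ := h'
        exact absurd h' h
      · rw [map_zero, Matrix.zero_apply]
    simp only [h₂]
    rw [Finset.sum_eq_single r.1, Finset.sum_eq_single s, Finset.sum_eq_single r]
    · by_cases hrs : r = s
      · subst hrs
        rw [Matrix.diagonal_apply_eq, if_pos rfl, mul_one, if_neg fun e => D.irrefl _ e.2.2,
          add_zero]
        exact D.diag_eq M r.1 r.2 false
      · rw [Matrix.diagonal_apply_ne _ hrs, mul_zero, zero_add]
        split_ifs with h
        · rfl
        · exact Threads.zero_of M hrs fun e => h ⟨rfl, rfl, e⟩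
    · exact fun t _ ht => if_neg fun e => ht e.2.1
    · simp
    · exact fun t _ ht => Finset.sum_eq_zero fun t' _ => if_neg fun e => ht e.1
    · simp
    · intro x _ hx
      rw [Matrix.diagonal_apply]
      simp [hx.symm]
    · simp
  rw [hM]
  refine add_mem (sum_mem fun x _ => Subalgebra.smul_mem _ (hidem x) _)
    (sum_mem fun p _ => sum_mem fun r _ => ?_)
  split_ifs with h
  · exact Subalgebra.smul_mem _ (hunit p r h) _
  · exact zero_mem _

open Classical in
/-- The class of the path that runs along the thread from `s` to `r`. -/
noncomputable def chainClass (r s : V × Bool) : BoundQuiverAlgebra k R :=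
  if h : ∃ p : Q.Path, p.arrows ≠ [] ∧ T.Chain r p.arrows s then
    RingCon.mkₐ k _ (PathAlgebra.ofPath k h.choose) else 0

theorem chainClass_eq {r s : V × Bool} {p : Q.Path} (hp : p.arrows ≠ [])
    (h : T.Chain r p.arrows s) :
    T.chainClass k r s = RingCon.mkₐ k (relIdeal k R).ringCon (PathAlgebra.ofPath k p) := by
  have hex : ∃ p : Q.Path, p.arrows ≠ [] ∧ T.Chain r p.arrows s := ⟨p, hp, h⟩
  rw [chainClass, dif_pos hex, Path.ext_arrows hp (h.unique hex.choose_spec.2)]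

theorem chainClass_self (r : V × Bool) : T.chainClass k r r = 0 := by
  rw [chainClass, dif_neg]
  rintro ⟨p, hp, h⟩
  rcases h.eq_or_lt with h | h
  · exact hp h.1
  · exact D.irrefl _ h

/-- The inverse of the homomorphism from the bound quiver algebra to the thread algebra. -/
noncomputable def retraction : D.algebra k →ₗ[k] BoundQuiverAlgebra k R where
  toFun M := ∑ x, Threads.mat M (T.vertex x, false) (T.vertex x, false) •
      RingCon.mkₐ k (relIdeal k R).ringCon (PathAlgebra.ofPath k (Path.trivial x)) +
    ∑ r, ∑ s, Threads.mat M r s • T.chainClass k r s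
  map_add' M N := by
    simp only [map_add, Matrix.add_apply, add_smul, Finset.sum_add_distrib]
    abel
  map_smul' c M := by
    simp only [map_smul, Matrix.smul_apply, smul_assoc, RingHom.id_apply, smul_add,
      Finset.smul_sum]

theorem mat_prod {r s : V × Bool} {l : List Q.A} (hl : l ≠ []) (h : T.Chain r l s) :
    Threads.mat (l.map (T.arrowElt k)).prod = Matrix.single r s 1 := by
  induction l generalizing r with
  | nil => exact absurd rfl hl
  | cons a l ih =>
    obtain ⟨rfl, h⟩ := h
    rw [List.map_cons, List.prod_cons, map_mul]
    rcases l with _ | ⟨b, l⟩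
    · obtain rfl : T.tail a = s := h
      rw [List.map_nil, List.prod_nil, map_one, mul_one, arrowElt, Threads.unit_val]
    · rw [ih (List.cons_ne_nil _ _) h, arrowElt, Threads.unit_val, Matrix.single_mul_single_same,
        mul_one]

/-- There are three kinds of paths. Trivial paths correspond to idempotents, thread segments to
single matrix units, and a path containing a relation is zero on both sides. -/
theorem retraction_pathElt (p : Q.Path) : T.retraction k (T.pathElt k p) =
    RingCon.mkₐ k (relIdeal k R).ringCon (PathAlgebra.ofPath k p) := by
  change ∑ x, Threads.mat (T.pathElt k p) (T.vertex x, false) (T.vertex x, false) •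
      RingCon.mkₐ k (relIdeal k R).ringCon (PathAlgebra.ofPath k (Path.trivial x)) +
    ∑ r, ∑ s, Threads.mat (T.pathElt k p) r s • T.chainClass k r s = _
  rcases hp : p.arrows with _ | ⟨a, l⟩
  · obtain ⟨x, y, l, hw⟩ := p
    obtain rfl : l = [] := hp
    obtain rfl : x = y := hw
    have h0 : ∀ r s, Threads.mat (D.idem k (T.vertex x)) r s • T.chainClass k r s = 0 := by
      intro r s
      by_cases hrs : r = s
      · rw [hrs, chainClass_self, smul_zero]
      · rw [Threads.idem_val, Matrix.diagonal_apply_ne _ hrs, zero_smul]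
    simp only [pathElt, List.map_nil, List.prod_nil, mul_one, h0, Finset.sum_const_zero, add_zero]
    rw [Finset.sum_eq_single x]
    · rw [Threads.idem_val, Matrix.diagonal_apply_eq, if_pos rfl, one_smul]
      rfl
    · intro y _ hy
      rw [Threads.idem_val, Matrix.diagonal_apply_eq, if_neg fun e => hy (T.vertex.injective e),
        zero_smul]
    · simp
  · have hw := p.isWalk
    rw [hp] at hw
    rcases T.chain_or_rel hw with ⟨s, hs⟩ | ⟨l₁, b, c, l₂, hl, hr⟩
    · have hm : Threads.mat (T.pathElt k p) = Matrix.single (T.head a) s 1 := by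
        unfold pathElt
        rw [hp, List.map_cons, List.prod_cons, ← mul_assoc, ← hw.1, idem_mul_arrowElt,
          ← List.prod_cons, ← List.map_cons, T.mat_prod k (List.cons_ne_nil _ _) hs]
      have hne : T.head a ≠ s := fun e =>
        D.irrefl _ (e ▸ hs.eq_or_lt.resolve_left fun h => List.cons_ne_nil _ _ h.1)
      rw [hm, Finset.sum_eq_zero, zero_add, Finset.sum_eq_single (T.head a),
        Finset.sum_eq_single s]
      · rw [Matrix.single_apply_same, one_smul]
        exact T.chainClass_eq k (by simp [hp]) (hp ▸ hs)
      · intro t _ ht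
        rw [Matrix.single_apply_of_ne _ _ _ _ _ fun e => ht e.2.symm, zero_smul]
      · simp
      · intro t _ ht
        refine Finset.sum_eq_zero fun t' _ => ?_
        rw [Matrix.single_apply_of_ne _ _ _ _ _ fun e => ht e.1.symm, zero_smul]
      · simp
      · intro x _
        rw [Matrix.single_apply_of_ne _ _ _ _ _ fun e => hne (e.1.trans e.2.symm), zero_smul]
    · have h0 : RingCon.mkₐ k (relIdeal k R).ringCon (PathAlgebra.ofPath k p) = 0 :=
        (RingCon.eq _).2 ((TwoSidedIdeal.rel_iff _ _ _).2
          (by rw [sub_zero]; exact ofPath_mem_relIdeal k (hp.trans hl) hr))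
      have h1 : T.pathElt k p = 0 := by
        rw [← pathHom_ofPath]
        change T.quotientHom k (RingCon.mkₐ k _ (PathAlgebra.ofPath k p)) = 0
        rw [h0, map_zero]
      simp only [h0, h1, map_zero, Matrix.zero_apply, zero_smul, Finset.sum_const_zero, add_zero]

/-- This gives injectivity of the comparison map; no dimension of the bound quiver algebra is
needed. -/
theorem retraction_quotientHom (x : BoundQuiverAlgebra k R) :
    T.retraction k (T.quotientHom k x) = x := by
  obtain ⟨y, rfl⟩ := RingCon.mkₐ_surjective (α := k) _ x
  change (T.retraction k ∘ₗ (T.pathHom k).toLinearMap) y =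
    (RingCon.mkₐ k (relIdeal k R).ringCon).toLinearMap y
  congr 1
  refine (PathAlgebra.basis k).ext fun p => ?_
  change T.retraction k (T.pathHom k (PathAlgebra.ofPath k p)) = _
  rw [pathHom_ofPath, retraction_pathElt]
  rfl

/-- The bound quiver algebra is isomorphic to the thread algebra. -/
noncomputable def algEquiv : BoundQuiverAlgebra k R ≃ₐ[k] D.algebra k :=
  AlgEquiv.ofBijective (T.quotientHom k)
    ⟨Function.LeftInverse.injective (T.retraction_quotientHom k), fun M => by
      obtain ⟨y, hy⟩ := T.mem_range_pathHom k M
      exact ⟨RingCon.mkₐ k _ y, hy⟩⟩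

end ThreadData

end FinQuiver

/-! ### Lists of positions on paths -/

section PathVertex

variable {V W : Type}

theorem pathVertex_map (g : V → W) (p : ℕ) (a b : V) (w : Fin (p - 1) → V) (j : ℕ) :
    g (pathVertex p a b w j) = pathVertex p (g a) (g b) (fun i => g (w i)) j := by
  unfold pathVertex
  split_ifs <;> rfl

theorem pathVertex_zero (p : ℕ) (a b : V) (w : Fin (p - 1) → V) : pathVertex p a b w 0 = a := rfl

theorem pathVertex_self {p : ℕ} (hp : 0 < p) (a b : V) (w : Fin (p - 1) → V) :
    pathVertex p a b w p = b := by
  unfold pathVertex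
  rw [dif_neg hp.ne', dif_neg (lt_irrefl p)]

theorem pathVertex_succ {p : ℕ} (a b : V) (w : Fin (p - 1) → V) (j : Fin (p - 1)) :
    pathVertex p a b w (j + 1) = w j := by
  unfold pathVertex
  rw [dif_neg (Nat.succ_ne_zero _), dif_pos (by omega)]
  rfl

theorem pathVertex_shift (n : ℕ) (a b : V) (w : Fin (n + 1) → V) (i : ℕ) :
    pathVertex (n + 2) a b w (i + 1) = pathVertex (n + 1) (w 0) b (fun j => w j.succ) i := by
  unfold pathVertex
  rw [dif_neg (Nat.succ_ne_zero _)]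
  rcases i with _ | i
  · rw [dif_pos (by omega), dif_pos rfl]
    rfl
  · rw [dif_neg (Nat.succ_ne_zero _)]
    by_cases h : i + 1 < n + 1
    · rw [dif_pos (by omega), dif_pos h]
      rfl
    · rw [dif_neg (by omega), dif_neg h]

theorem pathVertex_congr {p : ℕ} (a a' b : V) (w : Fin (p - 1) → V) (i : ℕ) :
    pathVertex p a b w (i + 1) = pathVertex p a' b w (i + 1) := by
  unfold pathVertex
  rw [dif_neg (Nat.succ_ne_zero _), dif_neg (Nat.succ_ne_zero _)]

/-- The source of an arrow of a path is the first vertex or an inner vertex. -/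
theorem pathVertex_source {p : ℕ} (i : Fin p) :
    ((i : ℕ) + 1 = p ∧ ∀ {V : Type} (a b : V) w, pathVertex p a b w (i + 1) = b) ∨
      ∃ j : Fin (p - 1), (j : ℕ) = i ∧ ∀ {V : Type} (a b : V) w, pathVertex p a b w (i + 1) = w j := by
  by_cases h : (i : ℕ) + 1 = p
  · refine Or.inl ⟨h, fun a b w => ?_⟩
    unfold pathVertex
    rw [dif_neg (Nat.succ_ne_zero _), dif_neg (by omega)]
  · exact Or.inr ⟨⟨i, by omega⟩, rfl, fun a b w => pathVertex_succ a b w ⟨i, by omega⟩⟩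

/-- The target of an arrow of a path is the last vertex or an inner vertex. -/
theorem pathVertex_target {p : ℕ} (i : Fin p) :
    ((i : ℕ) = 0 ∧ ∀ {V : Type} (a b : V) w, pathVertex p a b w i = a) ∨
      ∃ j : Fin (p - 1), (j : ℕ) + 1 = i ∧ ∀ {V : Type} (a b : V) w, pathVertex p a b w i = w j := by
  obtain ⟨i, hi⟩ := i
  rcases i with _ | i
  · exact Or.inl ⟨rfl, fun a b w => rfl⟩
  · exact Or.inr ⟨⟨i, by omega⟩, rfl, fun a b w => pathVertex_succ a b w ⟨i, by omega⟩⟩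

theorem pathVertex_injective {p : ℕ} (hp : 0 < p) {a b : V} {w : Fin (p - 1) → V}
    (hw : Function.Injective w) (hab : a ≠ b) (ha : ∀ j, w j ≠ a) (hb : ∀ j, w j ≠ b) :
    Function.Injective fun i : Fin (p + 1) => pathVertex p a b w i := by
  have hcase : ∀ i : Fin (p + 1), ((i : ℕ) = 0 ∧ pathVertex p a b w i = a) ∨
      ((i : ℕ) = p ∧ pathVertex p a b w i = b) ∨
      ∃ j : Fin (p - 1), (j : ℕ) + 1 = i ∧ pathVertex p a b w i = w j := by
    intro i
    by_cases h : (i : ℕ) = p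
    · exact Or.inr (Or.inl ⟨h, by rw [h, pathVertex_self hp]⟩)
    · rcases pathVertex_target (⟨i, by omega⟩ : Fin p) with ⟨h₁, h₂⟩ | ⟨j, h₁, h₂⟩
      · exact Or.inl ⟨h₁, h₂ a b w⟩
      · exact Or.inr (Or.inr ⟨j, h₁, h₂ a b w⟩)
  intro i j hij
  dsimp only at hij
  rcases hcase i with ⟨h₁, h₂⟩ | ⟨h₁, h₂⟩ | ⟨m, h₁, h₂⟩ <;>
    rcases hcase j with ⟨h₁', h₂'⟩ | ⟨h₁', h₂'⟩ | ⟨m', h₁', h₂'⟩ <;> rw [h₂, h₂'] at hij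
  · exact Fin.ext (h₁.trans h₁'.symm)
  · exact absurd hij hab
  · exact absurd hij.symm (ha _)
  · exact absurd hij.symm hab
  · exact Fin.ext (h₁.trans h₁'.symm)
  · exact absurd hij.symm (hb _)
  · exact absurd hij (ha _)
  · exact absurd hij (hb _)
  · exact Fin.ext (by rw [← h₁, ← h₁', hw hij])

end PathVertex

namespace Threads

open ThreadList

/-! ### Adjacent positions along one path. -/

section Segment

variable {V : Type}

/-- The position at which the arrow that starts at an inner vertex of a path begins. -/
def out (x : (V × Bool) × Bool) : V × Bool := if x.2 then other x.1 else x.1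

theorem out_fst (x : (V × Bool) × Bool) : (out x).1 = x.1.1 := by
  unfold out
  split_ifs <;> rfl

theorem ne_out_iff (x : (V × Bool) × Bool) : x.1 ≠ out x ↔ x.2 = true := by
  unfold out
  split_ifs with h
  · simp [h, (other_ne x.1).symm]
  · simp [h]

/-- An arrow ends at the first position of an inner vertex and starts at `out`, the second position
if the vertex is marked, so arrows are exactly adjacent entries. The word is reversed since arrows
are numbered from the end of the path, while the list runs from its start. -/
theorem adj_segment {p : ℕ} (hp : 0 < p) (s e : V × Bool)
    (f : Fin (p - 1) → (V × Bool) × Bool) (x y : V × Bool) :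
    adj (some s :: (enc (List.ofFn f).reverse ++ [some e])) x y ↔
      ∃ i : Fin p, pathVertex p e s (fun j => out (f j)) (i + 1) = x ∧
        pathVertex p e s (fun j => (f j).1) i = y := by
  obtain ⟨n, rfl⟩ : ∃ n, p = n + 1 := ⟨p - 1, by omega⟩
  change Fin n → _ at f
  clear hp
  induction n generalizing e with
  | zero =>
    rw [Fin.exists_fin_one]
    simp only [List.ofFn_zero, List.reverse_nil, enc, List.nil_append, adj, List.head?_cons,
      List.head?_nil, Option.some.injEq, reduceCtorEq, and_false, or_false]
    exact and_congr ⟨Eq.symm, Eq.symm⟩ Iff.rfl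
  | succ n ih =>
    have h₁ : adj (some s :: (enc (List.ofFn f).reverse ++ [some e])) x y ↔
        adj (some s :: (enc (List.ofFn fun j => f j.succ).reverse ++ [some (f 0).1])) x y ∨
          (out (f 0) = x ∧ e = y) := by
      rw [List.ofFn_succ, List.reverse_cons, enc_append]
      obtain ⟨z, b⟩ := f 0
      have h₂ := adj_append (some s :: enc (List.ofFn fun j => f j.succ).reverse)
      simp only [List.cons_append] at h₂
      cases b <;> simp only [enc, List.append_assoc, List.cons_append, List.nil_append] <;>
        rw [h₂] <;> simp [adj, out, eq_comm]
    rw [h₁, ih _ fun j : Fin n => f j.succ, Fin.exists_fin_succ (n := n + 1), or_comm]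
    refine or_congr ?_ (exists_congr fun i => ?_)
    · rw [Fin.val_zero, pathVertex_zero, pathVertex_shift, pathVertex_zero]
    · rw [Fin.val_succ, pathVertex_shift, pathVertex_shift, pathVertex_congr (out (f 0)) (f 0).1]

theorem reduceOption_enc_nodup {w : List ((V × Bool) × Bool)}
    (h : (w.map fun x => x.1.1).Nodup) : (enc w).reduceOption.Nodup := by
  induction w with
  | nil => simp [enc]
  | cons x w ih =>
    obtain ⟨x, b⟩ := x
    rw [List.map_cons, List.nodup_cons] at h
    have h₁ : ∀ p : V × Bool, p.1 = x.1 → some p ∉ enc w := fun p hp e =>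
      h.1 (by rw [← hp]; exact mem_enc e)
    cases b
    · simp only [enc, List.reduceOption_cons_of_some, List.nodup_cons, List.reduceOption_mem_iff]
      exact ⟨h₁ x rfl, ih h.2⟩
    · simp only [enc, List.reduceOption_cons_of_some, List.reduceOption_cons_of_none,
        List.nodup_cons, List.reduceOption_mem_iff, List.mem_cons, not_or]
      exact ⟨⟨(other_ne x).symm, h₁ x rfl⟩, h₁ _ rfl, ih h.2⟩

theorem State.list_nodup {S : State V} (h : S.verts.Nodup) : S.list.reduceOption.Nodup := by
  obtain ⟨v, u, a, b, c⟩ := S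
  have ha := @reduceOption_enc_nodup V a
  have hb := @reduceOption_enc_nodup V b
  have hc := @reduceOption_enc_nodup V c
  have ha' := @mem_enc V a
  have hb' := @mem_enc V b
  have hc' := @mem_enc V c
  simp only [verts, list, List.map_append, List.nodup_cons, List.nodup_append, List.mem_cons,
    List.mem_append, not_or, List.reduceOption_append, List.reduceOption_cons_of_some,
    List.reduceOption_mem_iff, List.reduceOption_nil, List.not_mem_nil, or_false,
    List.nodup_nil] at h ⊢
  have hv := other_ne v
  have hu := other_ne u
  have huv : ∀ {p q : V × Bool}, p = q → p.1 = q.1 := fun e => congrArg Prod.fst e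
  have hv' := other_fst v
  have hu' := other_fst u
  grind

/-- The list is cut at `u` and at `other v`, into the parts for `γ`, `β` and `α`. -/
theorem State.adj_list (S : State V) (x y : V × Bool) : adj S.list x y ↔
    adj (some S.v :: (enc S.c ++ [some S.u])) x y ∨
    adj (some S.u :: (enc S.b ++ [some (other S.v)])) x y ∨
    adj (some (other S.v) :: (enc S.a ++ [some (other S.u)])) x y := by
  have h₁ := adj_append (some S.v :: enc S.c) (enc S.b ++ some (other S.v) ::
    (enc S.a ++ [some (other S.u)])) S.u x y
  have h₂ := adj_append (some S.u :: enc S.b) (enc S.a ++ [some (other S.u)]) (other S.v) x y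
  simp only [List.cons_append] at h₁ h₂
  rw [State.list, h₁, h₂]

end Segment

end Threads

/-! ### Presentations of the algebras `Λ₀(p, r)` -/

/-- Take `v` as vertex `0` and `u` as vertex `p`. The word `b` gives the long path from `p` to `0`,
the step from `v` to `u` is the arrow `γ`, and the step from `other v` to `other u` is `β`. The
marked letters come last in `b`, next to vertex `0`, which is where the relations between
consecutive `αᵢ` lie. -/
theorem exists_lambda0_threadData {V : Type} {D : Threads V} (v u : V × Bool)
    (b : List ((V × Bool) × Bool)) (s r : ℕ)
    (hb : b.map Prod.snd = List.replicate s false ++ List.replicate r true)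
    (hn : (Threads.State.verts ⟨v, u, [], b, []⟩).Nodup)
    (hmem : ∀ x, x ∈ Threads.State.verts ⟨v, u, [], b, []⟩)
    (hD : D.HasList (Threads.State.list ⟨v, u, [], b, []⟩)) :
    ∃ p r : ℕ, 1 ≤ p ∧ r ≤ p - 1 ∧
      Nonempty (FinQuiver.ThreadData (Lambda0Relations p r) D) := by
  have hlen : b.length = s + r := by
    have := congrArg List.length hb
    simpa using this
  -- The letters of `b` are the `p - 1` inner vertices of the long path.
  obtain ⟨p, hp⟩ : ∃ p, p = b.length + 1 := ⟨_, rfl⟩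
  have hp0 : 0 < p := by omega
  obtain ⟨f, hf⟩ : ∃ f : Fin (p - 1) → (V × Bool) × Bool, (List.ofFn f).reverse = b := by
    subst hp
    exact ⟨fun i : Fin b.length => b.reverse[i]'(by simp), by
      rw [List.reverse_eq_iff]
      refine List.ext_getElem (by simp) fun i h₁ h₂ => ?_
      simp⟩
  -- Numbering from vertex `0` reverses `b`, so the `r` marked letters come first.
  have hbit : ∀ i : Fin (p - 1), (f i).2 = true ↔ (i : ℕ) < r := by
    intro i
    have h₁ : List.ofFn (fun i => (f i).2) = List.replicate r true ++ List.replicate s false := by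
      have h₂ := congrArg List.reverse hb
      rw [← hf, List.map_reverse, List.reverse_reverse, List.map_ofFn] at h₂
      rw [show (fun i => (f i).2) = Prod.snd ∘ f from rfl, h₂]
      simp
    have h₃ : (List.replicate r true ++ List.replicate s false)[(i : ℕ)]'(by
        have := i.2; simp; omega) = (f i).2 := by
      simp only [← h₁, List.getElem_ofFn]
    rw [← h₃, List.getElem_append]
    split_ifs with h
    · simpa using h
    · simpa using h
  have hverts : Threads.State.verts ⟨v, u, [], b, []⟩ =
      v.1 :: u.1 :: (List.ofFn fun i => (f i).1.1).reverse := by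
    simp only [Threads.State.verts, List.nil_append, List.append_nil, ← hf, List.map_reverse,
      List.map_ofFn]
    rfl
  rw [hverts, List.nodup_cons, List.nodup_cons, List.nodup_reverse, List.nodup_ofFn] at hn
  simp only [List.mem_cons, List.mem_reverse, List.mem_ofFn, not_or, not_exists] at hn
  simp only [hverts, List.mem_cons, List.mem_reverse, List.mem_ofFn] at hmem
  obtain ⟨⟨hvu, hv⟩, hu, hinj⟩ := hn
  let vert : Fin (p + 1) → V := fun i => pathVertex p v.1 u.1 (fun j => (f j).1.1) i
  have hvert : Function.Bijective vert := by
    refine ⟨pathVertex_injective hp0 hinj hvu hv hu, fun x => ?_⟩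
    rcases hmem x with rfl | rfl | ⟨j, rfl⟩
    · exact ⟨0, rfl⟩
    · exact ⟨Fin.last p, pathVertex_self hp0 _ _ _⟩
    · exact ⟨⟨j + 1, by omega⟩, pathVertex_succ _ _ _ j⟩
  let tail : Fin p ⊕ Bool → V × Bool := Sum.elim
    (fun i => pathVertex p (other v) u (fun j => Threads.out (f j)) (i + 1))
    (fun c => if c then v else other v)
  let head : Fin p ⊕ Bool → V × Bool := Sum.elim
    (fun i => pathVertex p (other v) u (fun j => (f j).1) i)
    (fun c => if c then u else other u)
  have hadj : ∀ x y, ThreadList.adj (Threads.State.list ⟨v, u, [], b, []⟩) x y ↔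
      ∃ a, tail a = x ∧ head a = y := by
    intro x y
    rw [Threads.State.adj_list, Sum.exists]
    dsimp only
    rw [← hf, Threads.adj_segment hp0, Bool.exists_bool]
    simp only [Threads.enc, List.nil_append, ThreadList.adj, List.head?_cons, List.head?_nil,
      Option.some.injEq, reduceCtorEq, and_false, or_false, tail, head, Sum.elim_inl, Sum.elim_inr,
      if_true, Bool.false_eq_true, if_false]
    rw [eq_comm (a := x), eq_comm (a := x)]
    exact or_comm.trans or_assoc
  have hne : ∀ {x y : V × Bool}, x.1 ≠ y.1 → x ≠ y := fun h e => h (by rw [e])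
  have hov := other_ne v
  have hou := other_ne u
  refine ⟨p, r, hp0, by omega, ⟨⟨Equiv.ofBijective vert hvert, tail, head, ?_, ?_, ?_, ?_, ?_, ?_⟩⟩⟩
  · rintro (i | c)
    · refine (pathVertex_map Prod.fst p (other v) u (fun j => Threads.out (f j)) (i + 1)).trans ?_
      simp only [Threads.out_fst]
      rfl
    · change (if c then v else other v).1 = v.1
      split_ifs <;> rfl
  · rintro (i | c)
    · exact pathVertex_map Prod.fst p (other v) u (fun j => (f j).1) i
    · refine Eq.trans ?_ (pathVertex_self hp0 v.1 u.1 fun j => (f j).1.1).symm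
      change (if c then u else other u).1 = u.1
      split_ifs <;> rfl
  · have h₁ : ∀ (i : Fin p) (c : Bool), head (.inl i) ≠ head (.inr c) := by
      intro i c
      refine hne ?_
      have h₃ : (head (.inr c)).1 = u.1 := by
        simp only [head, Sum.elim_inr]
        split_ifs <;> rfl
      rw [h₃]
      simp only [head, Sum.elim_inl]
      rcases pathVertex_target i with ⟨-, h₂⟩ | ⟨j, -, h₂⟩
      · rw [h₂]
        exact hvu
      · rw [h₂]
        exact hu j
    rintro (i | c) (i' | c') h
    · simp only [head, Sum.elim_inl] at h
      rcases pathVertex_target i with ⟨h₀, h₂⟩ | ⟨j, h₀, h₂⟩ <;>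
        rcases pathVertex_target i' with ⟨h₀', h₂'⟩ | ⟨j', h₀', h₂'⟩ <;>
        rw [h₂, h₂'] at h
      · exact congrArg _ (Fin.ext (by omega))
      · exact absurd (congrArg Prod.fst h).symm (hv j')
      · exact absurd (congrArg Prod.fst h) (hv j)
      · rw [hinj (congrArg Prod.fst h)] at h₀
        exact congrArg _ (Fin.ext (by omega))
    · exact absurd h (h₁ _ _)
    · exact absurd h.symm (h₁ _ _)
    · cases c <;> cases c'
      · rfl
      · exact absurd h hou
      · exact absurd h.symm hou
      · rfl
  · intro x y
    rw [hD.lt_iff, ThreadList.before_iff_transGen hD.nodup]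
    have : ThreadList.adj (Threads.State.list ⟨v, u, [], b, []⟩) =
        fun x y => ∃ a, tail a = x ∧ head a = y := by
      funext x y
      exact propext (hadj x y)
    rw [this]
    rfl
  · rintro ρ (⟨i, -, h⟩ | ⟨i, j, -, -, h⟩ | ⟨i, -, h⟩) <;>
      rw [FinQuiver.Path.length, h] <;> rfl
  · have hrel : ∀ a b : (Lambda0Quiver p).A, (Lambda0Quiver p).s a = (Lambda0Quiver p).t b →
        (FinQuiver.RelMem (Lambda0Relations p r) a b ↔
        (∃ i : Fin p, (i : ℕ) + 1 = p ∧ a = Sum.inl i ∧ b = Sum.inr false) ∨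
        (∃ i j : Fin p, (j : ℕ) = i + 1 ∧ (i : ℕ) < r ∧ a = Sum.inl i ∧ b = Sum.inl j) ∨
        (∃ i : Fin p, (i : ℕ) = 0 ∧ a = Sum.inr true ∧ b = Sum.inl i)) := by
      intro a b hab
      constructor
      · rintro ⟨ρ, hρ, h⟩
        refine hρ.imp ?_ (Or.imp ?_ ?_)
        · rintro ⟨i, h₁, h₂⟩
          rw [h] at h₂
          exact ⟨i, h₁, (List.cons.inj h₂).1, (List.cons.inj (List.cons.inj h₂).2).1⟩
        · rintro ⟨i, j, h₀, h₁, h₂⟩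
          rw [h] at h₂
          exact ⟨i, j, h₀, h₁, (List.cons.inj h₂).1, (List.cons.inj (List.cons.inj h₂).2).1⟩
        · rintro ⟨i, h₁, h₂⟩
          rw [h] at h₂
          exact ⟨i, h₁, (List.cons.inj h₂).1, (List.cons.inj (List.cons.inj h₂).2).1⟩
      · intro h
        refine ⟨⟨(Lambda0Quiver p).t a, (Lambda0Quiver p).s b, [a, b], rfl, hab.symm, rfl⟩,
          h.imp ?_ (Or.imp ?_ ?_), rfl⟩
        · rintro ⟨i, h₁, rfl, rfl⟩
          exact ⟨i, h₁, rfl⟩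
        · rintro ⟨i, j, h₀, h₁, rfl, rfl⟩
          exact ⟨i, j, h₀, h₁, rfl⟩
        · rintro ⟨i, h₁, rfl, rfl⟩
          exact ⟨i, h₁, rfl⟩
    intro a b hab
    rw [hrel a b hab]
    rcases a with i | c <;> rcases b with i' | c'
    · have hij : (i : ℕ) + 1 = i' := congrArg Fin.val hab
      obtain ⟨j, hj⟩ : ∃ j : Fin (p - 1), (j : ℕ) = i := ⟨⟨i, by omega⟩, rfl⟩
      have h₁ : tail (.inl i) = Threads.out (f j) := by
        simp only [tail, Sum.elim_inl, ← hj]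
        exact pathVertex_succ _ _ _ j
      have h₂ : head (.inl i') = (f j).1 := by
        simp only [head, Sum.elim_inl, ← hij, ← hj]
        exact pathVertex_succ _ _ _ j
      rw [h₁, h₂, Threads.ne_out_iff, hbit, hj]
      constructor
      · rintro (⟨i₀, -, -, h₃⟩ | ⟨i₀, j₀, -, h₃, h₄, -⟩ | ⟨i₀, -, h₃, -⟩)
        · exact absurd h₃ Sum.inl_ne_inr
        · rw [Sum.inl.inj h₄]
          exact h₃
        · exact absurd h₃ Sum.inl_ne_inr
      · exact fun h => Or.inr (Or.inl ⟨i, i', hij.symm, h, rfl, rfl⟩)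
    · have hi : (i : ℕ) + 1 = p := congrArg Fin.val hab
      have h₁ : tail (.inl i) = u := by
        rcases pathVertex_source i with ⟨-, h₂⟩ | ⟨j, h₂, -⟩
        · exact h₂ (other v) u fun j => Threads.out (f j)
        · omega
      rw [h₁]
      cases c'
      · refine iff_of_true (Or.inl ⟨i, hi, rfl, rfl⟩) ?_
        exact hou
      · refine iff_of_false ?_ fun h => h rfl
        rintro (⟨i₀, -, -, h₃⟩ | ⟨i₀, j₀, -, -, -, h₃⟩ | ⟨i₀, -, h₃, -⟩)
        · exact Bool.noConfusion (Sum.inr.inj h₃)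
        · exact absurd h₃ Sum.inr_ne_inl
        · exact absurd h₃ Sum.inl_ne_inr
    · have hi : (i' : ℕ) = 0 := (congrArg Fin.val hab).symm
      have h₁ : head (.inl i') = other v := by
        simp only [head, Sum.elim_inl, hi]
        rfl
      rw [h₁]
      cases c
      · refine iff_of_false ?_ fun h => h rfl
        rintro (⟨i₀, -, h₃, -⟩ | ⟨i₀, j₀, -, -, h₃, -⟩ | ⟨i₀, -, h₃, -⟩)
        · exact absurd h₃ Sum.inr_ne_inl
        · exact absurd h₃ Sum.inr_ne_inl
        · exact Bool.noConfusion (Sum.inr.inj h₃)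
      · refine iff_of_true (Or.inr (Or.inr ⟨i', hi, rfl, rfl⟩)) ?_
        exact hov
    · have h₀ : 0 = p := congrArg Fin.val hab
      omega

/-! ### Presentations of the bound quiver algebras of the quiver made of three paths -/

section ThreePath

open Classical in
/-- The inner vertices of a path, marked by whether there is a relation at the vertex. -/
noncomputable def pathWord {Q : FinQuiver} (R : Set Q.Path) {p : ℕ} (arrow : Fin p → Q.A)
    (inner : Fin (p - 1) → Q.V) (j : Fin (p - 1)) : (Q.V × Bool) × Bool :=
  ((inner j, false), decide (FinQuiver.RelMem R (arrow ⟨j, by omega⟩) (arrow ⟨j + 1, by omega⟩)))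

theorem pathWord_ne_out_iff {Q : FinQuiver} (R : Set Q.Path) {p : ℕ} (arrow : Fin p → Q.A)
    (inner : Fin (p - 1) → Q.V) (e s : Q.V × Bool) {i i' : Fin p} (h : (i : ℕ) + 1 = i') :
    FinQuiver.RelMem R (arrow i) (arrow i') ↔
      pathVertex p e s (fun j => (pathWord R arrow inner j).1) i' ≠
        pathVertex p e s (fun j => Threads.out (pathWord R arrow inner j)) (i + 1) := by
  obtain ⟨i, hi⟩ := i
  obtain ⟨i', hi'⟩ := i'
  obtain rfl : i + 1 = i' := h
  have hw := pathVertex_succ e s (fun j => (pathWord R arrow inner j).1) ⟨i, by omega⟩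
  have ho := pathVertex_succ e s (fun j => Threads.out (pathWord R arrow inner j)) ⟨i, by omega⟩
  dsimp only at hw ho ⊢
  rw [hw, ho, Threads.ne_out_iff]
  exact (@decide_eq_true_iff _ (Classical.propDecidable _)).symm

variable {p₁ p₂ p₃ : ℕ} (R : Set (threePathQuiver p₁ p₂ p₃).Path)

/-- The word of the path `α₁ ⋯ α_{p₁}`. -/
noncomputable def wordα : Fin (p₁ - 1) → (ThreePathVertex p₁ p₂ p₃ × Bool) × Bool :=
  pathWord R (ThreePathArrow.α (p₁ := p₁) (p₂ := p₂) (p₃ := p₃)) ThreePathVertex.x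

/-- The word of the path `β₁ ⋯ β_{p₂}`. -/
noncomputable def wordβ : Fin (p₂ - 1) → (ThreePathVertex p₁ p₂ p₃ × Bool) × Bool :=
  pathWord R (ThreePathArrow.β (p₁ := p₁) (p₂ := p₂) (p₃ := p₃)) ThreePathVertex.y

/-- The word of the path `γ₁ ⋯ γ_{p₃}`. -/
noncomputable def wordγ : Fin (p₃ - 1) → (ThreePathVertex p₁ p₂ p₃ × Bool) × Bool :=
  pathWord R (ThreePathArrow.γ (p₁ := p₁) (p₂ := p₂) (p₃ := p₃)) ThreePathVertex.z

/-- The state given by a set of relations on the quiver made of three paths. -/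
noncomputable def threePathState : Threads.State (ThreePathVertex p₁ p₂ p₃) where
  v := (.v, false)
  u := (.u, false)
  a := (List.ofFn (wordα R)).reverse
  b := (List.ofFn (wordβ R)).reverse
  c := (List.ofFn (wordγ R)).reverse

theorem threePathState_verts : (threePathState R).verts =
    .v :: .u :: ((List.ofFn .x).reverse ++ (List.ofFn .y).reverse ++ (List.ofFn .z).reverse) := by
  simp only [threePathState, Threads.State.verts, List.map_append, List.map_reverse,
    List.map_ofFn]
  rfl

theorem threePathState_verts_nodup : (threePathState R).verts.Nodup := by
  rw [threePathState_verts]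
  have hx : Function.Injective (ThreePathVertex.x (p₁ := p₁) (p₂ := p₂) (p₃ := p₃)) :=
    fun _ _ => ThreePathVertex.x.inj
  have hy : Function.Injective (ThreePathVertex.y (p₁ := p₁) (p₂ := p₂) (p₃ := p₃)) :=
    fun _ _ => ThreePathVertex.y.inj
  have hz : Function.Injective (ThreePathVertex.z (p₁ := p₁) (p₂ := p₂) (p₃ := p₃)) :=
    fun _ _ => ThreePathVertex.z.inj
  simp [List.nodup_cons, List.nodup_append, List.nodup_reverse, List.nodup_ofFn, hx, hy, hz]
  rintro j _ (⟨i, rfl⟩ | ⟨i, rfl⟩) <;> exact nofun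

theorem mem_threePathState_verts (x : ThreePathVertex p₁ p₂ p₃) :
    x ∈ (threePathState R).verts := by
  rw [threePathState_verts]
  cases x <;> simp

/-- The threads given by a set of relations on the quiver made of three paths. -/
noncomputable def threePathThreads : Threads (ThreePathVertex p₁ p₂ p₃) :=
  .ofList (threePathState R).list (Threads.State.list_nodup (threePathState_verts_nodup R))

/-- The position at which an arrow starts. -/
noncomputable def threePathTail : ThreePathArrow p₁ p₂ p₃ → ThreePathVertex p₁ p₂ p₃ × Bool
  | .α i => pathVertex p₁ (.u, true) (.v, true) (fun j => Threads.out (wordα R j)) (i + 1)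
  | .β i => pathVertex p₂ (.v, true) (.u, false) (fun j => Threads.out (wordβ R j)) (i + 1)
  | .γ i => pathVertex p₃ (.u, false) (.v, false) (fun j => Threads.out (wordγ R j)) (i + 1)

/-- The position at which an arrow ends. -/
noncomputable def threePathHead : ThreePathArrow p₁ p₂ p₃ → ThreePathVertex p₁ p₂ p₃ × Bool
  | .α i => pathVertex p₁ (.u, true) (.v, true) (fun j => (wordα R j).1) i
  | .β i => pathVertex p₂ (.v, true) (.u, false) (fun j => (wordβ R j).1) i
  | .γ i => pathVertex p₃ (.u, false) (.v, false) (fun j => (wordγ R j).1) i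

theorem threePathTail_fst (a : ThreePathArrow p₁ p₂ p₃) :
    (threePathTail R a).1 = (threePathQuiver p₁ p₂ p₃).s a := by
  rcases a with i | i | i <;> refine (pathVertex_map Prod.fst _ _ _ _ _).trans ?_ <;>
    simp only [Threads.out_fst] <;> rfl

theorem threePathHead_fst (a : ThreePathArrow p₁ p₂ p₃) :
    (threePathHead R a).1 = (threePathQuiver p₁ p₂ p₃).t a := by
  rcases a with i | i | i <;> exact pathVertex_map Prod.fst _ _ _ _ _

theorem threePathHead_injective (hp₁ : 0 < p₁) (hp₂ : 0 < p₂) (hp₃ : 0 < p₃) :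
    Function.Injective (threePathHead R) := by
  -- A left inverse, recovering an arrow from the position where it ends; its value at positions
  -- where no arrow ends is arbitrary.
  let g : ThreePathVertex p₁ p₂ p₃ × Bool → ThreePathArrow p₁ p₂ p₃
    | (.u, true) => .α ⟨0, hp₁⟩
    | (.u, false) => .γ ⟨0, hp₃⟩
    | (.v, _) => .β ⟨0, hp₂⟩
    | (.x j, _) => .α ⟨j + 1, by omega⟩
    | (.y j, _) => .β ⟨j + 1, by omega⟩
    | (.z j, _) => .γ ⟨j + 1, by omega⟩
  refine Function.LeftInverse.injective (g := g) ?_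
  rintro (i | i | i) <;> dsimp only [threePathHead] <;>
    rcases pathVertex_target i with ⟨h₁, h₂⟩ | ⟨j, h₁, h₂⟩ <;> rw [h₂]
  · exact congrArg _ (Fin.ext h₁.symm)
  · exact congrArg _ (Fin.ext h₁)
  · exact congrArg _ (Fin.ext h₁.symm)
  · exact congrArg _ (Fin.ext h₁)
  · exact congrArg _ (Fin.ext h₁.symm)
  · exact congrArg _ (Fin.ext h₁)

theorem adj_threePathState (hp₁ : 0 < p₁) (hp₂ : 0 < p₂) (hp₃ : 0 < p₃)
    (x y : ThreePathVertex p₁ p₂ p₃ × Bool) : ThreadList.adj (threePathState R).list x y ↔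
      ∃ a, threePathTail R a = x ∧ threePathHead R a = y := by
  have h : ∀ P : ThreePathArrow p₁ p₂ p₃ → Prop, (∃ a, P a) ↔
      (∃ i, P (.γ i)) ∨ (∃ i, P (.β i)) ∨ ∃ i, P (.α i) := by
    intro P
    constructor
    · rintro ⟨i | i | i, h⟩
      · exact Or.inr (Or.inr ⟨i, h⟩)
      · exact Or.inr (Or.inl ⟨i, h⟩)
      · exact Or.inl ⟨i, h⟩
    · rintro (⟨i, h⟩ | ⟨i, h⟩ | ⟨i, h⟩) <;> exact ⟨_, h⟩
  rw [h, Threads.State.adj_list]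
  exact or_congr (Threads.adj_segment hp₃ _ _ _ x y)
    (or_congr (Threads.adj_segment hp₂ _ _ _ x y) (Threads.adj_segment hp₁ _ _ _ x y))

/-- At inner vertices the marks were chosen to match the relations. At `v`, the relation `γ_{p₃} β₁`
excludes `α_{p₁} β₁` because at most one arrow may form a relation with `β₁` on that side. At `u`,
likewise, `β_{p₂} α₁` excludes `β_{p₂} γ₁`. -/
theorem relMem_threePath_iff {k : Type u} [Field k] (hp₁ : 0 < p₁) (hp₂ : 0 < p₂) (hp₃ : 0 < p₃)
    (hR : FinQuiver.IsGentle k R)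
    (hβα : FinQuiver.RelMem R (.β ⟨p₂ - 1, Nat.sub_one_lt_of_lt hp₂⟩) (.α ⟨0, hp₁⟩))
    (hγβ : FinQuiver.RelMem R (.γ ⟨p₃ - 1, Nat.sub_one_lt_of_lt hp₃⟩) (.β ⟨0, hp₂⟩))
    (a b : ThreePathArrow p₁ p₂ p₃)
    (hab : (threePathQuiver p₁ p₂ p₃).s a = (threePathQuiver p₁ p₂ p₃).t b) :
    FinQuiver.RelMem R a b ↔ threePathHead R b ≠ threePathTail R a := by
  have hlast : ∀ {p : ℕ} (hp : 0 < p) {i : Fin p}, (i : ℕ) + 1 = p →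
      i = ⟨p - 1, Nat.sub_one_lt_of_lt hp⟩ := fun _ _ h => Fin.ext (by dsimp only; omega)
  have hfirst : ∀ {p : ℕ} (hp : 0 < p) {i : Fin p}, (i : ℕ) = 0 → i = ⟨0, hp⟩ :=
    fun _ _ h => Fin.ext h
  have hlastγ : (threePathQuiver p₁ p₂ p₃).s (.γ ⟨p₃ - 1, Nat.sub_one_lt_of_lt hp₃⟩) = .v := by
    refine Eq.trans ?_ (pathVertex_self hp₃ ThreePathVertex.u .v .z)
    exact congrArg (pathVertex p₃ ThreePathVertex.u .v .z) (Nat.sub_add_cancel hp₃)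
  rcases a with i | i | i <;> rcases b with i' | i' | i' <;>
    dsimp only [threePathQuiver] at hab <;>
    rcases pathVertex_source i with ⟨h₁, h₂⟩ | ⟨j, h₁, h₂⟩ <;>
    rcases pathVertex_target i' with ⟨h₁', h₂'⟩ | ⟨j', h₁', h₂'⟩ <;>
    rw [h₂, h₂'] at hab <;> try cases hab
  · exact pathWord_ne_out_iff R _ _ _ _ (by omega)
  · obtain rfl := hlast hp₁ h₁
    obtain rfl := hfirst hp₂ h₁'
    dsimp only [threePathHead, threePathTail]
    rw [h₂, h₂']
    refine iff_of_false (fun h => ?_) fun h => h rfl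
    nomatch hR.left_unique_rel (.β ⟨0, hp₂⟩) (.α _) (.γ _)
      (h₂ ThreePathVertex.u .v .x) h hlastγ hγβ
  · obtain rfl := hlast hp₂ h₁
    obtain rfl := hfirst hp₁ h₁'
    dsimp only [threePathHead, threePathTail]
    rw [h₂, h₂']
    exact iff_of_true hβα (by simp)
  · exact pathWord_ne_out_iff R _ _ _ _ (by omega)
  · obtain rfl := hlast hp₂ h₁
    obtain rfl := hfirst hp₃ h₁'
    dsimp only [threePathHead, threePathTail]
    rw [h₂, h₂']
    refine iff_of_false (fun h => ?_) fun h => h rfl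
    nomatch hR.right_unique_rel (.β _) (.α ⟨0, hp₁⟩) (.γ ⟨0, hp₃⟩)
      (h₂ ThreePathVertex.v .u .y).symm hβα (h₂ ThreePathVertex.v .u .y).symm h
  · obtain rfl := hlast hp₃ h₁
    obtain rfl := hfirst hp₂ h₁'
    dsimp only [threePathHead, threePathTail]
    rw [h₂, h₂']
    exact iff_of_true hγβ (by simp)
  · exact pathWord_ne_out_iff R _ _ _ _ (by omega)

/-- The description by threads of a gentle bound quiver made of three paths. -/
noncomputable def threePathThreadData {k : Type u} [Field k]
    (hp₁ : 0 < p₁) (hp₂ : 0 < p₂) (hp₃ : 0 < p₃) (hR : FinQuiver.IsGentle k R)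
    (hβα : FinQuiver.RelMem R (.β ⟨p₂ - 1, Nat.sub_one_lt_of_lt hp₂⟩) (.α ⟨0, hp₁⟩))
    (hγβ : FinQuiver.RelMem R (.γ ⟨p₃ - 1, Nat.sub_one_lt_of_lt hp₃⟩) (.β ⟨0, hp₂⟩)) :
    FinQuiver.ThreadData R (threePathThreads R) where
  vertex := Equiv.refl _
  tail := threePathTail R
  head := threePathHead R
  tail_fst := threePathTail_fst R
  head_fst := threePathHead_fst R
  head_injective := threePathHead_injective R hp₁ hp₂ hp₃
  lt_iff x y := by
    refine (ThreadList.before_iff_transGen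
      (Threads.State.list_nodup (threePathState_verts_nodup R))).trans ?_
    rw [show ThreadList.adj (threePathState R).list =
      fun x y => ∃ a, threePathTail R a = x ∧ threePathHead R a = y from
        funext fun x => funext fun y => propext (adj_threePathState R hp₁ hp₂ hp₃ x y)]
    rfl
  length_eq_two := hR.length_eq_two
  rel_iff := relMem_threePath_iff R hp₁ hp₂ hp₃ hR hβα hγβ

end ThreePath

/-! ### Conclusion: from bound quivers to threads and back. -/

theorem FinQuiver.ThreadData.tiltCotiltStep {Q : FinQuiver} {R : Set Q.Path} {V : Type}
    [Fintype V] [DecidableEq V] [Nonempty V] {D : Threads V} (k : Type u) [Field k]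
    (T : ThreadData R D) (hD : D.Connected) :
    TiltCotiltStep (AlgCat.of k (D.algebra k)) (AlgCat.of k (BoundQuiverAlgebra k R)) ∧
      TiltCotiltStep (AlgCat.of k (BoundQuiverAlgebra k R)) (AlgCat.of k (D.algebra k)) := by
  have := Module.Finite.equiv (T.algEquiv k).symm.toLinearEquiv
  exact ⟨tiltCotiltStep_of_algEquiv (D.pointed k) (hD.noCentralIdempotents k) (T.algEquiv k),
    tiltCotiltStep_of_algEquiv ((D.pointed k).congr (T.algEquiv k).symm)
      ((hD.noCentralIdempotents k).congr (T.algEquiv k).symm.toRingEquiv) (T.algEquiv k).symm⟩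

theorem mainTheorem7 {k : Type u} [Field k] [IsAlgClosed k] (p₁ p₂ p₃ : ℕ)
    (hp₁ : 0 < p₁) (hp₂ : 0 < p₂) (hp₃ : 0 < p₃)
    (R : Set (threePathQuiver p₁ p₂ p₃).Path)
    (hR : FinQuiver.IsGentle k R)
    (hβα : FinQuiver.RelMem R (.β ⟨p₂ - 1, Nat.sub_one_lt_of_lt hp₂⟩) (.α ⟨0, hp₁⟩))
    (hγβ : FinQuiver.RelMem R (.γ ⟨p₃ - 1, Nat.sub_one_lt_of_lt hp₃⟩) (.β ⟨0, hp₂⟩)) :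
    ∃ p r : ℕ, 1 ≤ p ∧ r ≤ p - 1 ∧
      TiltCotiltEquivalent (AlgCat.of k (FinQuiver.BoundQuiverAlgebra k R))
        (AlgCat.of k (Lambda0 k p r)) := by
  classical
  have : Nonempty (ThreePathVertex p₁ p₂ p₃) := ⟨.u⟩
  have hn := threePathState_verts_nodup R
  have T := threePathThreadData R hp₁ hp₂ hp₃ hR hβα hγβ
  have hD := T.connected hR.connected
  obtain ⟨v, u, b, s, r, hb, hperm, htilt⟩ :=
    Threads.State.exists_reaches (k := k) (threePathState R)
  obtain ⟨D', hD', hL', hDD'⟩ := htilt hn _ hD (Threads.hasList_ofList _ _)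
  obtain ⟨p, r, hp, hr, ⟨T'⟩⟩ := exists_lambda0_threadData v u b s r hb (hperm.nodup_iff.2 hn)
    (fun x => hperm.mem_iff.2 (mem_threePathState_verts R x)) hL'
  -- The chain of reflections is framed by the isomorphisms of the two bound quiver algebras with
  -- their thread algebras, each of which counts as a tilting step.
  exact ⟨p, r, hp, hr, (Relation.ReflTransGen.head (T.tiltCotiltStep k hD).2 hDD').tail
    (T'.tiltCotiltStep k hD').1⟩
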